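/- Let $n\in\mathbb{N}$, $\ell\ge 1$, let $R$ be an integral domain, $\xi\in R^\times$ and $Q_1,\dots,Q_\ell\in R$. Let $\mathcal{H}_{n,R}=\mathcal{H}_{n,R}(\xi,Q_1,\dots,Q_\ell)$ be the cyclotomic Hecke algebra of type $A$, that is, the unital associative $R$-algebra with generators $L_1,\dots,L_n,T_1,\dots,T_{n-1}$ and relations $$\prod_{l=1}^{\ell}(L_1-Q_l)=0 \ \ (n\ge 1),\qquad (T_r+1)(T_r-\xi)=0,\qquad L_iL_j=L_jL_i,$$ $$T_rT_s=T_sT_r\ \text{ if } |r-s|>1,\qquad T_sT_{s+1}T_s=T_{s+1}T_sT_{s+1}\ \ (1\le s<n-1),$$ $$T_rL_t=L_tT_r\ \text{ if } t\ne r,r+1,\qquad L_{r+1}(T_r-\xi+1)=T_rL_r+1\ \ (1\le r<n).$$ For $w\in\mathfrak{S}_n$ with a reduced expression $w=s_{i_1}\cdots s_{i_k}$ in the simple transpositions $s_a=(a,a+1)$, put $T_w=T_{i_1}\cdots T_{i_k}$. Then $T_w$ does not depend on the reduced expression, and the elements $L_1^{c_1}\cdots L_n^{c_n}T_w$ ($0\le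 c_1,\dots,c_n<\ell$, $w\in\mathfrak{S}_n$) form an $R$-basis of $\mathcal{H}_{n,R}$. Let $\tau_R:\mathcal{H}_{n,R}\to R$ be the $R$-linear map determined by $$\tau_R(L_1^{c_1}\cdots L_n^{c_n}T_w)=\begin{cases}(1-\xi)^{\,n(\ell-1)-\sum_{i=1}^n c_i}, & w=1,\\ 0, & w\neq 1,\end{cases}$$ where $0^0:=1$ if $\xi=1$. Then $\tau_R(xy)=\tau_R(yx)$ for all $x,y\in\mathcal{H}_{n,R}$; in other words, the bilinear form $(x,y)\mapsto\tau_R(xy)$ on $\mathcal{H}_{n,R}$ is symmetric. -/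

import Mathlib

/-! # The cyclotomic Hecke algebra of type `A` in its unified presentation

All indices are shifted to start at `0`: the generators `L_1, …, L_n` are indexed by `Fin n` and
`T_1, …, T_{n-1}` by `Fin (n - 1)`, where `r : Fin (n - 1)` stands for the simple transposition
exchanging positions `r` and `r + 1`. -/

namespace CyclotomicHecke

/-- The position `r`, as an element of `Fin n`. -/
def lo {n : ℕ} (r : Fin (n - 1)) : Fin n := ⟨r.1, by omega⟩

/-- The position `r + 1`, as an element of `Fin n`. -/
def hi {n : ℕ} (r : Fin (n - 1)) : Fin n := ⟨r.1 + 1, by omega⟩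

/-- The symbols `L_i` and `T_r` for the generators. -/
inductive Gen (n : ℕ) : Type
  | L (i : Fin n) : Gen n
  | T (r : Fin (n - 1)) : Gen n

section Presentation

variable (R : Type*) [CommRing R]

/-- `L_i` in the free algebra. -/
def freeL {n : ℕ} (i : Fin n) : FreeAlgebra R (Gen n) := FreeAlgebra.ι R (Gen.L i)

/-- `T_r` in the free algebra. -/
def freeT {n : ℕ} (r : Fin (n - 1)) : FreeAlgebra R (Gen n) := FreeAlgebra.ι R (Gen.T r)

/-- The defining relations. -/
inductive Rel (n ℓ : ℕ) (ξ : Rˣ) (Q : Fin ℓ → R) :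
    FreeAlgebra R (Gen n) → FreeAlgebra R (Gen n) → Prop
  /-- `(L_1 - Q_1) ⋯ (L_1 - Q_ℓ) = 0` -/
  | cyclotomic (i : Fin n) (hi : i.1 = 0) :
      Rel n ℓ ξ Q
        (List.ofFn fun l : Fin ℓ => freeL R i - algebraMap R (FreeAlgebra R (Gen n)) (Q l)).prod 0
  /-- `(T_r + 1) (T_r - ξ) = 0` -/
  | quadratic (r : Fin (n - 1)) :
      Rel n ℓ ξ Q
        ((freeT R r + 1) * (freeT R r - algebraMap R (FreeAlgebra R (Gen n)) (ξ : R))) 0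
  /-- `L_i L_j = L_j L_i` -/
  | comm_L (i j : Fin n) :
      Rel n ℓ ξ Q (freeL R i * freeL R j) (freeL R j * freeL R i)
  /-- `T_r T_s = T_s T_r` if `|r - s| > 1` -/
  | comm_T (r s : Fin (n - 1)) (h : r.1 + 1 < s.1 ∨ s.1 + 1 < r.1) :
      Rel n ℓ ξ Q (freeT R r * freeT R s) (freeT R s * freeT R r)
  /-- `T_r T_{r+1} T_r = T_{r+1} T_r T_{r+1}` -/
  | braid (r s : Fin (n - 1)) (h : s.1 = r.1 + 1) :
      Rel n ℓ ξ Q (freeT R r * freeT R s * freeT R r) (freeT R s * freeT R r * freeT R s)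
  /-- `T_r L_t = L_t T_r` if `t ≠ r, r + 1` -/
  | comm_TL (r : Fin (n - 1)) (t : Fin n) (h₁ : t ≠ lo r) (h₂ : t ≠ hi r) :
      Rel n ℓ ξ Q (freeT R r * freeL R t) (freeL R t * freeT R r)
  /-- `L_{r+1} (T_r - ξ + 1) = T_r L_r + 1` -/
  | skein (r : Fin (n - 1)) :
      Rel n ℓ ξ Q
        (freeL R (hi r) * (freeT R r - algebraMap R (FreeAlgebra R (Gen n)) (ξ : R) + 1))
        (freeT R r * freeL R (lo r) + 1)

end Presentation

/-- The cyclotomic Hecke algebra `H_{n,R}(ξ, Q_1, …, Q_ℓ)` of type `A`: the free algebra on the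
generators modulo the two-sided ideal generated by the defining relations. -/
def HeckeAlg {R : Type*} [CommRing R] (n ℓ : ℕ) (ξ : Rˣ) (Q : Fin ℓ → R) : Type _ :=
  RingQuot (Rel R n ℓ ξ Q)

section Algebra

variable {R : Type*} [CommRing R] {n ℓ : ℕ} (ξ : Rˣ) (Q : Fin ℓ → R)

noncomputable instance : Ring (HeckeAlg n ℓ ξ Q) :=
  inferInstanceAs (Ring (RingQuot (Rel R n ℓ ξ Q)))

noncomputable instance : Algebra R (HeckeAlg n ℓ ξ Q) :=
  inferInstanceAs (Algebra R (RingQuot (Rel R n ℓ ξ Q)))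

/-- The generator `L_i` of the Hecke algebra. -/
noncomputable def L (i : Fin n) : HeckeAlg n ℓ ξ Q :=
  RingQuot.mkAlgHom R (Rel R n ℓ ξ Q) (freeL R i)

/-- The generator `T_r` of the Hecke algebra. -/
noncomputable def T (r : Fin (n - 1)) : HeckeAlg n ℓ ξ Q :=
  RingQuot.mkAlgHom R (Rel R n ℓ ξ Q) (freeT R r)

end Algebra

/-! ### Reduced words in the symmetric group -/

/-- The element `s_{i_1} ⋯ s_{i_k}` of the symmetric group. -/
def wordPerm {n : ℕ} (s : List (Fin (n - 1))) : Equiv.Perm (Fin n) :=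
  (s.map fun r => Equiv.swap (lo r) (hi r)).prod

/-- A word in the simple transpositions is reduced if no shorter word has the same product. -/
def IsReduced {n : ℕ} (s : List (Fin (n - 1))) : Prop :=
  ∀ t : List (Fin (n - 1)), wordPerm t = wordPerm s → s.length ≤ t.length

theorem exists_word {n : ℕ} (w : Equiv.Perm (Fin n)) :
    ∃ s : List (Fin (n - 1)), wordPerm s = w := by
  cases n with
  | zero => exact ⟨[], Subsingleton.elim _ _⟩
  | succ m =>
    have hw : w ∈ Submonoid.closure
        (Set.range fun i : Fin m => Equiv.swap i.castSucc i.succ) := by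
      rw [Equiv.Perm.mclosure_swap_castSucc_succ]; trivial
    induction hw using Submonoid.closure_induction with
    | mem x hx =>
      obtain ⟨i, rfl⟩ := hx
      refine ⟨[(i : Fin (m + 1 - 1))], ?_⟩
      simp only [wordPerm, List.map_cons, List.map_nil, List.prod_cons, List.prod_nil, mul_one]
      rfl
    | one => exact ⟨[], rfl⟩
    | mul x y _ _ hx hy =>
      obtain ⟨s, rfl⟩ := hx
      obtain ⟨t, rfl⟩ := hy
      exact ⟨s ++ t, by simp [wordPerm]⟩

theorem exists_reduced_word {n : ℕ} (w : Equiv.Perm (Fin n)) :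
    ∃ s : List (Fin (n - 1)), wordPerm s = w ∧ IsReduced s := by
  classical
  have h : ∃ k, ∃ s : List (Fin (n - 1)), s.length = k ∧ wordPerm s = w :=
    let ⟨s, hs⟩ := exists_word w
    ⟨s.length, s, rfl, hs⟩
  obtain ⟨s, hs, hw⟩ := Nat.find_spec h
  refine ⟨s, hw, fun t ht => ?_⟩
  rw [hs]
  exact Nat.find_min' h ⟨t, rfl, ht.trans hw⟩

/-- A chosen reduced expression of `w`. -/
noncomputable def reducedWord {n : ℕ} (w : Equiv.Perm (Fin n)) : List (Fin (n - 1)) :=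
  (exists_reduced_word w).choose

/-! ### Standard monomials and the trace function -/

section Trace

variable {R : Type*} [CommRing R] {n ℓ : ℕ} (ξ : Rˣ) (Q : Fin ℓ → R)

/-- The product `T_{i_1} ⋯ T_{i_k}`. -/
noncomputable def wordT (s : List (Fin (n - 1))) : HeckeAlg n ℓ ξ Q :=
  (s.map fun r => T ξ Q r).prod

/-- The element `T_w`, by means of the chosen reduced expression of `w`. -/
noncomputable def Tw (w : Equiv.Perm (Fin n)) : HeckeAlg n ℓ ξ Q :=
  wordT ξ Q (reducedWord w)

/-- The standard monomial `L_1^{c_1} ⋯ L_n^{c_n} T_w`, where `0 ≤ c_i < ℓ`. -/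
noncomputable def monomial (c : Fin n → Fin ℓ) (w : Equiv.Perm (Fin n)) : HeckeAlg n ℓ ξ Q :=
  (List.ofFn fun i : Fin n => L ξ Q i ^ (c i : ℕ)).prod * Tw ξ Q w

/-- The prescribed value of the trace function on `L_1^{c_1} ⋯ L_n^{c_n} T_w`. The subtraction in
the exponent does not truncate, since `c_i ≤ ℓ - 1` for all `i`. -/
def traceValue (c : Fin n → Fin ℓ) (w : Equiv.Perm (Fin n)) : R :=
  if w = 1 then (1 - (ξ : R)) ^ (n * (ℓ - 1) - ∑ i, (c i : ℕ)) else 0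

/-- The trace function: the `R`-linear extension of the prescribed values on a basis `b` indexed
by the standard monomials. -/
noncomputable def trace
    (b : Module.Basis ((Fin n → Fin ℓ) × Equiv.Perm (Fin n)) R (HeckeAlg n ℓ ξ Q)) :
    HeckeAlg n ℓ ξ Q →ₗ[R] R :=
  b.constr R fun p => traceValue ξ p.1 p.2

/-- The bilinear form `(x, y) ↦ τ (x y)` induced by a linear function `τ`. -/
noncomputable def inducedForm (τ : HeckeAlg n ℓ ξ Q →ₗ[R] R) :
    LinearMap.BilinForm R (HeckeAlg n ℓ ξ Q) :=
  (LinearMap.mul R (HeckeAlg n ℓ ξ Q)).compr₂ τ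

end Trace

end CyclotomicHecke

/-! Indices start at `0`, and `d = ℓ - 1`. The algebra acts on `lowDegree R n d`, a model of `R[x_0,
…, x_{n-1}] / (∏_l (x_i - Q_l))_i` tensored with the finite Hecke algebra. `L_0` is multiplication
by `x_0` followed by reduction. `T_r` exchanges `x_r` and `x_{r+1}` while multiplying by the finite
`T_r` on the left, plus the Demazure operator `f ↦ (1 + (ξ - 1) x_{r+1}) (f - s f) / (x_{r+1} -
x_r)`. The other `L_i` are determined by `L_0` and the `T_r`, so only relations of type `B` need
checking (`exists_algHom`); the substantial ones are `opT_braid` and `opL_comm`.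

The standard monomial `L^c T_w` sends the unit vector to `x^c` placed at `w`, so these monomials are
linearly independent. A Mackey decomposition of the tower of subalgebras `A_k = sub k`
(`sub_le_mackey`) yields a spanning set of at most `ℓ^n n!` elements, and counting gives the basis
(`coord_bijective`).

Hence `τ x` is `polyTrace`, the functional `x^c ↦ (1 - ξ)^(n d - |c|)`, applied to the value at `1`
of `x` acting on the unit vector. It is symmetric in the variables and, because `(1 - ξ)^(m+1) + (ξ
- 1) (1 - ξ)^m = 0`, it kills Demazure images. So `τ (T_r x)` is `ξ` times `polyTrace` of the value
at `s_r`, and `τ (x T_r)` is the same because right multiplication commutes with the action. There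
remains `L_0`. Peeling off the tower from the top writes every element through products of powers of
the `L_i`, which commute with `L_0`, and products `g T g' L^c` with `g, g' ∈ A_k`, `T` exchanging `k
- 1` and `k`, and `L^c` involving only later `L_i`. The latter have trace zero
(`repTrace_mul_natT_mul`), also after multiplication by `L_0` on either side. -/

namespace CyclotomicHecke

open MvPolynomial

/-! ### Divided differences and Demazure operators. -/

section Poly

set_option linter.unusedSectionVars false

variable {R : Type*} [CommRing R] {σ : Type*} [DecidableEq σ]

/-- Exchanging the variables `i` and `j`. -/
noncomputable def swapVar (i j : σ) : MvPolynomial σ R →ₐ[R] MvPolynomial σ R :=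
  rename (Equiv.swap i j)

@[simp] theorem swapVar_swapVar (i j : σ) (f : MvPolynomial σ R) :
    swapVar i j (swapVar i j f) = f := by
  simp only [swapVar, rename_rename]
  convert rename_id_apply f
  ext x; simp

theorem swapVar_comm (i j : σ) : (swapVar i j : MvPolynomial σ R →ₐ[R] _) = swapVar j i := by
  simp [swapVar, Equiv.swap_comm]

@[simp] theorem swapVar_X_left (i j : σ) : swapVar i j (X i : MvPolynomial σ R) = X j := by
  simp [swapVar]

@[simp] theorem swapVar_X_right (i j : σ) : swapVar i j (X j : MvPolynomial σ R) = X i := by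
  simp [swapVar]

theorem swapVar_X_of_ne {i j k : σ} (hi : k ≠ i) (hj : k ≠ j) :
    swapVar i j (X k : MvPolynomial σ R) = X k := by
  simp [swapVar, Equiv.swap_apply_of_ne_of_ne hi hj]

theorem rename_swapVar (e : Equiv.Perm σ) (i j : σ) (f : MvPolynomial σ R) :
    rename e (swapVar i j f) = swapVar (e i) (e j) (rename e f) := by
  simp only [swapVar, rename_rename]
  congr 1; congr 1
  ext x; simp [Equiv.swap_apply_apply]

/-- The twisted Leibniz rule `f g - s(f g) = (f - s f) g + s f (g - s g)` reduces divisibility to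
constants and variables. -/
theorem sub_swapVar_dvd (i j : σ) (f : MvPolynomial σ R) :
    (X j - X i : MvPolynomial σ R) ∣ f - swapVar i j f := by
  induction f using MvPolynomial.induction_on with
  | C a => simp [swapVar]
  | add p q hp hq =>
    rw [map_add, add_sub_add_comm]; exact dvd_add hp hq
  | mul_X p k hp =>
    have h : p * X k - swapVar i j (p * X k) =
        (p - swapVar i j p) * X k + swapVar i j p * (X k - swapVar i j (X k)) := by
      rw [map_mul]; ring
    rw [h]
    refine dvd_add (hp.mul_right _) (Dvd.dvd.mul_left ?_ _)
    by_cases hi : k = i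
    · subst hi; simpa using (dvd_sub_comm.1 (dvd_refl (X j - X k : MvPolynomial σ R)))
    · by_cases hj : k = j
      · subst hj; simp
      · simp [swapVar_X_of_ne hi hj]

variable [IsDomain R]

theorem X_sub_X_ne_zero {i j : σ} (h : i ≠ j) : (X j - X i : MvPolynomial σ R) ≠ 0 := by
  rw [sub_ne_zero]; exact fun e => h (X_injective e).symm

open Classical in
/-- The divided difference `(f - s f) / (x_j - x_i)`, where `s` exchanges `x_i` and `x_j`
(and `0` if `i = j`). -/
noncomputable def divDiff (i j : σ) : MvPolynomial σ R →ₗ[R] MvPolynomial σ R :=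
  if h : i ≠ j then
    { toFun := fun f => (sub_swapVar_dvd i j f).choose
      map_add' := fun f g => mul_left_cancel₀ (X_sub_X_ne_zero h) (by
        rw [mul_add, ← (sub_swapVar_dvd i j f).choose_spec,
          ← (sub_swapVar_dvd i j g).choose_spec,
          ← (sub_swapVar_dvd i j (f + g)).choose_spec, map_add]; ring)
      map_smul' := fun c f => mul_left_cancel₀ (X_sub_X_ne_zero h) (by
        rw [RingHom.id_apply, mul_smul_comm, ← (sub_swapVar_dvd i j f).choose_spec,
          ← (sub_swapVar_dvd i j (c • f)).choose_spec, map_smul, smul_sub]) }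
  else 0

theorem mul_divDiff {i j : σ} (h : i ≠ j) (f : MvPolynomial σ R) :
    (X j - X i) * divDiff i j f = f - swapVar i j f := by
  rw [divDiff, dif_pos h]
  exact ((sub_swapVar_dvd i j f).choose_spec).symm

/-- Over a domain the defining equation pins down the chosen quotient, so identities can be checked
after multiplication by `X j - X i`. -/
theorem eq_divDiff {i j : σ} (h : i ≠ j) {f g : MvPolynomial σ R}
    (hg : (X j - X i) * g = f - swapVar i j f) : divDiff i j f = g :=
  mul_left_cancel₀ (X_sub_X_ne_zero h) ((mul_divDiff h f).trans hg.symm)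

theorem swapVar_divDiff {i j : σ} (h : i ≠ j) (f : MvPolynomial σ R) :
    swapVar i j (divDiff i j f) = divDiff i j f := by
  refine mul_left_cancel₀ (X_sub_X_ne_zero h) ?_
  have := congrArg (swapVar i j) (mul_divDiff h f)
  simp only [map_mul, map_sub, swapVar_X_left, swapVar_X_right, swapVar_swapVar] at this
  rw [mul_divDiff h]
  linear_combination -this

theorem rename_divDiff (e : Equiv.Perm σ) (i j : σ) (f : MvPolynomial σ R) :
    rename e (divDiff i j f) = divDiff (e i) (e j) (rename e f) := by
  by_cases h : i = j
  · simp [divDiff, h]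
  symm
  apply eq_divDiff (e.injective.ne h)
  have := congrArg (rename e) (mul_divDiff h f)
  simpa [rename_swapVar] using this

variable (z : R)

/-- The linear polynomial `1 + (z - 1) x_i`. -/
noncomputable def linX (i : σ) : MvPolynomial σ R := 1 + C (z - 1) * X i

@[simp] theorem rename_linX (e : Equiv.Perm σ) (i : σ) :
    rename e (linX z i) = linX z (e i) := by simp [linX]

@[simp] theorem swapVar_linX_right (i j : σ) : swapVar i j (linX z j) = linX z i := by
  simp [swapVar]

/-- The operator `f ↦ (1 + (z - 1) x_j) (f - s f) / (x_j - x_i)`. -/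
noncomputable def demazure (i j : σ) : MvPolynomial σ R →ₗ[R] MvPolynomial σ R :=
  LinearMap.mulLeft R (linX z j) ∘ₗ divDiff i j

theorem demazure_apply (i j : σ) (f : MvPolynomial σ R) :
    demazure z i j f = linX z j * divDiff i j f := rfl

theorem mul_demazure {i j : σ} (h : i ≠ j) (f : MvPolynomial σ R) :
    (X j - X i) * demazure z i j f = linX z j * (f - swapVar i j f) := by
  rw [demazure_apply, mul_left_comm, mul_divDiff h]

theorem rename_demazure (e : Equiv.Perm σ) (i j : σ) (f : MvPolynomial σ R) :
    rename e (demazure z i j f) = demazure z (e i) (e j) (rename e f) := by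
  simp [demazure_apply, rename_divDiff]

theorem swapVar_demazure (k l i j : σ) (f : MvPolynomial σ R) :
    swapVar k l (demazure z i j f) =
      demazure z (Equiv.swap k l i) (Equiv.swap k l j) (swapVar k l f) :=
  rename_demazure z _ i j f

/-- A divided difference is symmetric in the two variables, so the second application only sees the
factor `linX z j`, whose own divided difference is `z - 1`. -/
theorem demazure_demazure {i j : σ} (h : i ≠ j) (f : MvPolynomial σ R) :
    demazure z i j (demazure z i j f) = C (z - 1) * demazure z i j f := by
  refine mul_left_cancel₀ (X_sub_X_ne_zero h) ?_
  rw [mul_demazure z h]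
  simp only [demazure_apply, map_mul, swapVar_divDiff h, swapVar_linX_right]
  simp only [linX]
  ring

/-- These are the mixed terms in the quadratic relation for `opT`. The divided difference changes
sign when its argument is swapped, which leaves the factor `linX z i - linX z j`. -/
theorem swapVar_demazure_add {i j : σ} (h : i ≠ j) (f : MvPolynomial σ R) :
    swapVar i j (demazure z i j f) + demazure z i j (swapVar i j f) =
      C (z - 1) * (swapVar i j f - f) := by
  have h2 := mul_divDiff h f
  have h3 : divDiff i j (swapVar i j f) = - divDiff i j f := by
    apply eq_divDiff h
    rw [swapVar_swapVar]; linear_combination -h2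
  simp only [demazure_apply, map_mul, swapVar_divDiff h, swapVar_linX_right, h3]
  simp only [linX]
  linear_combination (-C (z - 1)) * h2

theorem demazure_X_mul {i j : σ} (h : i ≠ j) (f : MvPolynomial σ R) :
    demazure z i j (X i * f) = X j * demazure z i j f - linX z j * f := by
  refine mul_left_cancel₀ (X_sub_X_ne_zero h) ?_
  rw [mul_sub, mul_left_comm, mul_demazure z h, mul_demazure z h]
  simp only [map_mul, swapVar_X_left]
  ring

theorem demazure_mul {i j : σ} (h : i ≠ j) {m : MvPolynomial σ R} (hm : swapVar i j m = m)
    (f : MvPolynomial σ R) : demazure z i j (m * f) = m * demazure z i j f := by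
  refine mul_left_cancel₀ (X_sub_X_ne_zero h) ?_
  rw [mul_left_comm, mul_demazure z h, mul_demazure z h, map_mul, hm]
  ring

theorem demazure_comm {i j k l : σ} (h : i ≠ j) (h' : k ≠ l) (hik : i ≠ k) (hil : i ≠ l)
    (hjk : j ≠ k) (hjl : j ≠ l) (f : MvPolynomial σ R) :
    demazure z i j (demazure z k l f) = demazure z k l (demazure z i j f) := by
  refine mul_left_cancel₀ (X_sub_X_ne_zero h) (mul_left_cancel₀ (X_sub_X_ne_zero h') ?_)
  rw [mul_demazure z h, mul_left_comm _ (X j - X i), mul_demazure z h', swapVar_demazure,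
    swapVar_demazure, Equiv.swap_apply_of_ne_of_ne hik.symm hjk.symm,
    Equiv.swap_apply_of_ne_of_ne hil.symm hjl.symm, Equiv.swap_apply_of_ne_of_ne hik hil,
    Equiv.swap_apply_of_ne_of_ne hjk hjl]
  have e1 := mul_demazure z h' f
  have e2 := mul_demazure z h' (swapVar i j f)
  have e3 := mul_demazure z h f
  have e4 := mul_demazure z h (swapVar k l f)
  have e5 : swapVar k l (swapVar i j f) = swapVar i j (swapVar k l f) := by
    have := rename_swapVar (Equiv.swap k l) i j f
    rwa [Equiv.swap_apply_of_ne_of_ne hik hil, Equiv.swap_apply_of_ne_of_ne hjk hjl] at this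
  rw [e5] at e2
  linear_combination linX z j * e1 - linX z j * e2 - linX z l * e3 + linX z l * e4

section Braid

set_option linter.unusedSimpArgs false

variable {i j k : σ} (hij : i ≠ j) (hjk : j ≠ k) (hik : i ≠ k) (f : MvPolynomial σ R)

theorem swapVar_swap_conj (hjk : j ≠ k) (hik : i ≠ k) : swapVar i k f =
    swapVar i j (swapVar j k (swapVar i j f)) := by
  simp only [swapVar, rename_rename]
  congr 1; congr 1
  ext x
  simp only [Function.comp, Equiv.swap_apply_def]
  split_ifs <;> simp_all

theorem swapVar_braid (hij : i ≠ j) (hjk : j ≠ k) (hik : i ≠ k) :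
    swapVar j k (swapVar i j (swapVar j k f)) =
      swapVar i j (swapVar j k (swapVar i j f)) := by
  simp only [swapVar, rename_rename]
  congr 1; congr 1
  ext x
  simp only [Function.comp, Equiv.swap_apply_def]
  split_ifs <;> simp_all

theorem algebraMap_demazure {K : Type*} [Field K] [Algebra (MvPolynomial σ R) K]
    [IsFractionRing (MvPolynomial σ R) K] (hij : i ≠ j) :
    algebraMap (MvPolynomial σ R) K (demazure z i j f) =
      algebraMap (MvPolynomial σ R) K (linX z j) *
        (algebraMap (MvPolynomial σ R) K f - algebraMap (MvPolynomial σ R) K (swapVar i j f)) /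
        (algebraMap (MvPolynomial σ R) K (X j) - algebraMap (MvPolynomial σ R) K (X i)) := by
  have h0 : algebraMap (MvPolynomial σ R) K (X j) - algebraMap (MvPolynomial σ R) K (X i) ≠ 0 := by
    rw [← map_sub]
    exact (map_ne_zero_iff _ (IsFractionRing.injective _ _)).2 (X_sub_X_ne_zero hij)
  rw [eq_div_iff h0, mul_comm, ← map_sub, ← map_mul, mul_demazure z hij]
  simp

/-- The three identities needed in `opT_braid`, one for each of `F`, `T_r F` and `T_s F` in the
finite Hecke algebra. In the fraction field both sides are linear in the six images of `f` under
permutations of `i, j, k`; with these treated as independent, they become identities of rational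
functions. -/
theorem demazure_relations (hij : i ≠ j) (hjk : j ≠ k) (hik : i ≠ k) :
    demazure z i j (demazure z j k (demazure z i j f)) =
      demazure z j k (demazure z i j (demazure z j k f)) ∧
    demazure z j k (swapVar i j (demazure z j k f)) =
      C (z - 1) * swapVar i j (demazure z j k (swapVar i j f)) +
        swapVar i j (demazure z j k (demazure z i j f)) +
        demazure z i j (demazure z j k (swapVar i j f)) ∧
    demazure z i j (swapVar j k (demazure z i j f)) =
      C (z - 1) * swapVar j k (demazure z i j (swapVar j k f)) +
        swapVar j k (demazure z i j (demazure z j k f)) +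
        demazure z j k (demazure z i j (swapVar j k f)) := by
  set ι := algebraMap (MvPolynomial σ R) (FractionRing (MvPolynomial σ R)) with hι
  have hinj : Function.Injective ι := IsFractionRing.injective _ _
  have h0 : ∀ {a b : σ}, a ≠ b → ι (X b) - ι (X a) ≠ 0 := by
    intro a b hab
    rw [← map_sub]
    exact (map_ne_zero_iff _ hinj).2 (X_sub_X_ne_zero hab)
  have a1 := h0 hij
  have a2 := h0 hjk
  have a3 := h0 hik
  have a1' := h0 hij.symm
  have a2' := h0 hjk.symm
  have a3' := h0 hik.symm
  have key : ∀ {a b : σ}, a ≠ b → ∀ g, ι (demazure z a b g) =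
      ι (linX z b) * (ι g - ι (swapVar a b g)) / (ι (X b) - ι (X a)) :=
    fun hab g => algebraMap_demazure z g hab
  have c1 : ∀ g : MvPolynomial σ R, swapVar i k g = swapVar i j (swapVar j k (swapVar i j g)) :=
    fun g => swapVar_swap_conj g hjk hik
  have c2 : ∀ g : MvPolynomial σ R, swapVar j k (swapVar i j (swapVar j k g)) =
      swapVar i j (swapVar j k (swapVar i j g)) :=
    fun g => swapVar_braid g hij hjk hik
  clear_value ι
  refine ⟨hinj ?_, hinj ?_, hinj ?_⟩ <;>
  · simp only [map_add, map_mul, swapVar_demazure, Equiv.swap_apply_left, Equiv.swap_apply_right,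
      Equiv.swap_apply_of_ne_of_ne hik.symm hjk.symm, Equiv.swap_apply_of_ne_of_ne hij hik,
      Equiv.swap_apply_of_ne_of_ne hij.symm hjk,
      key hij, key hjk, key hik, key hij.symm, key hjk.symm, key hik.symm, swapVar_swapVar,
      swapVar_comm j i, swapVar_comm k j, swapVar_comm k i]
    simp only [c1, c2, swapVar_swapVar]
    simp only [linX, map_add, map_mul, map_one, map_sub] at a1 a2 a3 a1' a2' a3' ⊢
    generalize ι f = f0 at *
    generalize ι (swapVar i j f) = f1 at *
    generalize ι (swapVar j k f) = f2 at *
    generalize ι (swapVar i j (swapVar j k f)) = f12 at *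
    generalize ι (swapVar j k (swapVar i j f)) = f21 at *
    generalize ι (swapVar i j (swapVar j k (swapVar i j f))) = f121 at *
    generalize ι (X i) = x at *
    generalize ι (X j) = y at *
    generalize ι (X k) = w at *
    generalize ι (C z) = c at *
    field_simp
    ring

end Braid

end Poly

end CyclotomicHecke

namespace CyclotomicHecke

open MvPolynomial

/-! ### Degrees and top coefficients in a single variable. -/

section Degree

set_option linter.unusedSectionVars false

variable {R : Type*} [CommRing R] {σ : Type*} [DecidableEq σ]

theorem degreeOf_swapVar (i j k : σ) (f : MvPolynomial σ R) :
    degreeOf k (swapVar i j f) = degreeOf (Equiv.swap i j k) f := by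
  have := degreeOf_rename_of_injective (p := f) (Equiv.swap i j).injective (Equiv.swap i j k)
  rwa [Equiv.swap_apply_self] at this

theorem degreeOf_sub_le_of_le {i : σ} {f g : MvPolynomial σ R} {a : ℕ} (hf : degreeOf i f ≤ a)
    (hg : degreeOf i g ≤ a) : degreeOf i (f - g) ≤ a :=
  (degreeOf_sub_le i f g).trans (max_le hf hg)

theorem degreeOf_add_le_of_le {i : σ} {f g : MvPolynomial σ R} {a : ℕ} (hf : degreeOf i f ≤ a)
    (hg : degreeOf i g ≤ a) : degreeOf i (f + g) ≤ a :=
  (degreeOf_add_le i f g).trans (max_le hf hg)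

theorem degreeOf_mul_le_of_le {i : σ} {f g : MvPolynomial σ R} {a b c : ℕ}
    (hf : degreeOf i f ≤ a) (hg : degreeOf i g ≤ b) (h : a + b ≤ c) : degreeOf i (f * g) ≤ c :=
  (degreeOf_mul_le i f g).trans ((add_le_add hf hg).trans h)

/-- The coefficient of `x_i ^ d` in a polynomial of degree at most `d` in `x_i`. -/
noncomputable def topCoeff (i : σ) (d : ℕ) : MvPolynomial σ R →ₗ[R] MvPolynomial σ R where
  toFun f := f.divMonomial (Finsupp.single i d)
  map_add' f g := add_divMonomial f g _
  map_smul' c f := by ext m; simp [coeff_divMonomial]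

theorem coeff_topCoeff (i : σ) (d : ℕ) (f : MvPolynomial σ R) (m : σ →₀ ℕ) :
    coeff m (topCoeff i d f) = coeff (Finsupp.single i d + m) f :=
  coeff_divMonomial _ _ _

theorem topCoeff_comm (i j : σ) (d e : ℕ) (f : MvPolynomial σ R) :
    topCoeff i d (topCoeff j e f) = topCoeff j e (topCoeff i d f) := by
  ext m; simp only [coeff_topCoeff, add_left_comm]

theorem topCoeff_eq_zero {i : σ} {d : ℕ} {f : MvPolynomial σ R} (h : degreeOf i f < d) :
    topCoeff i d f = 0 := by
  ext m
  rw [coeff_topCoeff, coeff_zero, ← notMem_support_iff]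
  exact notMem_support_of_degreeOf_lt i (h.trans_le (by simp))

theorem topCoeff_succ_X_mul (i : σ) (d : ℕ) (f : MvPolynomial σ R) :
    topCoeff i (d + 1) (X i * f) = topCoeff i d f := by
  ext m
  rw [coeff_topCoeff, coeff_topCoeff, add_comm d 1, Finsupp.single_add, add_assoc, coeff_X_mul]

theorem topCoeff_X_mul {i j : σ} (h : j ≠ i) (d : ℕ) (f : MvPolynomial σ R) :
    topCoeff i d (X j * f) = X j * topCoeff i d f := by
  ext m
  rw [coeff_topCoeff, coeff_X_mul', coeff_X_mul']
  simp only [Finsupp.mem_support_iff, Finsupp.add_apply, Finsupp.single_apply, h.symm, if_false,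
    zero_add, coeff_topCoeff]
  split_ifs with hj
  · congr 1
    ext k
    by_cases hk : k = j
    · subst hk; simp [h.symm]
    · simp [Finsupp.single_apply, Ne.symm hk]
  · rfl

theorem topCoeff_C_mul (i : σ) (d : ℕ) (c : R) (f : MvPolynomial σ R) :
    topCoeff i d (C c * f) = C c * topCoeff i d f := by
  rw [C_mul', map_smul, C_mul']

theorem topCoeff_linX_mul (z : R) {i j : σ} (h : j ≠ i) (d : ℕ) (f : MvPolynomial σ R) :
    topCoeff i d (linX z j * f) = linX z j * topCoeff i d f := by
  simp only [linX, add_mul, one_mul, map_add, mul_assoc, topCoeff_C_mul, topCoeff_X_mul h]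

theorem rename_topCoeff (e : Equiv.Perm σ) (i : σ) (d : ℕ) (f : MvPolynomial σ R) :
    rename e (topCoeff i d f) = topCoeff (e i) d (rename e f) := by
  ext m
  obtain ⟨m, rfl⟩ : ∃ m', Finsupp.mapDomain e m' = m :=
    ⟨Finsupp.mapDomain e.symm m, by rw [← Finsupp.mapDomain_comp]; simp⟩
  rw [coeff_rename_mapDomain _ e.injective, coeff_topCoeff, coeff_topCoeff,
    ← Finsupp.mapDomain_single, ← Finsupp.mapDomain_add, coeff_rename_mapDomain _ e.injective]

theorem swapVar_topCoeff (k l i : σ) (d : ℕ) (f : MvPolynomial σ R) :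
    swapVar k l (topCoeff i d f) = topCoeff (Equiv.swap k l i) d (swapVar k l f) :=
  rename_topCoeff _ i d f

theorem degreeOf_topCoeff_le (i j : σ) (d : ℕ) (f : MvPolynomial σ R) :
    degreeOf j (topCoeff i d f) ≤ degreeOf j f := by
  rw [degreeOf_le_iff]
  intro m hm
  rw [mem_support_iff, coeff_topCoeff, ← mem_support_iff] at hm
  exact le_trans (by simp) (monomial_le_degreeOf j hm)

theorem degreeOf_topCoeff_self_le {i : σ} {d : ℕ} {f : MvPolynomial σ R} (h : degreeOf i f ≤ d) :
    degreeOf i (topCoeff i d f) ≤ 0 := by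
  rw [degreeOf_le_iff]
  intro m hm
  rw [mem_support_iff, coeff_topCoeff, ← mem_support_iff] at hm
  have := (monomial_le_degreeOf i hm).trans h
  simp at this
  omega

/-- The polynomial `∏ (x_i - q_l)`. -/
noncomputable def cycPoly {ι : Type*} [Fintype ι] (q : ι → R) (i : σ) : MvPolynomial σ R :=
  ∏ l, (X i - C (q l))

theorem rename_cycPoly {ι : Type*} [Fintype ι] (q : ι → R) (e : Equiv.Perm σ) (i : σ) :
    rename e (cycPoly q i) = cycPoly q (e i) := by
  simp [cycPoly, map_prod]

theorem swapVar_cycPoly {ι : Type*} [Fintype ι] (q : ι → R) (k l i : σ) :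
    swapVar k l (cycPoly q i) = cycPoly q (Equiv.swap k l i) := rename_cycPoly q _ i

theorem topCoeff_cycPoly_mul_of_ne {ι : Type*} [Fintype ι] (q : ι → R) {i j : σ} (h : j ≠ i)
    (d : ℕ) (f : MvPolynomial σ R) :
    topCoeff i d (cycPoly q j * f) = cycPoly q j * topCoeff i d f := by
  classical
  unfold cycPoly
  generalize (Finset.univ : Finset ι) = s
  induction s using Finset.induction_on generalizing f with
  | empty => simp
  | insert a s ha ih =>
    rw [Finset.prod_insert ha, mul_assoc, sub_mul, map_sub, topCoeff_X_mul h, topCoeff_C_mul, ih]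
    ring

variable [IsDomain R]

theorem degreeOf_cycPoly_of_ne {ι : Type*} [Fintype ι] (q : ι → R) {i j : σ} (h : j ≠ i) :
    degreeOf i (cycPoly q j) = 0 := by
  rw [← Nat.le_zero]
  refine (degreeOf_prod_le i _ _).trans ?_
  rw [Nat.le_zero]
  refine Finset.sum_eq_zero fun l _ => ?_
  rw [← Nat.le_zero]
  exact degreeOf_sub_le_of_le (by simp [degreeOf_X_of_ne h.symm]) (by simp)

theorem degreeOf_X_sub_C (i : σ) (c : R) : degreeOf i (X i - C c : MvPolynomial σ R) = 1 := by
  refine le_antisymm (degreeOf_sub_le_of_le (by simp) (by simp)) ?_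
  have := degreeOf_add_le i (X i - C c : MvPolynomial σ R) (C c)
  simpa using this

theorem X_sub_C_ne_zero (i : σ) (c : R) : (X i - C c : MvPolynomial σ R) ≠ 0 :=
  ne_zero_of_degreeOf_ne_zero (i := i) (by simp [degreeOf_X_sub_C])

theorem degreeOf_cycPoly {ι : Type*} [Fintype ι] (q : ι → R) (i : σ) :
    degreeOf i (cycPoly q i) = Fintype.card ι := by
  rw [cycPoly, degreeOf_prod_eq _ _ fun l _ => X_sub_C_ne_zero i (q l)]
  simp [degreeOf_X_sub_C]

theorem cycPoly_ne_zero {ι : Type*} [Fintype ι] (q : ι → R) (i : σ) :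
    (cycPoly q i : MvPolynomial σ R) ≠ 0 :=
  Finset.prod_ne_zero_iff.2 fun l _ => X_sub_C_ne_zero i (q l)

theorem eq_zero_of_cycPoly_dvd {d : ℕ} (q : Fin (d + 1) → R) {i : σ} {f : MvPolynomial σ R}
    (h : cycPoly q i ∣ f) (hf : degreeOf i f ≤ d) : f = 0 := by
  obtain ⟨g, rfl⟩ := h
  by_contra h0
  have hg : g ≠ 0 := right_ne_zero_of_mul h0
  rw [degreeOf_mul_eq (cycPoly_ne_zero q i) hg, degreeOf_cycPoly, Fintype.card_fin] at hf
  omega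

theorem topCoeff_prod_X_sub_C_mul {ι : Type*} (s : Finset ι) (q : ι → R) (i : σ)
    {g : MvPolynomial σ R} (hg : degreeOf i g = 0) :
    topCoeff i s.card ((∏ l ∈ s, (X i - C (q l))) * g) = g := by
  classical
  induction s using Finset.induction_on with
  | empty =>
    simp only [Finset.card_empty, Finset.prod_empty, one_mul]
    ext m; simp [coeff_topCoeff]
  | insert a s ha ih =>
    rw [Finset.card_insert_of_notMem ha, Finset.prod_insert ha, mul_assoc, sub_mul, map_sub,
      topCoeff_succ_X_mul, topCoeff_C_mul, ih, topCoeff_eq_zero, mul_zero, sub_zero]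
    refine Nat.lt_succ_of_le (degreeOf_mul_le_of_le (le_of_eq ?_) hg.le le_rfl)
    rw [degreeOf_prod_eq _ _ fun l _ => X_sub_C_ne_zero i (q l),
      Finset.sum_congr rfl fun l _ => degreeOf_X_sub_C i (q l), Finset.sum_const, smul_eq_mul,
      mul_one]
    rfl

theorem topCoeff_cycPoly_mul {d : ℕ} (q : Fin (d + 1) → R) (i : σ)
    {g : MvPolynomial σ R} (hg : degreeOf i g = 0) :
    topCoeff i (d + 1) (cycPoly q i * g) = g := by
  simpa [cycPoly] using topCoeff_prod_X_sub_C_mul Finset.univ q i hg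

/-- Degrees add over a domain and `X j - X i` has degree at least `1` in either variable. The zero
alternative is unavoidable: `0` has `degreeOf` equal to `0`, which is not below `a = 0`. -/
theorem degreeOf_divDiff {i j : σ} (h : i ≠ j) {f : MvPolynomial σ R} {a : ℕ}
    (hi : degreeOf i f ≤ a) (hj : degreeOf j f ≤ a) :
    divDiff i j f = 0 ∨ (degreeOf i (divDiff i j f) < a ∧ degreeOf j (divDiff i j f) < a) := by
  refine or_iff_not_imp_left.2 fun h0 => ?_
  have h1 := mul_divDiff h f
  have hX := X_sub_X_ne_zero (R := R) h
  constructor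
  · have h2 := congrArg (degreeOf i) h1
    rw [degreeOf_mul_eq hX h0] at h2
    have h3 : degreeOf i (f - swapVar i j f) ≤ a :=
      degreeOf_sub_le_of_le hi (by rwa [degreeOf_swapVar, Equiv.swap_apply_left])
    have h4 := degreeOf_sub_le i (X j - X i : MvPolynomial σ R) (X j)
    rw [sub_sub_cancel_left, degreeOf_neg, degreeOf_X_self, degreeOf_X_of_ne h] at h4
    omega
  · have h2 := congrArg (degreeOf j) h1
    rw [degreeOf_mul_eq hX h0] at h2
    have h3 : degreeOf j (f - swapVar i j f) ≤ a :=
      degreeOf_sub_le_of_le hj (by rwa [degreeOf_swapVar, Equiv.swap_apply_right])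
    have h4 := degreeOf_add_le j (X j - X i : MvPolynomial σ R) (X i)
    rw [sub_add_cancel, degreeOf_X_self, degreeOf_X_of_ne h.symm] at h4
    omega

theorem degreeOf_divDiff_of_ne {i j k : σ} (h : i ≠ j) (hi : k ≠ i) (hj : k ≠ j)
    (f : MvPolynomial σ R) : degreeOf k (divDiff i j f) ≤ degreeOf k f := by
  by_cases h0 : divDiff i j f = 0
  · simp [h0]
  have h2 := congrArg (degreeOf k) (mul_divDiff h f)
  rw [degreeOf_mul_eq (X_sub_X_ne_zero (R := R) h) h0] at h2
  have h3 : degreeOf k (f - swapVar i j f) ≤ degreeOf k f :=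
    degreeOf_sub_le_of_le le_rfl (by rw [degreeOf_swapVar, Equiv.swap_apply_of_ne_of_ne hi hj])
  omega

theorem degreeOf_linX_le (z : R) (i : σ) : degreeOf i (linX z i : MvPolynomial σ R) ≤ 1 :=
  degreeOf_add_le_of_le (by simp) (degreeOf_mul_le_of_le (degreeOf_C _ _).le
    (degreeOf_X_self i).le le_rfl)

theorem degreeOf_linX_of_ne (z : R) {i k : σ} (h : k ≠ i) :
    degreeOf k (linX z i : MvPolynomial σ R) ≤ 0 :=
  degreeOf_add_le_of_le (by simp) (degreeOf_mul_le_of_le (degreeOf_C _ _).le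
    (degreeOf_X_of_ne h).le le_rfl)

variable (z : R)

/-- The divided difference lowers the degree by one and `linX z j` restores at most one. -/
theorem degreeOf_demazure {i j : σ} (h : i ≠ j) {f : MvPolynomial σ R} {a : ℕ}
    (hi : degreeOf i f ≤ a) (hj : degreeOf j f ≤ a) :
    degreeOf i (demazure z i j f) ≤ a ∧ degreeOf j (demazure z i j f) ≤ a := by
  rw [demazure_apply]
  rcases degreeOf_divDiff h hi hj with h0 | ⟨h1, h2⟩
  · simp [h0]
  · exact ⟨degreeOf_mul_le_of_le (degreeOf_linX_of_ne z h) h1.le (by omega),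
      degreeOf_mul_le_of_le (degreeOf_linX_le z j) le_rfl (by omega)⟩

theorem degreeOf_demazure_of_ne {i j k : σ} (h : i ≠ j) (hi : k ≠ i) (hj : k ≠ j)
    (f : MvPolynomial σ R) : degreeOf k (demazure z i j f) ≤ degreeOf k f := by
  rw [demazure_apply]
  exact degreeOf_mul_le_of_le (degreeOf_linX_of_ne z hj) (degreeOf_divDiff_of_ne h hi hj f)
    (by omega)

theorem degreeOf_demazure_le {i j : σ} (h : i ≠ j) {f : MvPolynomial σ R} {a : ℕ}
    (hf : ∀ k, degreeOf k f ≤ a) (k : σ) : degreeOf k (demazure z i j f) ≤ a := by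
  by_cases hi : k = i
  · subst hi; exact (degreeOf_demazure z h (hf _) (hf _)).1
  by_cases hj : k = j
  · subst hj; exact (degreeOf_demazure z h (hf _) (hf _)).2
  · exact (degreeOf_demazure_of_ne z h hi hj f).trans (hf k)

theorem topCoeff_divDiff_eq_zero {i j : σ} (h : i ≠ j) {f : MvPolynomial σ R} {d : ℕ}
    (hi : degreeOf i f ≤ d) (hj : degreeOf j f ≤ d) : topCoeff i d (divDiff i j f) = 0 := by
  rcases degreeOf_divDiff h hi hj with h0 | ⟨h1, -⟩
  · simp [h0]
  · exact topCoeff_eq_zero h1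

/-- A nonzero divided difference would have degree below `0`. -/
theorem swapVar_eq_self {i j : σ} (h : i ≠ j) {f : MvPolynomial σ R}
    (hi : degreeOf i f = 0) (hj : degreeOf j f = 0) : swapVar i j f = f := by
  rcases degreeOf_divDiff h hi.le hj.le with h0 | ⟨h1, -⟩
  · have := mul_divDiff h f
    rw [h0, mul_zero] at this
    exact (sub_eq_zero.1 this.symm).symm
  · omega

theorem topCoeff_demazure_comm {i j k : σ} (h : j ≠ k) (hj : j ≠ i) (hk : k ≠ i) (d : ℕ)
    (f : MvPolynomial σ R) :
    topCoeff i d (demazure z j k f) = demazure z j k (topCoeff i d f) := by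
  refine mul_left_cancel₀ (X_sub_X_ne_zero h) ?_
  rw [mul_demazure z h, sub_mul, ← topCoeff_X_mul hj, ← topCoeff_X_mul hk, ← map_sub, ← sub_mul,
    mul_demazure z h, topCoeff_linX_mul z hk, map_sub, swapVar_topCoeff,
    Equiv.swap_apply_of_ne_of_ne hj.symm hk.symm]

theorem demazure_X_mul_right {i j : σ} (h : i ≠ j) (f : MvPolynomial σ R) :
    demazure z i j (X j * f) = X i * demazure z i j f + linX z j * f := by
  refine mul_left_cancel₀ (X_sub_X_ne_zero h) ?_
  rw [mul_add, mul_left_comm, mul_demazure z h, mul_demazure z h]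
  simp only [map_mul, swapVar_X_right]
  ring

theorem demazure_eq_zero {i j : σ} (h : i ≠ j) {f : MvPolynomial σ R}
    (hf : swapVar i j f = f) : demazure z i j f = 0 := by
  refine mul_left_cancel₀ (X_sub_X_ne_zero h) ?_
  rw [mul_demazure z h, hf, sub_self, mul_zero, mul_zero]

end Degree

end CyclotomicHecke

namespace CyclotomicHecke

open MvPolynomial

/-! ### Multiplication modulo the cyclotomic polynomial. -/

section Reduction

set_option linter.unusedSectionVars false

variable {R : Type*} [CommRing R] [IsDomain R] {σ : Type*} [DecidableEq σ]
  {d : ℕ} (q : Fin (d + 1) → R)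

/-- Multiplication by `x_i`, followed by reduction modulo `∏ (x_i - q_l)`. -/
noncomputable def redMul (i : σ) : MvPolynomial σ R →ₗ[R] MvPolynomial σ R :=
  LinearMap.mulLeft R (X i) - LinearMap.mulLeft R (cycPoly q i) ∘ₗ topCoeff i d

theorem redMul_apply (i : σ) (f : MvPolynomial σ R) :
    redMul q i f = X i * f - cycPoly q i * topCoeff i d f := rfl

theorem redMul_of_lt {i : σ} {f : MvPolynomial σ R} (h : degreeOf i f < d) :
    redMul q i f = X i * f := by
  rw [redMul_apply, topCoeff_eq_zero h, mul_zero, sub_zero]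

theorem swapVar_redMul (k l i : σ) (f : MvPolynomial σ R) :
    swapVar k l (redMul q i f) = redMul q (Equiv.swap k l i) (swapVar k l f) := by
  rw [redMul_apply, redMul_apply, map_sub, map_mul, map_mul, swapVar_cycPoly, swapVar_topCoeff]
  simp [swapVar]

theorem degreeOf_redMul_le {i : σ} {f : MvPolynomial σ R} (hf : ∀ k, degreeOf k f ≤ d) (k : σ) :
    degreeOf k (redMul q i f) ≤ d := by
  by_cases hk : k = i
  · subst hk
    have h0 := degreeOf_topCoeff_self_le (hf k)
    have h1 : degreeOf k (redMul q k f) ≤ d + 1 := by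
      rw [redMul_apply]
      refine degreeOf_sub_le_of_le
        (degreeOf_mul_le_of_le (degreeOf_X_self k).le (hf k) (by omega)) ?_
      exact degreeOf_mul_le_of_le (degreeOf_cycPoly q k).le h0 (by simp)
    -- Degree `d + 1` cannot occur: `cycPoly` is monic in its variable, so the two leading terms
    -- cancel.
    have h2 : topCoeff k (d + 1) (redMul q k f) = 0 := by
      rw [redMul_apply, map_sub, topCoeff_succ_X_mul, topCoeff_cycPoly_mul q k (by omega),
        sub_self]
    rw [degreeOf_le_iff] at h1 ⊢
    intro m hm
    by_contra hlt
    have hmk : m k = d + 1 := le_antisymm (h1 m hm) (by omega)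
    have h3 := congrArg (coeff (m - Finsupp.single k (d + 1))) h2
    rw [coeff_topCoeff, add_tsub_cancel_of_le (Finsupp.single_le_iff.2 hmk.ge), coeff_zero] at h3
    exact (mem_support_iff.1 hm) h3
  · rw [redMul_apply]
    refine degreeOf_sub_le_of_le
      (degreeOf_mul_le_of_le (degreeOf_X_of_ne hk).le (hf k) (by omega)) ?_
    exact degreeOf_mul_le_of_le (degreeOf_cycPoly_of_ne q (Ne.symm hk)).le
      ((degreeOf_topCoeff_le i k d f).trans (hf k)) (by omega)

theorem redMul_comm {i j : σ} (h : i ≠ j) {f : MvPolynomial σ R} :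
    redMul q i (redMul q j f) = redMul q j (redMul q i f) := by
  simp only [redMul_apply, map_sub, topCoeff_X_mul h, topCoeff_X_mul h.symm,
    topCoeff_cycPoly_mul_of_ne q h, topCoeff_cycPoly_mul_of_ne q h.symm, topCoeff_comm i j]
  ring

/-- `redMul q i` is multiplication by `X i` modulo `cycPoly q i`. -/
theorem prod_sub_dvd {ι : Type*} (s : List ι) (c : ι → R) (i : σ) (f : MvPolynomial σ R) :
    cycPoly q i ∣ ((s.map fun l => redMul q i - algebraMap R (Module.End R (MvPolynomial σ R))
      (c l)).prod f - (s.map fun l => (X i - C (c l) : MvPolynomial σ R)).prod * f) := by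
  induction s with
  | nil => simp
  | cons a s ih =>
    simp only [List.map_cons, List.prod_cons, Module.End.mul_apply, LinearMap.sub_apply,
      Module.algebraMap_end_apply, redMul_apply]
    set g := (s.map fun l => redMul q i - algebraMap R (Module.End R (MvPolynomial σ R))
      (c l)).prod f
    obtain ⟨u, hu⟩ := ih
    refine ⟨(X i - C (c a)) * u - topCoeff i d g, ?_⟩
    rw [MvPolynomial.smul_eq_C_mul]
    linear_combination (X i - C (c a)) * hu

/-- The value is a multiple of `cycPoly q i`, of degree `d + 1` in `X i`, but has degree at most `d`
there. -/
theorem prod_redMul_eq_zero {i : σ} {f : MvPolynomial σ R} (hf : ∀ k, degreeOf k f ≤ d) :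
    (List.ofFn fun l => redMul q i - algebraMap R (Module.End R (MvPolynomial σ R)) (q l)).prod f
      = 0 := by
  refine eq_zero_of_cycPoly_dvd q (i := i) ?_ ?_
  · have := prod_sub_dvd q (List.finRange (d + 1)) q i f
    rw [← List.ofFn_eq_map, ← List.ofFn_eq_map] at this
    refine (dvd_sub_left ?_).1 this
    rw [List.prod_ofFn]
    exact Dvd.intro f rfl
  · have : ∀ (s : List (Fin (d + 1))) (k : σ), degreeOf k ((s.map fun l => redMul q i -
        algebraMap R (Module.End R (MvPolynomial σ R)) (q l)).prod f) ≤ d := by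
      intro s
      induction s with
      | nil => simpa using hf
      | cons a s ih =>
        intro k
        simp only [List.map_cons, List.prod_cons, Module.End.mul_apply, LinearMap.sub_apply,
          Module.algebraMap_end_apply]
        refine degreeOf_sub_le_of_le (degreeOf_redMul_le q ih k) ?_
        rw [MvPolynomial.smul_eq_C_mul]
        exact degreeOf_mul_le_of_le (degreeOf_C _ _).le (ih k) (by omega)
    rw [List.ofFn_eq_map]
    exact this _ i

variable (z : R)

/-- The divided difference is zero or of degree below `d` in `X i`, and `linX z j` is free of `X i`,
so nothing has to be reduced. -/
theorem redMul_demazure {i j : σ} (h : i ≠ j) {f : MvPolynomial σ R}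
    (hf : ∀ k, degreeOf k f ≤ d) : redMul q i (demazure z i j f) = X i * demazure z i j f := by
  rw [redMul_apply, demazure_apply, topCoeff_linX_mul z h.symm,
    topCoeff_divDiff_eq_zero h (hf i) (hf j), mul_zero, mul_zero, sub_zero]

/-- This is the part of `T L T + T` in which no variables are exchanged. -/
theorem demazure_redMul_demazure {i j : σ} (h : i ≠ j) {f : MvPolynomial σ R}
    (hf : ∀ k, degreeOf k f ≤ d) :
    demazure z i j (redMul q i (demazure z i j f)) + demazure z i j f = 0 := by
  rw [redMul_demazure q z h hf, demazure_X_mul z h, demazure_demazure z h]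
  simp only [linX]
  ring

theorem redMul_comm_demazure {i j k : σ} (h : j ≠ k) (hj : j ≠ i) (hk : k ≠ i)
    (f : MvPolynomial σ R) :
    redMul q i (demazure z j k f) = demazure z j k (redMul q i f) := by
  rw [redMul_apply, redMul_apply, map_sub, topCoeff_demazure_comm z h hj hk,
    demazure_mul z h (swapVar_X_of_ne hj.symm hk.symm), demazure_mul z h]
  rw [swapVar_cycPoly, Equiv.swap_apply_of_ne_of_ne hj.symm hk.symm]

/-- The operator that measures the difference between the action of `L_j` on the representation
space and reduced multiplication by `x_j`. -/
noncomputable def skeinError (i j : σ) : MvPolynomial σ R →ₗ[R] MvPolynomial σ R :=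
  (z - 1) • ((swapVar i j).toLinearMap ∘ₗ redMul q i ∘ₗ (swapVar i j).toLinearMap) +
    (swapVar i j).toLinearMap ∘ₗ redMul q i ∘ₗ demazure z i j +
    demazure z i j ∘ₗ redMul q i ∘ₗ (swapVar i j).toLinearMap + (swapVar i j).toLinearMap

/-- Were `redMul q i` plain multiplication by `X i`, the four terms would cancel by
`swapVar_demazure_add`; only the corrections carrying a `cycPoly` survive. -/
theorem skeinError_apply {i j : σ} (h : i ≠ j) {f : MvPolynomial σ R}
    (hf : ∀ k, degreeOf k f ≤ d) : skeinError q z i j f =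
      -demazure z i j (cycPoly q i * topCoeff i d (swapVar i j f)) -
        C (z - 1) * (cycPoly q j * swapVar i j (topCoeff i d (swapVar i j f))) := by
  simp only [skeinError, LinearMap.add_apply, LinearMap.smul_apply, LinearMap.comp_apply,
    AlgHom.toLinearMap_apply, redMul_demazure q z h hf]
  rw [redMul_apply]
  simp only [map_sub, map_mul, swapVar_X_left, swapVar_swapVar, swapVar_cycPoly,
    Equiv.swap_apply_left, demazure_X_mul z h, MvPolynomial.smul_eq_C_mul, map_one]
  have := swapVar_demazure_add z h f
  simp only [linX] at this ⊢
  simp only [map_sub, map_one] at this ⊢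
  linear_combination X j * this

/-- Compare the coefficients of `X i ^ (d + 1)` in the defining equation of `divDiff`: the swapped
numerator has degree at most `d` in `X i`. -/
theorem topCoeff_divDiff_cycPoly {i j : σ} (h : i ≠ j) {g : MvPolynomial σ R}
    (hi : degreeOf i g = 0) (hj : degreeOf j g ≤ d) :
    topCoeff i d (divDiff i j (cycPoly q i * g)) = -g := by
  have h1 := congrArg (topCoeff i (d + 1)) (mul_divDiff h (cycPoly q i * g))
  have h2 : topCoeff i (d + 1) (divDiff i j (cycPoly q i * g)) = 0 := by
    apply topCoeff_divDiff_eq_zero h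
    · exact degreeOf_mul_le_of_le (degreeOf_cycPoly q i).le hi.le (by simp)
    · exact degreeOf_mul_le_of_le (degreeOf_cycPoly_of_ne q h).le hj (by omega)
  have h3 : topCoeff i (d + 1) (swapVar i j g) = 0 := by
    apply topCoeff_eq_zero
    rw [degreeOf_swapVar, Equiv.swap_apply_left]
    omega
  rw [sub_mul, map_sub, map_sub, topCoeff_X_mul h.symm, h2, topCoeff_succ_X_mul,
    topCoeff_cycPoly_mul q i hi, map_mul (swapVar i j), swapVar_cycPoly, Equiv.swap_apply_left,
    topCoeff_cycPoly_mul_of_ne q h.symm, h3] at h1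
  linear_combination -h1

/-- The core of the commutation of `L_0` and `L_1`. By `skeinError_apply` both sides depend only on
the top coefficient `g` of the swapped `f` and on the top coefficient `μ` in both variables. The
term `cycPoly q i * cycPoly q j * μ` is symmetric, hence killed by `demazure`, and the remaining
terms match. -/
theorem skeinError_redMul {i j : σ} (h : i ≠ j) {f : MvPolynomial σ R}
    (hf : ∀ k, degreeOf k f ≤ d) :
    skeinError q z i j (redMul q i f) = redMul q i (skeinError q z i j f) := by
  rw [skeinError_apply q z h hf, skeinError_apply q z h (degreeOf_redMul_le q hf)]
  set g := topCoeff i d (swapVar i j f) with hg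
  set μ := topCoeff i d (topCoeff j d f) with hμ
  have hsf : ∀ k, degreeOf k (swapVar i j f) ≤ d := fun k => by
    rw [degreeOf_swapVar]; exact hf _
  have hgi : degreeOf i g = 0 := Nat.le_zero.1 (degreeOf_topCoeff_self_le (hsf i))
  have hgj : degreeOf j g ≤ d := (degreeOf_topCoeff_le i j d _).trans (hsf j)
  have hsg : swapVar i j g = topCoeff j d f := by
    rw [hg, swapVar_topCoeff, swapVar_swapVar, Equiv.swap_apply_left]
  have hμi : degreeOf i μ = 0 := Nat.le_zero.1 (degreeOf_topCoeff_self_le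
    ((degreeOf_topCoeff_le j i d _).trans (hf i)))
  have hμj : degreeOf j μ = 0 := by
    rw [hμ, topCoeff_comm]
    exact Nat.le_zero.1 (degreeOf_topCoeff_self_le ((degreeOf_topCoeff_le i j d _).trans (hf j)))
  have hsμ : swapVar i j μ = μ := swapVar_eq_self h hμi hμj
  have hg' : topCoeff i d (swapVar i j (redMul q i f)) = X j * g - cycPoly q j * μ := by
    rw [swapVar_redMul, Equiv.swap_apply_left, redMul_apply, map_sub, topCoeff_X_mul h.symm,
      topCoeff_cycPoly_mul_of_ne q h.symm, ← hsμ, hμ, swapVar_topCoeff, swapVar_topCoeff,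
      Equiv.swap_apply_left, Equiv.swap_apply_right, topCoeff_comm]
  have htop : topCoeff i d (-demazure z i j (cycPoly q i * g) -
      C (z - 1) * (cycPoly q j * swapVar i j g)) =
      linX z j * g - C (z - 1) * (cycPoly q j * μ) := by
    rw [map_sub, map_neg, demazure_apply, topCoeff_linX_mul z h.symm,
      topCoeff_divDiff_cycPoly q h hgi hgj, topCoeff_C_mul, topCoeff_cycPoly_mul_of_ne q h.symm,
      hsg]
    ring
  have hsym : demazure z i j (cycPoly q i * (cycPoly q j * μ)) = 0 := by
    apply demazure_eq_zero z h
    rw [map_mul, map_mul, hsμ, swapVar_cycPoly, swapVar_cycPoly, Equiv.swap_apply_left,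
      Equiv.swap_apply_right]
    ring
  rw [hg', redMul_apply, htop, mul_sub, map_sub (demazure z i j), hsym,
    mul_left_comm (cycPoly q i) (X j) g, demazure_X_mul_right z h, map_sub (swapVar i j), map_mul (swapVar i j),
    map_mul (swapVar i j), hsμ, swapVar_X_right, swapVar_cycPoly, Equiv.swap_apply_right]
  ring

end Reduction

end CyclotomicHecke

namespace CyclotomicHecke

/-! ### Descents and the exchange condition. -/

section Perm

open Equiv

variable {n : ℕ}

theorem lo_ne_hi (r : Fin (n - 1)) : (lo r : Fin n) ≠ hi r := by
  simp [lo, hi, Fin.ext_iff]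

/-- Exchanging two adjacent elements preserves the order of all other pairs. -/
theorem swap_lt_swap_iff {k l : Fin n} (h : l.1 = k.1 + 1) {a b : Fin n} (hab : a ≠ b) :
    (a = k ∧ b = l) ∨ (a = l ∧ b = k) ∨ (swap k l a < swap k l b ↔ a < b) := by
  by_cases h1 : a = k
  · subst h1
    by_cases h2 : b = l
    · exact Or.inl ⟨rfl, h2⟩
    · right; right
      rw [swap_apply_left, swap_apply_of_ne_of_ne hab.symm h2]
      simp only [Fin.lt_def, Fin.ext_iff] at *
      omega
  by_cases h2 : a = l
  · subst h2
    by_cases h3 : b = k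
    · exact Or.inr (Or.inl ⟨rfl, h3⟩)
    · right; right
      rw [swap_apply_right, swap_apply_of_ne_of_ne h3 hab.symm]
      simp only [Fin.lt_def, Fin.ext_iff] at *
      omega
  right; right
  rw [swap_apply_of_ne_of_ne h1 h2]
  by_cases h3 : b = k
  · subst h3
    rw [swap_apply_left]
    simp only [Fin.lt_def, Fin.ext_iff] at *
    omega
  by_cases h4 : b = l
  · subst h4
    rw [swap_apply_right]
    simp only [Fin.lt_def, Fin.ext_iff] at *
    omega
  rw [swap_apply_of_ne_of_ne h3 h4]

theorem swap_mul_eq_mul_swap {i j k l : Fin n} {w : Perm (Fin n)}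
    (h : (w⁻¹ i = k ∧ w⁻¹ j = l) ∨ (w⁻¹ i = l ∧ w⁻¹ j = k)) : swap i j * w = w * swap k l := by
  have : w * swap k l = swap (w k) (w l) * w := by
    ext x; simp [Equiv.swap_apply_apply]
  rw [this]
  rcases h with ⟨rfl, rfl⟩ | ⟨rfl, rfl⟩
  · simp
  · simp [swap_comm i j]

/-- The exchange condition: if `r` is a left descent of the product of a word `s`, then the
product of `s` with the simple transposition `r` can be written by a shorter word. -/
theorem exists_shorter_word (r : Fin (n - 1)) (s : List (Fin (n - 1)))
    (h : (wordPerm s)⁻¹ (hi r) < (wordPerm s)⁻¹ (lo r)) :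
    ∃ t : List (Fin (n - 1)), t.length < s.length ∧
      wordPerm t = swap (lo r) (hi r) * wordPerm s := by
  induction s using List.reverseRecOn with
  | nil => simp [wordPerm, lo, hi, Fin.lt_def] at h
  | append_singleton s i ih =>
    have hw : wordPerm (s ++ [i]) = wordPerm s * swap (lo i) (hi i) := by simp [wordPerm]
    by_cases hs : (wordPerm s)⁻¹ (hi r) < (wordPerm s)⁻¹ (lo r)
    · obtain ⟨t, ht, hts⟩ := ih hs
      refine ⟨t ++ [i], by simpa using ht, ?_⟩
      rw [hw, ← mul_assoc, ← hts]
      simp [wordPerm]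
    · refine ⟨s, by simp, ?_⟩
      have hne : (wordPerm s)⁻¹ (hi r) ≠ (wordPerm s)⁻¹ (lo r) :=
        (Equiv.injective _).ne (lo_ne_hi r).symm
      have hinv : ∀ x, (wordPerm (s ++ [i]))⁻¹ x = swap (lo i) (hi i) ((wordPerm s)⁻¹ x) := by
        intro x; rw [hw]; simp
      rw [hinv, hinv] at h
      have h1 := swap_lt_swap_iff (k := lo i) (l := hi i) rfl hne
      -- The last letter created the descent, so it exchanges exactly the two positions concerned;
      -- multiplying by `r` on the left amounts to deleting it.
      have h2 : swap (lo r) (hi r) * wordPerm s = wordPerm s * swap (lo i) (hi i) := by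
        apply swap_mul_eq_mul_swap
        tauto
      rw [hw, ← h2, ← mul_assoc]
      simp

theorem not_descent_of_isReduced {r : Fin (n - 1)} {s : List (Fin (n - 1))}
    (h : IsReduced (r :: s)) : ¬ (wordPerm s)⁻¹ (hi r) < (wordPerm s)⁻¹ (lo r) := by
  intro hd
  obtain ⟨t, ht, hts⟩ := exists_shorter_word r s hd
  have := h t (by rw [hts]; simp [wordPerm])
  simp at this
  omega

theorem IsReduced.tail {r : Fin (n - 1)} {s : List (Fin (n - 1))}
    (h : IsReduced (r :: s)) : IsReduced s := by
  intro t ht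
  have := h (r :: t) (by
    simp only [wordPerm, List.map_cons, List.prod_cons] at ht ⊢
    rw [ht])
  simpa using this

theorem not_descent_swap_mul {i j : Fin n} (h : i ≠ j) (w : Perm (Fin n)) :
    (swap i j * w)⁻¹ j < (swap i j * w)⁻¹ i ↔ ¬ w⁻¹ j < w⁻¹ i := by
  have : w⁻¹ i ≠ w⁻¹ j := (Equiv.injective _).ne h
  simp only [mul_inv_rev, swap_inv, Perm.mul_apply, swap_apply_left, swap_apply_right, not_lt]
  exact ⟨le_of_lt, fun h => lt_of_le_of_ne h this⟩

end Perm

/-! ### Left and right regular action of the finite Hecke algebra. -/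

section Regular

open Equiv

variable {R : Type*} [CommRing R] {n : ℕ} {V : Type*} [AddCommGroup V] [Module R V] (z : R)

/-- Left multiplication by `T_r`, where `r` exchanges `i` and `j`, on functions on the symmetric
group, regarded as elements of the Hecke algebra of the symmetric group with coefficients
in `V`. -/
def leftMulT (i j : Fin n) : (Perm (Fin n) → V) →ₗ[R] (Perm (Fin n) → V) where
  toFun F w := if w⁻¹ j < w⁻¹ i then F (swap i j * w) + (z - 1) • F w else z • F (swap i j * w)
  map_add' F G := by
    ext w; simp only [Pi.add_apply]; split_ifs <;> module
  map_smul' c F := by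
    ext w; simp only [Pi.smul_apply, RingHom.id_apply, smul_comm _ c]; split_ifs <;> simp

/-- Right multiplication by `T_r`. -/
def rightMulT (i j : Fin n) : (Perm (Fin n) → V) →ₗ[R] (Perm (Fin n) → V) where
  toFun F w := if w j < w i then F (w * swap i j) + (z - 1) • F w else z • F (w * swap i j)
  map_add' F G := by
    ext w; simp only [Pi.add_apply]; split_ifs <;> module
  map_smul' c F := by
    ext w; simp only [Pi.smul_apply, RingHom.id_apply, smul_comm _ c]; split_ifs <;> simp

theorem leftMulT_apply (i j : Fin n) (F : Perm (Fin n) → V) (w : Perm (Fin n)) :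
    leftMulT z i j F w =
      if w⁻¹ j < w⁻¹ i then F (swap i j * w) + (z - 1) • F w else z • F (swap i j * w) := rfl

theorem rightMulT_apply (i j : Fin n) (F : Perm (Fin n) → V) (w : Perm (Fin n)) :
    rightMulT z i j F w =
      if w j < w i then F (w * swap i j) + (z - 1) • F w else z • F (w * swap i j) := rfl

theorem leftMulT_leftMulT {i j : Fin n} (h : i ≠ j) (F : Perm (Fin n) → V) :
    leftMulT z i j (leftMulT z i j F) = (z - 1) • leftMulT z i j F + z • F := by
  ext w
  simp only [leftMulT_apply, Pi.add_apply, Pi.smul_apply, not_descent_swap_mul h,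
    ← mul_assoc, swap_mul_self, one_mul]
  split_ifs <;> module

theorem leftMulT_comm {i j k l : Fin n} (hik : i ≠ k) (hil : i ≠ l)
    (hjk : j ≠ k) (hjl : j ≠ l) (F : Perm (Fin n) → V) :
    leftMulT z i j (leftMulT z k l F) = leftMulT z k l (leftMulT z i j F) := by
  have hc : swap k l * swap i j = swap i j * swap k l := by
    rw [mul_swap_eq_swap_mul, swap_apply_of_ne_of_ne hik hil, swap_apply_of_ne_of_ne hjk hjl]
  ext w
  simp only [leftMulT_apply, mul_inv_rev, swap_inv, Perm.mul_apply,
    swap_apply_of_ne_of_ne hik hil, swap_apply_of_ne_of_ne hjk hjl,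
    swap_apply_of_ne_of_ne hik.symm hjk.symm, swap_apply_of_ne_of_ne hil.symm hjl.symm,
    ← mul_assoc, hc]
  split_ifs <;> module

/-- The coefficients at `w` depend only on the relative order of `w⁻¹ i`, `w⁻¹ j`, `w⁻¹ k`; each of
the six orders is a linear identity. Adjacency plays no role. -/
theorem leftMulT_braid {i j k : Fin n} (hij : i ≠ j) (hjk : j ≠ k) (hik : i ≠ k)
    (F : Perm (Fin n) → V) :
    leftMulT z i j (leftMulT z j k (leftMulT z i j F)) =
      leftMulT z j k (leftMulT z i j (leftMulT z j k F)) := by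
  have hc : ∀ w : Perm (Fin n), swap j k * (swap i j * (swap j k * w)) =
      swap i j * (swap j k * (swap i j * w)) := by
    intro w
    ext x
    generalize w x = y
    simp only [← mul_assoc, Perm.mul_apply]
    congr 1
    simp only [swap_apply_def]
    split_ifs <;> simp_all
  ext w
  have h1 : w⁻¹ i ≠ w⁻¹ j := (Equiv.injective _).ne hij
  have h2 : w⁻¹ j ≠ w⁻¹ k := (Equiv.injective _).ne hjk
  have h3 : w⁻¹ i ≠ w⁻¹ k := (Equiv.injective _).ne hik
  simp only [leftMulT_apply, mul_inv_rev, swap_inv, Perm.mul_apply, swap_apply_left,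
    swap_apply_right, swap_apply_of_ne_of_ne hik.symm hjk.symm, swap_apply_of_ne_of_ne hij hik, hc,
    swap_mul_self_mul]
  generalize w⁻¹ i = a at *
  generalize w⁻¹ j = b at *
  generalize w⁻¹ k = c at *
  rcases lt_or_gt_of_ne h1 with h1 | h1 <;> rcases lt_or_gt_of_ne h2 with h2 | h2 <;>
    rcases lt_or_gt_of_ne h3 with h3 | h3 <;>
    first
    | (exfalso; order)
    | (simp only [h1, h2, h3, h1.not_gt, h2.not_gt, h3.not_gt, if_true, if_false] <;> module)

/-- If `s w = w s'`, both operators mix the same two coefficients in the same way. Otherwise neither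
multiplication changes the descent tested by the other, because a simple transposition reverses the
order of only one pair. -/
theorem leftMulT_rightMulT_comm {i j k l : Fin n} (hij : j.1 = i.1 + 1) (hkl : l.1 = k.1 + 1)
    (F : Perm (Fin n) → V) :
    leftMulT z i j (rightMulT z k l F) = rightMulT z k l (leftMulT z i j F) := by
  have hij' : i ≠ j := by intro h; simp [h] at hij
  have hkl' : k ≠ l := by intro h; simp [h] at hkl
  ext w
  have hne : w⁻¹ j ≠ w⁻¹ i := (Equiv.injective _).ne hij'.symm
  have hne' : w l ≠ w k := (Equiv.injective _).ne hkl'.symm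
  by_cases h : (w⁻¹ i = k ∧ w⁻¹ j = l) ∨ (w⁻¹ i = l ∧ w⁻¹ j = k)
  · have hs := swap_mul_eq_mul_swap h
    have e1 : swap i j * (w * swap k l) = w := by rw [← hs, ← mul_assoc]; simp
    have e2 : swap i j * w * swap k l = w := by rw [hs, mul_assoc]; simp
    have e3 : swap i j * (swap i j * w) = w := by rw [← mul_assoc]; simp
    simp only [leftMulT_apply, rightMulT_apply, mul_inv_rev, swap_inv, Perm.mul_apply]
    rw [← hs]
    simp only [e3, e2]
    rcases h with ⟨hk, hl⟩ | ⟨hl, hk⟩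
    · have hk' : w k = i := by rw [← hk]; simp
      have hl' : w l = j := by rw [← hl]; simp
      simp only [hk, hl, hk', hl', swap_apply_left, swap_apply_right]
      have a1 : k < l := by rw [Fin.lt_def]; omega
      have a2 : i < j := by rw [Fin.lt_def]; omega
      simp only [a1, a2, a1.not_gt, a2.not_gt, if_true, if_false]
    · have hk' : w k = j := by rw [← hk]; simp
      have hl' : w l = i := by rw [← hl]; simp
      simp only [hk, hl, hk', hl', swap_apply_left, swap_apply_right]
      have a1 : k < l := by rw [Fin.lt_def]; omega
      have a2 : i < j := by rw [Fin.lt_def]; omega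
      simp only [a1, a2, a1.not_gt, a2.not_gt, if_true, if_false]
  · have h1 : swap k l (w⁻¹ j) < swap k l (w⁻¹ i) ↔ w⁻¹ j < w⁻¹ i := by
      have := swap_lt_swap_iff hkl hne
      tauto
    have h2 : swap i j (w l) < swap i j (w k) ↔ w l < w k := by
      have h3 := swap_lt_swap_iff hij hne'
      simp only [Perm.inv_eq_iff_eq] at h
      simp only [eq_comm (a := i), eq_comm (a := j)] at h
      tauto
    simp only [leftMulT_apply, rightMulT_apply, mul_inv_rev, swap_inv, Perm.mul_apply, h1, h2,
      mul_assoc]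
    split_ifs <;> module

/-- Operators on the coefficients commute with left multiplication. -/
theorem leftMulT_comp (f : V →ₗ[R] V) (i j : Fin n) (F : Perm (Fin n) → V) :
    leftMulT z i j (fun w => f (F w)) = fun w => f (leftMulT z i j F w) := by
  ext w; simp only [leftMulT_apply]; split_ifs <;> simp

theorem rightMulT_comp (f : V →ₗ[R] V) (i j : Fin n) (F : Perm (Fin n) → V) :
    rightMulT z i j (fun w => f (F w)) = fun w => f (rightMulT z i j F w) := by
  ext w; simp only [rightMulT_apply]; split_ifs <;> simp

end Regular

end CyclotomicHecke

namespace CyclotomicHecke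

/-! ### Reduction of the defining relations to those of type `B`. -/

section Generic

variable {R : Type*} [CommRing R] {B : Type*} [Ring B] [Algebra R B] {n : ℕ} (ξ : Rˣ)

/-- The elements `L_k` determined by `L_0` and the `T_r` through
`ξ L_{k+1} = (T_k L_k + 1) T_k`. -/
noncomputable def iterL (t : ℕ → B) (l : B) : ℕ → B
  | 0 => l
  | k + 1 => (↑ξ⁻¹ : R) • ((t k * iterL t l k + 1) * t k)

variable {ξ} {t : ℕ → B} {l : B}

/-- With `b = T_s`, `a = T_{s+1}`, `l = L_s` this concerns `L_{s+2} = ξ⁻² (a b l b a + a b a + ξ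
a)`. The first summand commutes with `b` by the braid relation, the sum of the other two by the
braid and quadratic relations. -/
theorem commute_iterL_step {a b l : B} (hb : b * b = ((ξ : R) - 1) • b + (ξ : R) • (1 : B))
    (hab : b * a * b = a * b * a) (hal : a * l = l * a) :
    Commute b ((↑ξ⁻¹ : R) • ((a * ((↑ξ⁻¹ : R) • ((b * l + 1) * b)) + 1) * a)) := by
  have h1 : (↑ξ⁻¹ : R) • ((a * ((↑ξ⁻¹ : R) • ((b * l + 1) * b)) + 1) * a) =
      ((↑ξ⁻¹ : R) * ↑ξ⁻¹) • (a * b * l * b * a + a * b * a + (ξ : R) • a) := by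
    have h2 : a = (↑ξ⁻¹ : R) • (ξ : R) • a := by rw [smul_smul]; simp
    rw [mul_smul, smul_add _ _ ((ξ : R) • a), ← h2]
    simp only [mul_smul_comm, smul_mul_assoc, add_mul, one_mul, mul_add, mul_assoc, smul_add]
  rw [h1]
  refine Commute.smul_right ?_ _
  have e1 : b * (a * b * l * b * a) = (a * b * l * b * a) * b := by
    calc b * (a * b * l * b * a) = (b * a * b) * l * b * a := by noncomm_ring
      _ = a * b * (a * l) * b * a := by rw [hab]; noncomm_ring
      _ = a * b * l * (a * b * a) := by rw [hal]; noncomm_ring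
      _ = (a * b * l * b * a) * b := by rw [← hab]; noncomm_ring
  have e2 : b * (a * b * a) + (ξ : R) • (b * a) = a * b * a * b + (ξ : R) • (a * b) := by
    have e3 : b * (a * b * a) = b * b * a * b := by rw [← hab]; noncomm_ring
    have e4 : a * b * a * b = b * a * (b * b) := by rw [← hab]; noncomm_ring
    rw [e3, e4, hb]
    simp only [add_mul, mul_add, smul_mul_assoc, mul_smul_comm, one_mul, mul_one, mul_assoc]
    abel
  rw [Commute, SemiconjBy]
  simp only [mul_add, add_mul, mul_smul_comm, smul_mul_assoc]
  rw [add_assoc, add_assoc, e1]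
  congr 1

/-- Strong induction, because the case `k = s + 2` falls back on the commutation of `T_{s+1}` with
`L_s`. -/
theorem commute_iterL_of_ne
    (hq : ∀ r, r + 1 < n → t r * t r = ((ξ : R) - 1) • t r + (ξ : R) • (1 : B))
    (hc : ∀ r s, r + 1 < s → s + 1 < n → Commute (t r) (t s))
    (hb : ∀ r, r + 2 < n → t r * t (r + 1) * t r = t (r + 1) * t r * t (r + 1))
    (h0 : ∀ r, r ≠ 0 → r + 1 < n → Commute (t r) l)
    (k : ℕ) (hk : k < n) (s : ℕ) (hs : s + 1 < n) (h1 : k ≠ s) (h2 : k ≠ s + 1) :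
    Commute (t s) (iterL ξ t l k) := by
  induction k using Nat.strong_induction_on generalizing s with
  | _ k ih =>
    match k with
    | 0 => exact h0 s (Ne.symm h1) hs
    | k + 1 =>
      by_cases hsk : k = s + 1
      · subst hsk
        exact commute_iterL_step (hq s hs) (hb s (by omega))
          (ih s (by omega) (by omega) (s + 1) (by omega) (by omega) (by omega))
      · have hts : Commute (t s) (t k) := by
          rcases lt_or_gt_of_ne (show k ≠ s by omega) with h | h
          · exact (hc k s (by omega) hs).symm
          · exact hc s k (by omega) (by omega)
        have := ih k (by omega) (by omega) s hs (by omega) hsk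
        exact (((hts.mul_right this).add_right (Commute.one_right _)).mul_right hts).smul_right _

/-- `h1` is the case of indices `0` and `1`. The rest follows since `L_{i+1}` is built from `T_i`
and `L_i`, and `T_i` commutes with every `L_j` for `j > i + 1`. -/
theorem commute_iterL
    (hq : ∀ r, r + 1 < n → t r * t r = ((ξ : R) - 1) • t r + (ξ : R) • (1 : B))
    (hc : ∀ r s, r + 1 < s → s + 1 < n → Commute (t r) (t s))
    (hb : ∀ r, r + 2 < n → t r * t (r + 1) * t r = t (r + 1) * t r * t (r + 1))
    (h0 : ∀ r, r ≠ 0 → r + 1 < n → Commute (t r) l)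
    (h1 : 1 < n → Commute l (t 0 * l * t 0 + t 0))
    {i j : ℕ} (hij : i < j) (hj : j < n) : Commute (iterL ξ t l i) (iterL ξ t l j) := by
  induction i with
  | zero =>
    obtain ⟨k, rfl⟩ : ∃ k, j = k + 1 := ⟨j - 1, by omega⟩
    clear hij
    induction k with
    | zero =>
      have := (h1 hj).smul_right (↑ξ⁻¹ : R)
      simpa only [iterL, add_mul, one_mul] using this
    | succ k ih =>
      have h2 : Commute l (t (k + 1)) := (h0 (k + 1) (by omega) hj).symm
      exact (((h2.mul_right (ih (by omega))).add_right (Commute.one_right _)).mul_right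
        h2).smul_right _
  | succ i ih =>
    have h2 : Commute (t i) (iterL ξ t l j) :=
      commute_iterL_of_ne hq hc hb h0 j hj i (by omega) (by omega) (by omega)
    exact (((h2.mul_left (ih (by omega))).add_left (Commute.one_left _)).mul_left
      h2).smul_left _

theorem iterL_skein
    (hq : ∀ r, r + 1 < n → t r * t r = ((ξ : R) - 1) • t r + (ξ : R) • (1 : B))
    {r : ℕ} (hr : r + 1 < n) :
    iterL ξ t l (r + 1) * (t r - algebraMap R B ξ + 1) = t r * iterL ξ t l r + 1 := by
  have h : t r * (t r - algebraMap R B ξ + 1) = (ξ : R) • (1 : B) := by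
    rw [mul_add, mul_sub, hq r hr, ← Algebra.commutes, ← Algebra.smul_def, mul_one, sub_smul, one_smul]
    abel
  rw [iterL, smul_mul_assoc, mul_assoc, h, mul_smul_comm, mul_one, smul_smul]
  simp

/-- Operators `T_r` and `L_0` satisfying the relations of the Hecke algebra of type `B`, in the
present normalisation, define a homomorphism from the cyclotomic Hecke algebra. -/
theorem exists_algHom {ℓ : ℕ} (Q : Fin ℓ → R)
    (hq : ∀ r, r + 1 < n → t r * t r = ((ξ : R) - 1) • t r + (ξ : R) • (1 : B))
    (hc : ∀ r s, r + 1 < s → s + 1 < n → Commute (t r) (t s))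
    (hb : ∀ r, r + 2 < n → t r * t (r + 1) * t r = t (r + 1) * t r * t (r + 1))
    (h0 : ∀ r, r ≠ 0 → r + 1 < n → Commute (t r) l)
    (h1 : 1 < n → Commute l (t 0 * l * t 0 + t 0))
    (hcyc : 0 < n → (List.ofFn fun i => l - algebraMap R B (Q i)).prod = 0) :
    ∃ ψ : HeckeAlg n ℓ ξ Q →ₐ[R] B, (∀ r : Fin (n - 1), ψ (T ξ Q r) = t r) ∧
      ∀ i : Fin n, ψ (L ξ Q i) = iterL ξ t l i := by
  let f : FreeAlgebra R (Gen n) →ₐ[R] B := FreeAlgebra.lift R fun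
    | Gen.L i => iterL ξ t l i
    | Gen.T r => t r
  have fL : ∀ i : Fin n, f (freeL R i) = iterL ξ t l i := fun i => by simp [f, freeL]
  have fT : ∀ r : Fin (n - 1), f (freeT R r) = t r := fun i => by simp [f, freeT]
  have hrel : ∀ ⦃x y⦄, Rel R n ℓ ξ Q x y → f x = f y := by
    intro x y hxy
    induction hxy with
    | cyclotomic i hi =>
      have : 0 < n := by have := i.2; omega
      rw [map_list_prod, List.map_ofFn, map_zero, ← hcyc this]
      congr 2
      ext j
      simp [fL, hi, iterL]
    | quadratic r =>
      have := hq r (by have := r.2; omega)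
      simp only [map_mul, map_add, map_sub, map_one, map_zero, fT, AlgHom.commutes]
      rw [mul_sub, add_mul, this, ← Algebra.commutes, mul_add, ← Algebra.smul_def,
        Algebra.algebraMap_eq_smul_one, sub_smul, one_smul, one_mul, mul_one]
      abel
    | comm_L i j =>
      simp only [map_mul, fL]
      rcases lt_trichotomy i.1 j.1 with h | h | h
      · exact commute_iterL hq hc hb h0 h1 h j.2
      · rw [h]
      · exact (commute_iterL hq hc hb h0 h1 h i.2).symm
    | comm_T r s h =>
      simp only [map_mul, fT]
      have := r.2
      have := s.2
      rcases h with h | h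
      · exact hc r s h (by omega)
      · exact (hc s r h (by omega)).symm
    | braid r s h =>
      simp only [map_mul, fT, h]
      exact hb r (by have := s.2; omega)
    | comm_TL r i h₁ h₂ =>
      simp only [map_mul, fL, fT]
      refine commute_iterL_of_ne hq hc hb h0 i i.2 r (by have := r.2; omega) ?_ ?_
      · intro h; exact h₁ (Fin.ext h)
      · intro h; exact h₂ (Fin.ext h)
    | skein r =>
      simp only [map_mul, map_add, map_sub, map_one, fL, fT, AlgHom.commutes]
      exact iterL_skein hq (by have := r.2; omega)
  refine ⟨RingQuot.liftAlgHom R ⟨f, hrel⟩, fun r => ?_, fun i => ?_⟩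
  · exact (RingQuot.liftAlgHom_mkAlgHom_apply R f hrel _).trans (fT r)
  · exact (RingQuot.liftAlgHom_mkAlgHom_apply R f hrel _).trans (fL i)

end Generic

end CyclotomicHecke

namespace CyclotomicHecke

open MvPolynomial

/-! ### The operators on polynomial-valued functions on the symmetric group. -/

section Operators

set_option linter.unusedSectionVars false

variable {R : Type*} [CommRing R] [IsDomain R] {n : ℕ} (z : R)

/-- The operator `T_r` on functions on the symmetric group with polynomial values, where `r`
exchanges `i` and `j`. -/
noncomputable def opT (i j : Fin n) : Module.End R (Equiv.Perm (Fin n) → MvPolynomial (Fin n) R) :=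
  (swapVar i j).toLinearMap.compLeft _ ∘ₗ leftMulT z i j + (demazure z i j).compLeft _

theorem opT_apply (i j : Fin n) (F : Equiv.Perm (Fin n) → MvPolynomial (Fin n) R)
    (w : Equiv.Perm (Fin n)) :
    opT z i j F w = swapVar i j (leftMulT z i j F w) + demazure z i j (F w) := rfl

theorem leftMulT_opT (i j k l : Fin n) (F : Equiv.Perm (Fin n) → MvPolynomial (Fin n) R)
    (w : Equiv.Perm (Fin n)) :
    leftMulT z i j (opT z k l F) w =
      swapVar k l (leftMulT z i j (leftMulT z k l F) w) + demazure z k l (leftMulT z i j F w) := by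
  have h : opT z k l F = (fun w => (swapVar k l).toLinearMap (leftMulT z k l F w)) +
      fun w => demazure z k l (F w) := rfl
  rw [h, map_add, leftMulT_comp, leftMulT_comp]
  rfl

theorem leftMulT_leftMulT_opT (i j k l i' j' : Fin n)
    (F : Equiv.Perm (Fin n) → MvPolynomial (Fin n) R) (w : Equiv.Perm (Fin n)) :
    leftMulT z i j (leftMulT z i' j' (opT z k l F)) w =
      swapVar k l (leftMulT z i j (leftMulT z i' j' (leftMulT z k l F)) w) +
        demazure z k l (leftMulT z i j (leftMulT z i' j' F) w) := by
  have h : leftMulT z i' j' (opT z k l F) =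
      (fun w => (swapVar k l).toLinearMap (leftMulT z i' j' (leftMulT z k l F) w)) +
      fun w => demazure z k l (leftMulT z i' j' F w) := by
    ext1 w; exact leftMulT_opT z i' j' k l F w
  rw [h, map_add, leftMulT_comp, leftMulT_comp]
  rfl

theorem opT_opT {i j : Fin n} (h : i ≠ j) (F : Equiv.Perm (Fin n) → MvPolynomial (Fin n) R) :
    opT z i j (opT z i j F) = (z - 1) • opT z i j F + z • F := by
  ext1 w
  have h1 := swapVar_demazure_add z h (leftMulT z i j F w)
  simp only [opT_apply, leftMulT_opT, leftMulT_leftMulT z h, map_add, swapVar_swapVar,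
    Pi.add_apply, Pi.smul_apply, demazure_demazure z h,
    MvPolynomial.smul_eq_C_mul] at h1 ⊢
  linear_combination h1

theorem swapVar_swapVar_comm {i j k l : Fin n} (hik : i ≠ k) (hil : i ≠ l)
    (hjk : j ≠ k) (hjl : j ≠ l) (f : MvPolynomial (Fin n) R) :
    swapVar i j (swapVar k l f) = swapVar k l (swapVar i j f) := by
  have := rename_swapVar (Equiv.swap i j) k l f
  rwa [Equiv.swap_apply_of_ne_of_ne hik.symm hjk.symm,
    Equiv.swap_apply_of_ne_of_ne hil.symm hjl.symm] at this

theorem swapVar_demazure_comm {i j k l : Fin n} (hik : i ≠ k) (hil : i ≠ l)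
    (hjk : j ≠ k) (hjl : j ≠ l) (f : MvPolynomial (Fin n) R) :
    swapVar i j (demazure z k l f) = demazure z k l (swapVar i j f) := by
  rw [swapVar_demazure, Equiv.swap_apply_of_ne_of_ne hik.symm hjk.symm,
    Equiv.swap_apply_of_ne_of_ne hil.symm hjl.symm]

theorem opT_comm {i j k l : Fin n} (hij : i ≠ j) (hkl : k ≠ l) (hik : i ≠ k) (hil : i ≠ l)
    (hjk : j ≠ k) (hjl : j ≠ l) (F : Equiv.Perm (Fin n) → MvPolynomial (Fin n) R) :
    opT z i j (opT z k l F) = opT z k l (opT z i j F) := by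
  ext1 w
  simp only [opT_apply, leftMulT_opT, map_add]
  rw [leftMulT_comm z hik hil hjk hjl, swapVar_swapVar_comm hik hil hjk hjl,
    swapVar_demazure_comm z hik hil hjk hjl, demazure_comm z hij hkl hik hil hjk hjl,
    swapVar_demazure_comm z hik.symm hjk.symm hil.symm hjl.symm]
  abel

/-- Both sides are sorted by the product of finite `T`'s applied to `F`. The longest product is
`leftMulT_braid`, products of two match by conjugation, and what is left is `demazure_relations`,
together with `s3` for the terms `z F` arising from squares. -/
theorem opT_braid {i j k : Fin n} (hij : i ≠ j) (hjk : j ≠ k) (hik : i ≠ k)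
    (F : Equiv.Perm (Fin n) → MvPolynomial (Fin n) R) :
    opT z i j (opT z j k (opT z i j F)) = opT z j k (opT z i j (opT z j k F)) := by
  have s1 : ∀ f : MvPolynomial (Fin n) R, swapVar i j (swapVar j k (demazure z i j f)) =
      demazure z j k (swapVar i j (swapVar j k f)) := by
    intro f
    simp [swapVar_demazure,
      Equiv.swap_apply_of_ne_of_ne hij hik, Equiv.swap_apply_of_ne_of_ne hik.symm hjk.symm]
  have s2 : ∀ f : MvPolynomial (Fin n) R, demazure z i j (swapVar j k (swapVar i j f)) =
      swapVar j k (swapVar i j (demazure z j k f)) := by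
    intro f
    simp [swapVar_demazure,
      Equiv.swap_apply_of_ne_of_ne hij hik, Equiv.swap_apply_of_ne_of_ne hik.symm hjk.symm]
  have s3 : ∀ f : MvPolynomial (Fin n) R, swapVar i j (demazure z j k (swapVar i j f)) =
      swapVar j k (demazure z i j (swapVar j k f)) := by
    intro f
    simp only [swapVar_demazure, Equiv.swap_apply_left, Equiv.swap_apply_right, swapVar_swapVar,
      Equiv.swap_apply_of_ne_of_ne hij hik, Equiv.swap_apply_of_ne_of_ne hik.symm hjk.symm]
  ext1 w
  obtain ⟨d1, -, -⟩ := demazure_relations z (F w) hij hjk hik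
  obtain ⟨-, d2, -⟩ := demazure_relations z (leftMulT z i j F w) hij hjk hik
  obtain ⟨-, -, d3⟩ := demazure_relations z (leftMulT z j k F w) hij hjk hik
  simp only [opT_apply, leftMulT_opT, leftMulT_leftMulT_opT, map_add, leftMulT_leftMulT z hij,
    leftMulT_leftMulT z hjk, Pi.add_apply, Pi.smul_apply, map_smul,
    leftMulT_braid z hij hjk hik, swapVar_braid _ hij hjk hik, s1, s2]
  simp only [MvPolynomial.smul_eq_C_mul]
  have s3' := s3 (F w)
  linear_combination d1 - d2 + d3 + C z * s3'

variable {d : ℕ} (q : Fin (d + 1) → R)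

/-- The operator `L_i` on functions on the symmetric group with polynomial values
(for the first index `i`). -/
noncomputable def opL (i : Fin n) : Module.End R (Equiv.Perm (Fin n) → MvPolynomial (Fin n) R) :=
  (redMul q i).compLeft _

theorem opL_apply (i : Fin n) (F : Equiv.Perm (Fin n) → MvPolynomial (Fin n) R)
    (w : Equiv.Perm (Fin n)) : opL q i F w = redMul q i (F w) := rfl

theorem leftMulT_opL (i j k : Fin n) (F : Equiv.Perm (Fin n) → MvPolynomial (Fin n) R)
    (w : Equiv.Perm (Fin n)) :
    leftMulT z i j (opL q k F) w = redMul q k (leftMulT z i j F w) :=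
  congrFun (leftMulT_comp z (redMul q k) i j F) w

theorem opT_opL_comm {i j k : Fin n} (h : i ≠ j) (hi : i ≠ k) (hj : j ≠ k)
    (F : Equiv.Perm (Fin n) → MvPolynomial (Fin n) R) :
    opT z i j (opL q k F) = opL q k (opT z i j F) := by
  ext1 w
  simp only [opT_apply, opL_apply, map_add, leftMulT_opL]
  rw [swapVar_redMul, Equiv.swap_apply_of_ne_of_ne hi.symm hj.symm,
    redMul_comm_demazure q z h hi hj]

/-- Functions whose values have degree at most `d` in each variable. -/
def lowDegree (R : Type*) [CommRing R] (n d : ℕ) :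
    Submodule R (Equiv.Perm (Fin n) → MvPolynomial (Fin n) R) where
  carrier := {F | ∀ w k, degreeOf k (F w) ≤ d}
  add_mem' hF hG w k := degreeOf_add_le_of_le (hF w k) (hG w k)
  zero_mem' w k := by simp
  smul_mem' c F hF w k := by
    rw [Pi.smul_apply, MvPolynomial.smul_eq_C_mul]
    exact degreeOf_mul_le_of_le (degreeOf_C _ _).le (hF w k) (by omega)

variable {F : Equiv.Perm (Fin n) → MvPolynomial (Fin n) R}

theorem degreeOf_leftMulT_le {k : Fin n} {a : ℕ} (hF : ∀ w, degreeOf k (F w) ≤ a) (i j : Fin n)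
    (w : Equiv.Perm (Fin n)) : degreeOf k (leftMulT z i j F w) ≤ a := by
  rw [leftMulT_apply]
  simp only [MvPolynomial.smul_eq_C_mul]
  split_ifs
  · exact degreeOf_add_le_of_le (hF _)
      (degreeOf_mul_le_of_le (degreeOf_C _ _).le (hF _) (by omega))
  · exact degreeOf_mul_le_of_le (degreeOf_C _ _).le (hF _) (by omega)

theorem degreeOf_opT_le {i j : Fin n} (h : i ≠ j) {a : ℕ} (hi : ∀ w, degreeOf i (F w) ≤ a)
    (hj : ∀ w, degreeOf j (F w) ≤ a) (w : Equiv.Perm (Fin n)) :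
    degreeOf i (opT z i j F w) ≤ a ∧ degreeOf j (opT z i j F w) ≤ a := by
  obtain ⟨h1, h2⟩ := degreeOf_demazure z h (hi w) (hj w)
  rw [opT_apply]
  refine ⟨degreeOf_add_le_of_le ?_ h1, degreeOf_add_le_of_le ?_ h2⟩
  · rw [degreeOf_swapVar, Equiv.swap_apply_left]
    exact degreeOf_leftMulT_le z hj i j w
  · rw [degreeOf_swapVar, Equiv.swap_apply_right]
    exact degreeOf_leftMulT_le z hi i j w

theorem degreeOf_opT_of_ne_le {i j k : Fin n} (h : i ≠ j) (hi : k ≠ i) (hj : k ≠ j) {a : ℕ}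
    (hk : ∀ w, degreeOf k (F w) ≤ a) (w : Equiv.Perm (Fin n)) :
    degreeOf k (opT z i j F w) ≤ a := by
  rw [opT_apply]
  refine degreeOf_add_le_of_le ?_ ((degreeOf_demazure_of_ne z h hi hj _).trans (hk w))
  rw [degreeOf_swapVar, Equiv.swap_apply_of_ne_of_ne hi hj]
  exact degreeOf_leftMulT_le z hk i j w

theorem leftMulT_mem_lowDegree (i j : Fin n) (hF : F ∈ lowDegree R n d) :
    leftMulT z i j F ∈ lowDegree R n d :=
  fun w k => degreeOf_leftMulT_le z (fun w => hF w k) i j w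

theorem opT_mem_lowDegree {i j : Fin n} (h : i ≠ j) (hF : F ∈ lowDegree R n d) :
    opT z i j F ∈ lowDegree R n d := fun w k => by
  rw [opT_apply]
  refine degreeOf_add_le_of_le ?_ (degreeOf_demazure_le z h (hF w) k)
  rw [degreeOf_swapVar]
  exact leftMulT_mem_lowDegree z i j hF w _

theorem opL_mem_lowDegree (i : Fin n) (hF : F ∈ lowDegree R n d) :
    opL q i F ∈ lowDegree R n d :=
  fun w k => degreeOf_redMul_le q (hF w) k

/-- As `T L T + T` is `ξ` times the next `L`, that element acts as `redMul q j` up to `skeinError`.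
-/
theorem opT_opL_opT {i j : Fin n} (h : i ≠ j) (hF : F ∈ lowDegree R n d)
    (w : Equiv.Perm (Fin n)) :
    opT z i j (opL q i (opT z i j F)) w + opT z i j F w =
      z • redMul q j (F w) + skeinError q z i j (leftMulT z i j F w) := by
  have h1 := demazure_redMul_demazure q z h (hF w)
  have h2 : ∀ f, redMul q j f = swapVar i j (redMul q i (swapVar i j f)) := fun f => by
    rw [swapVar_redMul, swapVar_swapVar, Equiv.swap_apply_left]
  simp only [h2, opT_apply, opL_apply, leftMulT_opL, leftMulT_opT, leftMulT_leftMulT z h,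
    skeinError, LinearMap.add_apply, LinearMap.smul_apply, LinearMap.comp_apply, map_add,
    AlgHom.toLinearMap_apply, Pi.add_apply, Pi.smul_apply, map_smul] at h1 ⊢
  simp only [MvPolynomial.smul_eq_C_mul] at h1 ⊢
  linear_combination h1

theorem opL_comm {i j : Fin n} (h : i ≠ j) (hF : F ∈ lowDegree R n d) :
    opL q i (opT z i j (opL q i (opT z i j F)) + opT z i j F) =
      opT z i j (opL q i (opT z i j (opL q i F))) + opT z i j (opL q i F) := by
  ext1 w
  rw [Pi.add_apply, opT_opL_opT z q h (opL_mem_lowDegree q i hF), leftMulT_opL,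
    skeinError_redMul q z h (leftMulT_mem_lowDegree z i j hF w), opL_apply, opL_apply,
    Pi.add_apply, opT_opL_opT z q h hF, map_add, map_smul, redMul_comm q h]

end Operators

end CyclotomicHecke

namespace CyclotomicHecke

open MvPolynomial

/-! ### The representation of the cyclotomic Hecke algebra. -/

section Representation

variable {R : Type*} [CommRing R] [IsDomain R] {n d : ℕ}

/-- The operator `T_k` on the representation space. -/
noncomputable def repT (z : R) (n d k : ℕ) : Module.End R (lowDegree R n d) :=
  if h : k < n - 1 then
    (opT z (lo ⟨k, h⟩) (hi ⟨k, h⟩)).restrict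
      (fun _ hF => opT_mem_lowDegree z (lo_ne_hi ⟨k, h⟩) hF)
  else 0

/-- The operator `L_0` on the representation space. -/
noncomputable def repL (q : Fin (d + 1) → R) (n : ℕ) : Module.End R (lowDegree R n d) :=
  if h : 0 < n then
    (opL q (⟨0, h⟩ : Fin n)).restrict (fun _ hF => opL_mem_lowDegree q _ hF)
  else 0

theorem coe_repT (z : R) (r : Fin (n - 1)) (F : lowDegree R n d) :
    (repT z n d r F : Equiv.Perm (Fin n) → MvPolynomial (Fin n) R) = opT z (lo r) (hi r) F := by
  rw [repT, dif_pos r.2]; rfl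

theorem coe_repT' (z : R) {k : ℕ} (h : k + 1 < n) (F : lowDegree R n d) :
    (repT z n d k F : Equiv.Perm (Fin n) → MvPolynomial (Fin n) R) =
      opT z ⟨k, by omega⟩ ⟨k + 1, h⟩ F :=
  coe_repT z ⟨k, by omega⟩ F

theorem coe_repL (q : Fin (d + 1) → R) (i : Fin n) (hi : i.1 = 0) (F : lowDegree R n d) :
    (repL q n F : Equiv.Perm (Fin n) → MvPolynomial (Fin n) R) = opL q i F := by
  obtain ⟨i, h⟩ := i
  obtain rfl : i = 0 := hi
  rw [repL, dif_pos h]; rfl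

theorem prod_repL (q : Fin (d + 1) → R) (s : List R) (i : Fin n) (hi : i.1 = 0)
    (F : lowDegree R n d) (w : Equiv.Perm (Fin n)) :
    ((s.map fun c => repL q n - algebraMap R (Module.End R (lowDegree R n d)) c).prod F :
        Equiv.Perm (Fin n) → MvPolynomial (Fin n) R) w =
      (s.map fun c => redMul q i - algebraMap R (Module.End R (MvPolynomial (Fin n) R)) c).prod
        ((F : Equiv.Perm (Fin n) → MvPolynomial (Fin n) R) w) := by
  induction s with
  | nil => simp
  | cons a s ih =>
    simp only [List.map_cons, List.prod_cons, Module.End.mul_apply, LinearMap.sub_apply,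
      Module.algebraMap_end_apply, Submodule.coe_sub, Submodule.coe_smul, Pi.sub_apply,
      Pi.smul_apply, coe_repL q i hi, opL_apply, ih]

theorem exists_rep (ξ : Rˣ) (Q : Fin (d + 1) → R) :
    ∃ ψ : HeckeAlg n (d + 1) ξ Q →ₐ[R] Module.End R (lowDegree R n d),
      (∀ r F, (ψ (T ξ Q r) F : Equiv.Perm (Fin n) → MvPolynomial (Fin n) R) =
        opT (ξ : R) (lo r) (hi r) F) ∧
      ∀ i : Fin n, i.1 = 0 → ∀ F,
        (ψ (L ξ Q i) F : Equiv.Perm (Fin n) → MvPolynomial (Fin n) R) = opL Q i F := by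
  refine (exists_algHom (n := n) (ξ := ξ) (t := repT (ξ : R) n d)
    (l := repL Q n) Q ?_ ?_ ?_ ?_ ?_ ?_).imp fun ψ ⟨hT, hL⟩ =>
      ⟨fun r F => by rw [hT, coe_repT], fun i hi F => by rw [hL, hi, iterL, coe_repL Q i hi]⟩
  · intro r hr
    ext1 F
    apply Subtype.ext
    have := opT_opT (ξ : R) (i := ⟨r, by omega⟩) (j := ⟨r + 1, hr⟩) (by simp)
      (F : Equiv.Perm (Fin n) → MvPolynomial (Fin n) R)
    simpa [coe_repT' _ hr] using this
  · intro r s h hs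
    ext1 F
    apply Subtype.ext
    simp only [Module.End.mul_apply, coe_repT' _ hs, coe_repT' _ (show r + 1 < n by omega)]
    apply opT_comm <;> simp only [ne_eq, Fin.mk.injEq] <;> omega
  · intro r hr
    ext1 F
    apply Subtype.ext
    simp only [Module.End.mul_apply, coe_repT' _ (show r + 1 < n by omega),
      coe_repT' _ (show r + 1 + 1 < n by omega)]
    apply opT_braid <;> simp only [ne_eq, Fin.mk.injEq] <;> omega
  · intro r h hr
    ext1 F
    apply Subtype.ext
    have e' := coe_repL (n := n) Q ⟨0, by omega⟩ rfl
    simp only [Module.End.mul_apply, coe_repT' _ hr, e']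
    exact opT_opL_comm _ _ (by simp) (by simpa using h) (by simp) _
  · intro h
    have e : ∀ F : lowDegree R n d, (repT (ξ : R) n d 0 F :
        Equiv.Perm (Fin n) → MvPolynomial (Fin n) R) = opT (ξ : R) ⟨0, by omega⟩ ⟨1, h⟩ F :=
      coe_repT' (ξ : R) (k := 0) h
    have e' := coe_repL (n := n) Q ⟨0, by omega⟩ rfl
    ext1 F
    apply Subtype.ext
    have := opL_comm (ξ : R) Q (i := ⟨0, by omega⟩) (j := ⟨1, h⟩) (by simp) F.2
    simp only [Module.End.mul_apply, LinearMap.add_apply, Submodule.coe_add, e, e', map_add]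
    rw [map_add] at this
    exact this
  · intro h
    ext1 F
    apply Subtype.ext
    ext1 w
    have h1 := prod_repL Q (List.ofFn Q) ⟨0, h⟩ rfl F w
    have h2 := prod_redMul_eq_zero Q (i := ⟨0, h⟩) (F.2 w)
    simp only [List.map_ofFn, Function.comp_def] at h1
    rw [h1, h2]
    rfl

/-- The representation of the cyclotomic Hecke algebra on functions on the symmetric group with
polynomial values of low degree. -/
noncomputable def rep (ξ : Rˣ) (Q : Fin (d + 1) → R) :
    HeckeAlg n (d + 1) ξ Q →ₐ[R] Module.End R (lowDegree R n d) :=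
  (exists_rep ξ Q).choose

variable (ξ : Rˣ) (Q : Fin (d + 1) → R)

theorem rep_T (r : Fin (n - 1)) (F : lowDegree R n d) :
    (rep ξ Q (T ξ Q r) F : Equiv.Perm (Fin n) → MvPolynomial (Fin n) R) =
      opT (ξ : R) (lo r) (hi r) F :=
  (exists_rep ξ Q).choose_spec.1 r F

theorem rep_L (i : Fin n) (hi : i.1 = 0) (F : lowDegree R n d) :
    (rep ξ Q (L ξ Q i) F : Equiv.Perm (Fin n) → MvPolynomial (Fin n) R) = opL Q i F :=
  (exists_rep ξ Q).choose_spec.2 i hi F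

end Representation

/-! ### The relations in the algebra itself. -/

section Relations

variable {R : Type*} [CommRing R] {n ℓ : ℕ} (ξ : Rˣ) (Q : Fin ℓ → R)

theorem T_mul_T (r : Fin (n - 1)) :
    T ξ Q r * T ξ Q r = ((ξ : R) - 1) • T ξ Q r + (ξ : R) • 1 := by
  have h := RingQuot.mkAlgHom_rel R (Rel.quadratic (R := R) (ξ := ξ) (Q := Q) r)
  simp only [map_mul, map_add, map_sub, map_one, map_zero, AlgHom.commutes] at h
  change (T ξ Q r + 1) * (T ξ Q r - algebraMap R (HeckeAlg n ℓ ξ Q) ξ) = 0 at h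
  have h2 : T ξ Q r * algebraMap R (HeckeAlg n ℓ ξ Q) ξ = (ξ : R) • T ξ Q r := by
    rw [← Algebra.commutes, Algebra.smul_def]
  rw [add_mul, mul_sub, h2, one_mul, Algebra.algebraMap_eq_smul_one] at h
  rw [sub_smul, one_smul, ← sub_eq_zero, ← h]
  abel

theorem L_comm (i j : Fin n) : Commute (L ξ Q i) (L ξ Q j) := by
  have h := RingQuot.mkAlgHom_rel R (Rel.comm_L (R := R) (ξ := ξ) (Q := Q) i j)
  simp only [map_mul] at h
  exact h

theorem T_comm {r s : Fin (n - 1)} (hrs : r.1 + 1 < s.1 ∨ s.1 + 1 < r.1) :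
    Commute (T ξ Q r) (T ξ Q s) := by
  have h := RingQuot.mkAlgHom_rel R (Rel.comm_T (R := R) (ξ := ξ) (Q := Q) r s hrs)
  simp only [map_mul] at h
  exact h

theorem T_braid {r s : Fin (n - 1)} (hrs : s.1 = r.1 + 1) :
    T ξ Q r * T ξ Q s * T ξ Q r = T ξ Q s * T ξ Q r * T ξ Q s := by
  have h := RingQuot.mkAlgHom_rel R (Rel.braid (R := R) (ξ := ξ) (Q := Q) r s hrs)
  simp only [map_mul] at h
  exact h

theorem T_L_comm {r : Fin (n - 1)} {t : Fin n} (h₁ : t ≠ lo r) (h₂ : t ≠ hi r) :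
    Commute (T ξ Q r) (L ξ Q t) := by
  have h := RingQuot.mkAlgHom_rel R (Rel.comm_TL (R := R) (ξ := ξ) (Q := Q) r t h₁ h₂)
  simp only [map_mul] at h
  exact h

theorem L_hi_mul (r : Fin (n - 1)) :
    L ξ Q (hi r) * T ξ Q r =
      T ξ Q r * L ξ Q (lo r) + 1 + ((ξ : R) - 1) • L ξ Q (hi r) := by
  have h := RingQuot.mkAlgHom_rel R (Rel.skein (R := R) (ξ := ξ) (Q := Q) r)
  simp only [map_mul, map_add, map_sub, map_one, AlgHom.commutes] at h
  change L ξ Q (hi r) * (T ξ Q r - algebraMap R (HeckeAlg n ℓ ξ Q) ξ + 1) =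
    T ξ Q r * L ξ Q (lo r) + 1 at h
  rw [← h, mul_add, mul_sub, ← Algebra.commutes, ← Algebra.smul_def, sub_smul, one_smul, mul_one]
  abel

theorem smul_L_hi (r : Fin (n - 1)) :
    (ξ : R) • L ξ Q (hi r) = (T ξ Q r * L ξ Q (lo r) + 1) * T ξ Q r := by
  have h1 := L_hi_mul ξ Q r
  have h2 : T ξ Q r * L ξ Q (lo r) + 1 = L ξ Q (hi r) * T ξ Q r - ((ξ : R) - 1) • L ξ Q (hi r) := by
    rw [h1]; abel
  rw [h2, sub_mul, mul_assoc, T_mul_T, smul_mul_assoc, mul_add, mul_smul_comm, mul_smul_comm,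
    mul_one]
  abel

theorem L_hi (r : Fin (n - 1)) :
    L ξ Q (hi r) = (↑ξ⁻¹ : R) • ((T ξ Q r * L ξ Q (lo r) + 1) * T ξ Q r) := by
  rw [← smul_L_hi, smul_smul]; simp

theorem prod_L_sub (i : Fin n) (hi : i.1 = 0) :
    (List.ofFn fun l => L ξ Q i - algebraMap R (HeckeAlg n ℓ ξ Q) (Q l)).prod = 0 := by
  have h := RingQuot.mkAlgHom_rel R (Rel.cyclotomic (R := R) (ξ := ξ) (Q := Q) i hi)
  rw [map_list_prod, List.map_ofFn, map_zero] at h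
  refine Eq.trans ?_ h
  congr 2
  ext l
  simp only [Function.comp, map_sub, AlgHom.commutes]
  rfl

/-- The Hecke algebra is generated by the `L_i` and `T_r`. -/
theorem adjoin_generators :
    Algebra.adjoin R (Set.range (L ξ Q) ∪ Set.range (T ξ Q) : Set (HeckeAlg n ℓ ξ Q)) = ⊤ := by
  have h1 : (RingQuot.mkAlgHom R (Rel R n ℓ ξ Q)).range = ⊤ :=
    AlgHom.range_eq_top _ |>.2 (RingQuot.mkAlgHom_surjective R _)
  refine top_le_iff.1 ?_
  change (⊤ : Subalgebra R (RingQuot (Rel R n ℓ ξ Q))) ≤ _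
  rw [← h1, ← Algebra.map_top, ← FreeAlgebra.adjoin_range_ι, AlgHom.map_adjoin]
  refine Algebra.adjoin_mono ?_
  rintro _ ⟨_, ⟨g, rfl⟩, rfl⟩
  cases g with
  | L i => exact Or.inl ⟨i, rfl⟩
  | T r => exact Or.inr ⟨r, rfl⟩

end Relations

end CyclotomicHecke

namespace CyclotomicHecke

open MvPolynomial

/-! ### Standard monomials acting on the unit vector. -/

section EvalL

variable {R : Type*} [CommRing R] {n ℓ : ℕ} (ξ : Rˣ) (Q : Fin ℓ → R)

instance isMulCommutative_adjoin_L :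
    IsMulCommutative (Algebra.adjoin R (Set.range (L ξ Q) : Set (HeckeAlg n ℓ ξ Q))) :=
  Algebra.isMulCommutative_adjoin R (by
    rintro _ ⟨i, rfl⟩ _ ⟨j, rfl⟩; exact L_comm ξ Q i j)

open scoped IsMulCommutative in
/-- Evaluation of polynomials at the commuting elements `L_i`. -/
noncomputable def evalL : MvPolynomial (Fin n) R →ₐ[R] HeckeAlg n ℓ ξ Q :=
  (Algebra.adjoin R (Set.range (L ξ Q) : Set (HeckeAlg n ℓ ξ Q))).val.comp
    (aeval (S₁ := Algebra.adjoin R (Set.range (L ξ Q) : Set (HeckeAlg n ℓ ξ Q)))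
      fun i => ⟨L ξ Q i, Algebra.subset_adjoin ⟨i, rfl⟩⟩)

open scoped IsMulCommutative in
@[simp] theorem evalL_X (i : Fin n) : evalL ξ Q (X i) = L ξ Q i := by simp [evalL]

theorem monomial_eq_prod_ofFn (c : Fin n →₀ ℕ) :
    (MvPolynomial.monomial c 1 : MvPolynomial (Fin n) R) = (List.ofFn fun i => X i ^ c i).prod := by
  rw [MvPolynomial.monomial_eq, C_1, one_mul, Finsupp.prod_fintype _ _ (by simp), List.prod_ofFn]

theorem evalL_monomial (c : Fin n →₀ ℕ) :
    evalL ξ Q (MvPolynomial.monomial c 1) = (List.ofFn fun i => L ξ Q i ^ c i).prod := by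
  rw [monomial_eq_prod_ofFn, map_list_prod, List.map_ofFn]
  congr 2
  ext i
  simp

end EvalL

section Action

set_option linter.unusedSectionVars false

variable {R : Type*} [CommRing R] [IsDomain R] {n d : ℕ}

theorem opT_X_mul (z : R) {i j : Fin n} (h : i ≠ j)
    (F : Equiv.Perm (Fin n) → MvPolynomial (Fin n) R) (w : Equiv.Perm (Fin n)) :
    opT z i j (fun w => X i * F w) w = X j * opT z i j F w - linX z j * F w := by
  have := congrFun (leftMulT_comp z (LinearMap.mulLeft R (X i)) i j F) w
  simp only [LinearMap.mulLeft_apply] at this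
  rw [opT_apply, opT_apply, this, map_mul, swapVar_X_left, demazure_X_mul z h]
  ring

theorem opT_mul (z : R) {i j : Fin n} (h : i ≠ j) {m : MvPolynomial (Fin n) R}
    (hm : swapVar i j m = m)
    (F : Equiv.Perm (Fin n) → MvPolynomial (Fin n) R) (w : Equiv.Perm (Fin n)) :
    opT z i j (fun w => m * F w) w = m * opT z i j F w := by
  have := congrFun (leftMulT_comp z (LinearMap.mulLeft R m) i j F) w
  simp only [LinearMap.mulLeft_apply] at this
  rw [opT_apply, opT_apply, this, map_mul, hm, demazure_mul z h hm]
  ring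

/-- At an ascent the finite `T` takes `w` to `s w` without correction, and `demazure` kills
constants. -/
theorem opT_single (z : R) {i j : Fin n} (h : i ≠ j) {w : Equiv.Perm (Fin n)}
    (hw : ¬ w⁻¹ j < w⁻¹ i) :
    opT z i j (Pi.single w (1 : MvPolynomial (Fin n) R)) = Pi.single (Equiv.swap i j * w) 1 := by
  have hne : Equiv.swap i j * w ≠ w := by
    intro e
    have := congrFun (congrArg DFunLike.coe (mul_eq_right.1 e)) i
    simp at this
    exact h this.symm
  have hd := (not_descent_swap_mul h w).2 hw
  ext1 v
  rw [opT_apply, leftMulT_apply]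
  have h0 : demazure z i j ((Pi.single w (1 : MvPolynomial (Fin n) R) :
      Equiv.Perm (Fin n) → MvPolynomial (Fin n) R) v) = 0 := by
    apply demazure_eq_zero z h
    by_cases hv : v = w
    · subst hv; simp
    · simp [hv]
  rw [h0, add_zero]
  by_cases hv : v = Equiv.swap i j * w
  · subst hv
    rw [if_pos hd, ← mul_assoc, Equiv.swap_mul_self, one_mul, Pi.single_eq_same,
      Pi.single_eq_same, Pi.single_eq_of_ne hne]
    simp
  · have hv' : Equiv.swap i j * v ≠ w := by
      rintro rfl
      apply hv
      rw [← mul_assoc, Equiv.swap_mul_self, one_mul]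
    rw [Pi.single_eq_of_ne hv, Pi.single_eq_of_ne hv']
    by_cases hvw : v = w
    · subst hvw
      rw [if_neg hw, smul_zero, map_zero]
    · rw [Pi.single_eq_of_ne hvw]
      simp

variable (ξ : Rˣ) (Q : Fin (d + 1) → R)

/-- `L_k` acts as multiplication by `x_k` on polynomials of sufficiently low degree. -/
theorem rep_L_of_lt (k : ℕ) (hk : k < n) (F : lowDegree R n d)
    (h0 : ∀ w (j : Fin n), j.1 < k → degreeOf j (F.1 w) ≤ 0)
    (h1 : ∀ w, degreeOf ⟨k, hk⟩ (F.1 w) < d) :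
    (rep ξ Q (L ξ Q ⟨k, hk⟩) F).1 = fun w => X ⟨k, hk⟩ * F.1 w := by
  induction k generalizing F with
  | zero =>
    ext1 w
    rw [rep_L ξ Q _ rfl, opL_apply, redMul_of_lt Q (h1 w)]
  | succ k ih =>
    set r : Fin (n - 1) := ⟨k, by omega⟩ with hr
    have hlo : (lo r : Fin n) = ⟨k, by omega⟩ := rfl
    have hhi : (hi r : Fin n) = ⟨k + 1, hk⟩ := rfl
    rw [← hhi, L_hi]
    set G := rep ξ Q (T ξ Q r) F with hG
    have hG1 : G.1 = opT (ξ : R) (lo r) (hi r) F.1 := rep_T ξ Q r F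
    -- `F` has degree `0` in `x_k` and at most `d - 1` in `x_{k+1}`; `T` may spread the latter bound
    -- to both variables, but does not exceed it.
    have hd : ∀ w, degreeOf (lo r) (G.1 w) ≤ d - 1 := fun w => by
      rw [hG1]
      refine (degreeOf_opT_le (ξ : R) (lo_ne_hi r) (fun w => ?_) (fun w => ?_) w).1
      · exact (h0 w _ (by simp [lo, hr])).trans (by omega)
      · have := h1 w
        rw [hhi]; omega
    have hd0 : 0 < d := (Nat.zero_le _).trans_lt (h1 1)
    have hLG := ih (by omega) G (fun w j hj => by
        rw [hG1]
        refine degreeOf_opT_of_ne_le (ξ : R) (lo_ne_hi r) ?_ ?_ (fun w => h0 w j (by omega)) w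
        · intro e; simp [e, lo, hr] at hj
        · intro e; simp [e, hi, hr] at hj)
      (fun w => by have := hd w; rw [hlo] at this; omega)
    ext1 w
    have hGG := congrFun (opT_opT (ξ : R) (lo_ne_hi r) F.1) w
    rw [← hG1] at hGG
    have h2 : (rep ξ Q ((↑ξ⁻¹ : R) • ((T ξ Q r * L ξ Q (lo r) + 1) * T ξ Q r)) F).1 w =
        (↑ξ⁻¹ : R) • (opT (ξ : R) (lo r) (hi r) (rep ξ Q (L ξ Q (lo r)) G).1 w + G.1 w) := by
      rw [← rep_T ξ Q]
      simp [hG]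
    -- `T (x_k G) = x_{k+1} T G - (1 + (ξ - 1) x_{k+1}) G`; adding `G` and using the quadratic
    -- relation leaves `ξ x_{k+1} F`.
    rw [h2, hlo, hLG, ← hlo, opT_X_mul _ (lo_ne_hi r), hGG]
    have h3 : (C (↑ξ⁻¹ : R) * C (ξ : R) : MvPolynomial (Fin n) R) = 1 := by
      rw [← C_mul]; simp
    simp only [Pi.add_apply, Pi.smul_apply, linX, MvPolynomial.smul_eq_C_mul]
    linear_combination X (hi r) * F.1 w * h3

theorem single_mem_lowDegree (w : Equiv.Perm (Fin n)) {f : MvPolynomial (Fin n) R}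
    (hf : ∀ k, degreeOf k f ≤ d) : Pi.single w f ∈ lowDegree R n d := by
  intro v k
  by_cases h : v = w
  · subst h; simpa using hf k
  · simp [h]

theorem degreeOf_monomial_le (c : Fin n →₀ ℕ) (k : Fin n) :
    degreeOf k (MvPolynomial.monomial c (1 : R)) ≤ c k := by
  rw [degreeOf_monomial_eq _ _ one_ne_zero]

/-- The element of the representation space corresponding to the basis element `x^c w`. -/
noncomputable def stdVec (R : Type*) [CommRing R] [IsDomain R] {n d : ℕ} (c : Fin n →₀ ℕ)
    (hc : ∀ k, c k ≤ d) (w : Equiv.Perm (Fin n)) : lowDegree R n d :=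
  ⟨Pi.single w (MvPolynomial.monomial c 1),
    single_mem_lowDegree w fun k => (degreeOf_monomial_le c k).trans (hc k)⟩

/-- The unit vector, which generates the representation. -/
noncomputable def unitVec (R : Type*) [CommRing R] [IsDomain R] (n d : ℕ)
    (w : Equiv.Perm (Fin n)) : lowDegree R n d :=
  ⟨Pi.single w 1, single_mem_lowDegree w fun k => by simp⟩

/-- Each letter of a reduced word is an ascent of the product of the letters to its right, so
`opT_single` applies throughout. -/
theorem rep_wordT (s : List (Fin (n - 1))) (hs : IsReduced s) :
    rep ξ Q (wordT ξ Q s) (unitVec R n d 1) = unitVec R n d (wordPerm s) := by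
  induction s with
  | nil => simp [wordT, wordPerm]
  | cons r s ih =>
    have h1 : wordT ξ Q (r :: s) = T ξ Q r * wordT ξ Q s := by simp [wordT]
    have h2 : wordPerm (r :: s) = Equiv.swap (lo r) (hi r) * wordPerm s := by simp [wordPerm]
    rw [h1, h2, map_mul, Module.End.mul_apply, ih hs.tail]
    apply Subtype.ext
    rw [rep_T]
    exact opT_single _ (lo_ne_hi r) (not_descent_of_isReduced hs)

/-- The variable of smallest index is peeled off. The remaining monomial then has no earlier
variable and exponent below `d` at this one, as `rep_L_of_lt` requires. -/
theorem rep_evalL_monomial (c : Fin n →₀ ℕ) (hc : ∀ k, c k ≤ d) (w : Equiv.Perm (Fin n)) :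
    rep ξ Q (evalL ξ Q (MvPolynomial.monomial c 1)) (unitVec R n d w) = stdVec R c hc w := by
  induction h : c.degree generalizing c with
  | zero =>
    obtain rfl : c = 0 := (Finsupp.degree_eq_zero_iff c).1 h
    have : (MvPolynomial.monomial 0 1 : MvPolynomial (Fin n) R) = 1 := rfl
    rw [this, map_one, map_one]
    rfl
  | succ N ih =>
    have hne : c.support.Nonempty := by
      rw [Finsupp.support_nonempty_iff]
      rintro rfl
      simp at h
    obtain ⟨k, hkc, hlt⟩ : ∃ k, c k ≠ 0 ∧ ∀ j, j < k → c j = 0 :=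
      ⟨c.support.min' hne, Finsupp.mem_support_iff.1 (c.support.min'_mem hne), fun j hj => by
        by_contra hcj
        exact absurd (c.support.min'_le j (Finsupp.mem_support_iff.2 hcj)) (not_le.2 hj)⟩
    clear hne
    obtain ⟨c', rfl⟩ : ∃ c', c = Finsupp.single k 1 + c' :=
      ⟨c - Finsupp.single k 1, (add_tsub_cancel_of_le
        (Finsupp.single_le_iff.2 (Nat.one_le_iff_ne_zero.2 hkc))).symm⟩
    have hc' : ∀ j, c' j ≤ d := fun j => (by simp : c' j ≤ _).trans (hc j)
    have hX : (MvPolynomial.monomial (Finsupp.single k 1 + c') 1 : MvPolynomial (Fin n) R) =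
        X k * MvPolynomial.monomial c' 1 := by
      rw [X, MvPolynomial.monomial_mul, one_mul]
    rw [hX, map_mul, evalL_X, map_mul, Module.End.mul_apply,
      ih c' hc' (by simp at h; omega)]
    apply Subtype.ext
    rw [rep_L_of_lt ξ Q k.1 k.2 _ (fun v j hj => ?_) (fun v => ?_)]
    · ext1 v
      by_cases hv : v = w
      · subst hv; simp [stdVec, hX]
      · simp [stdVec, hv]
    · by_cases hv : v = w
      · subst hv
        have := hlt j hj
        simp only [Finsupp.add_apply, Nat.add_eq_zero_iff] at this
        simpa [stdVec, this.2] using degreeOf_monomial_le (R := R) c' j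
      · simp [stdVec, hv]
    · have := hc k
      simp only [Finsupp.add_apply, Finsupp.single_eq_same] at this
      by_cases hv : v = w
      · subst hv
        have := degreeOf_monomial_le (R := R) c' k
        simp only [stdVec, Pi.single_eq_same]
        exact lt_of_le_of_lt this (by omega)
      · simp [stdVec, hv]
        omega

end Action

end CyclotomicHecke

namespace CyclotomicHecke

/-! ### The tower of subalgebras `A_k`. -/

section Tower

variable {R : Type*} [CommRing R] {n ℓ : ℕ} (ξ : Rˣ) (Q : Fin ℓ → R)

/-- `L_k` for a natural number `k`, with junk value `0`. -/
noncomputable def natL (n : ℕ) (k : ℕ) : HeckeAlg n ℓ ξ Q :=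
  if h : k < n then L ξ Q ⟨k, h⟩ else 0

/-- The generator `T` exchanging the positions `k - 1` and `k`, with junk value `0`. -/
noncomputable def natT (n : ℕ) (k : ℕ) : HeckeAlg n ℓ ξ Q :=
  if h : 0 < k ∧ k < n then T ξ Q ⟨k - 1, by omega⟩ else 0

theorem natL_of_lt {k : ℕ} (h : k < n) : natL ξ Q n k = L ξ Q ⟨k, h⟩ := dif_pos h

theorem natT_succ {k : ℕ} (h : k + 1 < n) : natT ξ Q n (k + 1) = T ξ Q ⟨k, by omega⟩ :=
  dif_pos ⟨k.succ_pos, h⟩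

@[simp] theorem natT_zero : natT ξ Q n 0 = 0 := dif_neg (by simp)

theorem natT_mul_self {k : ℕ} (h : k + 1 < n) : natT ξ Q n (k + 1) * natT ξ Q n (k + 1) =
    ((ξ : R) - 1) • natT ξ Q n (k + 1) + (ξ : R) • 1 := by
  rw [natT_succ ξ Q h, T_mul_T]

theorem natL_comm (i j : ℕ) : Commute (natL ξ Q n i) (natL ξ Q n j) := by
  unfold natL
  split_ifs
  · exact L_comm ξ Q _ _
  · exact Commute.zero_right _
  · exact Commute.zero_left _
  · exact Commute.zero_left _

theorem natT_comm_natT {i j : ℕ} (h : i + 1 < j) : Commute (natT ξ Q n i) (natT ξ Q n j) := by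
  unfold natT
  split_ifs
  · exact T_comm ξ Q (Or.inl (by simp only; omega))
  · exact Commute.zero_right _
  · exact Commute.zero_left _
  · exact Commute.zero_left _

theorem natT_comm_natL {i j : ℕ} (h1 : j ≠ i) (h2 : j + 1 ≠ i) :
    Commute (natT ξ Q n i) (natL ξ Q n j) := by
  unfold natT natL
  split_ifs
  · exact T_L_comm ξ Q (by simp only [ne_eq, lo, Fin.mk.injEq]; omega)
      (by simp only [ne_eq, hi, Fin.mk.injEq]; omega)
  · exact Commute.zero_right _
  · exact Commute.zero_left _
  · exact Commute.zero_left _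

theorem natT_braid {k : ℕ} (h : k + 2 < n) :
    natT ξ Q n (k + 2) * natT ξ Q n (k + 1) * natT ξ Q n (k + 2) =
      natT ξ Q n (k + 1) * natT ξ Q n (k + 2) * natT ξ Q n (k + 1) := by
  rw [natT_succ ξ Q (show k + 1 < n by omega), natT_succ ξ Q h]
  exact (T_braid ξ Q rfl).symm

theorem natL_succ {k : ℕ} (h : k + 1 < n) :
    natL ξ Q n (k + 1) =
      (↑ξ⁻¹ : R) • ((natT ξ Q n (k + 1) * natL ξ Q n k + 1) * natT ξ Q n (k + 1)) := by
  rw [natL_of_lt ξ Q h, natT_succ ξ Q h, natL_of_lt ξ Q (show k < n by omega)]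
  exact L_hi ξ Q ⟨k, by omega⟩

theorem natL_mul_natT {k : ℕ} (h : k + 1 < n) :
    natL ξ Q n (k + 1) * natT ξ Q n (k + 1) =
      natT ξ Q n (k + 1) * natL ξ Q n k + 1 + ((ξ : R) - 1) • natL ξ Q n (k + 1) := by
  rw [natL_of_lt ξ Q h, natT_succ ξ Q h, natL_of_lt ξ Q (show k < n by omega)]
  exact L_hi_mul ξ Q ⟨k, by omega⟩

/-- Iteration of `natL_mul_natT`. Consecutive powers of `L_{k+1}` come in pairs with coefficients
`1` and `ξ - 1`, exactly the combination annihilated in `repTrace_mul_monL_add`. -/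
theorem natL_pow_mul_natT {k : ℕ} (h : k + 1 < n) (c : ℕ) :
    natL ξ Q n (k + 1) ^ c * natT ξ Q n (k + 1) =
      natT ξ Q n (k + 1) * natL ξ Q n k ^ c + ∑ i ∈ Finset.range c, natL ξ Q n k ^ i *
        (natL ξ Q n (k + 1) ^ (c - 1 - i) + ((ξ : R) - 1) • natL ξ Q n (k + 1) ^ (c - i)) := by
  induction c with
  | zero => simp
  | succ c ih =>
    have hc := (natL_comm ξ Q (n := n) k (k + 1))
    rw [pow_succ', mul_assoc, ih, mul_add, ← mul_assoc, natL_mul_natT ξ Q h, Finset.mul_sum,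
      Finset.sum_range_succ, pow_succ', add_mul, add_mul]
    have e1 : ∀ i ∈ Finset.range c, natL ξ Q n (k + 1) * (natL ξ Q n k ^ i *
        (natL ξ Q n (k + 1) ^ (c - 1 - i) + ((ξ : R) - 1) • natL ξ Q n (k + 1) ^ (c - i))) =
        natL ξ Q n k ^ i * (natL ξ Q n (k + 1) ^ (c + 1 - 1 - i) +
          ((ξ : R) - 1) • natL ξ Q n (k + 1) ^ (c + 1 - i)) := by
      intro i hi
      have hi' := Finset.mem_range.1 hi
      rw [← mul_assoc, ← (hc.pow_left i).eq, mul_assoc, mul_add, mul_smul_comm, ← pow_succ',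
        ← pow_succ', show c - 1 - i + 1 = c + 1 - 1 - i by omega,
        show c - i + 1 = c + 1 - i by omega]
    rw [Finset.sum_congr rfl e1]
    have e2 : natL ξ Q n k ^ c * (natL ξ Q n (k + 1) ^ (c + 1 - 1 - c) +
        ((ξ : R) - 1) • natL ξ Q n (k + 1) ^ (c + 1 - c)) =
        1 * natL ξ Q n k ^ c + ((ξ : R) - 1) • natL ξ Q n (k + 1) * natL ξ Q n k ^ c := by
      rw [show c + 1 - 1 - c = 0 by omega, show c + 1 - c = 1 by omega, pow_zero, pow_one, mul_add,
        mul_one, one_mul, mul_smul_comm, smul_mul_assoc, (hc.pow_left c).eq]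
    rw [e2, mul_assoc]
    abel

/-- The subalgebra generated by `L_0, …, L_{k-1}` and the `T` exchanging two of the positions
`0, …, k - 1`. -/
noncomputable def sub (n k : ℕ) : Subalgebra R (HeckeAlg n ℓ ξ Q) :=
  Algebra.adjoin R (natL ξ Q n '' Set.Iio k ∪ natT ξ Q n '' Set.Iio k)

theorem natL_mem_sub {i k : ℕ} (h : i < k) : natL ξ Q n i ∈ sub ξ Q n k :=
  Algebra.subset_adjoin (Or.inl ⟨i, h, rfl⟩)

theorem natT_mem_sub {i k : ℕ} (h : i < k) : natT ξ Q n i ∈ sub ξ Q n k :=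
  Algebra.subset_adjoin (Or.inr ⟨i, h, rfl⟩)

theorem sub_mono {i k : ℕ} (h : i ≤ k) : sub ξ Q n i ≤ sub ξ Q n k :=
  Algebra.adjoin_mono (Set.union_subset_union (Set.image_mono (Set.Iio_subset_Iio h))
    (Set.image_mono (Set.Iio_subset_Iio h)))

theorem sub_top : sub ξ Q n n = ⊤ := by
  rw [← top_le_iff, ← adjoin_generators]
  refine Algebra.adjoin_le ?_
  rintro _ (⟨i, rfl⟩ | ⟨r, rfl⟩)
  · rw [← natL_of_lt ξ Q i.2]; exact natL_mem_sub ξ Q i.2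
  · have h : r.1 + 1 < n := by have := r.2; omega
    have := natT_mem_sub ξ Q (n := n) h
    rwa [natT_succ ξ Q h] at this

theorem commute_of_mem_sub {k : ℕ} {x y : HeckeAlg n ℓ ξ Q} (hx : x ∈ sub ξ Q n k)
    (hL : ∀ i < k, Commute (natL ξ Q n i) y) (hT : ∀ i < k, Commute (natT ξ Q n i) y) :
    Commute x y := by
  refine (Algebra.commute_of_mem_adjoin_of_forall_mem_commute hx ?_).symm
  rintro _ (⟨i, hi, rfl⟩ | ⟨i, hi, rfl⟩)
  · exact (hL i hi).symm
  · exact (hT i hi).symm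

theorem sub_comm_natL {k j : ℕ} (h : k ≤ j) {x : HeckeAlg n ℓ ξ Q} (hx : x ∈ sub ξ Q n k) :
    Commute x (natL ξ Q n j) :=
  commute_of_mem_sub ξ Q hx (fun i _ => natL_comm ξ Q i j)
    (fun i hi => natT_comm_natL ξ Q (by omega) (by omega))

theorem sub_comm_natT {k j : ℕ} (h : k < j) {x : HeckeAlg n ℓ ξ Q} (hx : x ∈ sub ξ Q n k) :
    Commute x (natT ξ Q n j) :=
  commute_of_mem_sub ξ Q hx (fun i hi => (natT_comm_natL ξ Q (by omega) (by omega)).symm)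
    (fun i hi => natT_comm_natT ξ Q (by omega))

end Tower

/-! ### Mackey decomposition and the size of a spanning set. -/

section Decomposition

variable {R : Type*} [CommRing R] {n d : ℕ} (ξ : Rˣ) (Q : Fin (d + 1) → R)

/-- The span of `A_k L_k^c` for `c ≤ d` and `A_k T A_k`, where `A_k = sub k` and `T` exchanges
`k - 1` and `k`. -/
noncomputable def mackey (n k : ℕ) : Submodule R (HeckeAlg n (d + 1) ξ Q) :=
  Submodule.span R
    ({x | ∃ a ∈ sub ξ Q n k, ∃ c ≤ d, x = a * natL ξ Q n k ^ c} ∪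
      {x | ∃ a ∈ sub ξ Q n k, ∃ b ∈ sub ξ Q n k, x = a * natT ξ Q n k * b})

variable {ξ Q}

theorem mul_natL_mem_mackey {k c : ℕ} {a : HeckeAlg n (d + 1) ξ Q} (ha : a ∈ sub ξ Q n k)
    (hc : c ≤ d) : a * natL ξ Q n k ^ c ∈ mackey ξ Q n k :=
  Submodule.subset_span (Or.inl ⟨a, ha, c, hc, rfl⟩)

theorem mul_natT_mul_mem_mackey {k : ℕ} {a b : HeckeAlg n (d + 1) ξ Q} (ha : a ∈ sub ξ Q n k)
    (hb : b ∈ sub ξ Q n k) : a * natT ξ Q n k * b ∈ mackey ξ Q n k :=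
  Submodule.subset_span (Or.inr ⟨a, ha, b, hb, rfl⟩)

theorem mul_mem_mackey_of_forall {k : ℕ} {y : HeckeAlg n (d + 1) ξ Q}
    (h1 : ∀ a ∈ sub ξ Q n k, ∀ c ≤ d, a * natL ξ Q n k ^ c * y ∈ mackey ξ Q n k)
    (h2 : ∀ a ∈ sub ξ Q n k, ∀ b ∈ sub ξ Q n k, a * natT ξ Q n k * b * y ∈ mackey ξ Q n k)
    {x : HeckeAlg n (d + 1) ξ Q} (hx : x ∈ mackey ξ Q n k) : x * y ∈ mackey ξ Q n k := by
  induction hx using Submodule.span_induction with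
  | mem x hx =>
    rcases hx with ⟨a, ha, c, hc, rfl⟩ | ⟨a, ha, b, hb, rfl⟩
    · exact h1 a ha c hc
    · exact h2 a ha b hb
  | zero => rw [zero_mul]; exact zero_mem _
  | add x x' _ _ hx hx' => rw [add_mul]; exact add_mem hx hx'
  | smul r x _ hx => rw [smul_mul_assoc]; exact Submodule.smul_mem _ _ hx

theorem mackey_mul_sub {k : ℕ} {x y : HeckeAlg n (d + 1) ξ Q} (hx : x ∈ mackey ξ Q n k)
    (hy : y ∈ sub ξ Q n k) : x * y ∈ mackey ξ Q n k := by
  refine mul_mem_mackey_of_forall (fun a ha c hc => ?_) (fun a ha b hb => ?_) hx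
  · rw [mul_assoc, ← ((sub_comm_natL ξ Q le_rfl hy).pow_right c).eq, ← mul_assoc]
    exact mul_natL_mem_mackey (mul_mem ha hy) hc
  · rw [mul_assoc]
    exact mul_natT_mul_mem_mackey ha (mul_mem hb hy)

theorem natL_pow_mul_natT_mem {k c : ℕ} (hk : k + 1 < n) (hc : c ≤ d)
    {a : HeckeAlg n (d + 1) ξ Q} (ha : a ∈ sub ξ Q n (k + 1)) :
    a * natL ξ Q n (k + 1) ^ c * natT ξ Q n (k + 1) ∈ mackey ξ Q n (k + 1) := by
  have hL : natL ξ Q n k ∈ sub ξ Q n (k + 1) := natL_mem_sub ξ Q (by omega)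
  rw [mul_assoc, natL_pow_mul_natT ξ Q hk, mul_add, ← mul_assoc, Finset.mul_sum]
  refine add_mem (mul_natT_mul_mem_mackey ha (pow_mem hL c)) (sum_mem fun i _ => ?_)
  rw [← mul_assoc, mul_add, mul_smul_comm]
  have hLi := mul_mem ha (pow_mem hL i)
  exact add_mem (mul_natL_mem_mackey hLi (by omega))
    (Submodule.smul_mem _ _ (mul_natL_mem_mackey hLi (by omega)))

theorem one_mem_mackey (k : ℕ) : (1 : HeckeAlg n (d + 1) ξ Q) ∈ mackey ξ Q n k := by
  simpa using mul_natL_mem_mackey (ξ := ξ) (Q := Q) (n := n) (k := k) (one_mem _) (Nat.zero_le d)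

/-- `mackey` contains `1` and is stable under `A_k` on the right; `A_{k+1}` has only two further
generators. -/
theorem sub_le_mackey_of_mul_mem {k : ℕ}
    (hL : ∀ x ∈ mackey ξ Q n k, x * natL ξ Q n k ∈ mackey ξ Q n k)
    (hT : ∀ x ∈ mackey ξ Q n k, x * natT ξ Q n k ∈ mackey ξ Q n k) :
    ∀ x ∈ sub ξ Q n (k + 1), x ∈ mackey ξ Q n k := by
  have key : ∀ x ∈ sub ξ Q n (k + 1), ∀ e ∈ mackey ξ Q n k, e * x ∈ mackey ξ Q n k := by
    intro x hx
    induction hx using Algebra.adjoin_induction with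
    | mem x hx =>
      intro e he
      rcases hx with ⟨i, hi, rfl⟩ | ⟨i, hi, rfl⟩
      · rcases Nat.lt_succ_iff_lt_or_eq.1 hi with h | rfl
        · exact mackey_mul_sub he (natL_mem_sub ξ Q h)
        · exact hL e he
      · rcases Nat.lt_succ_iff_lt_or_eq.1 hi with h | rfl
        · exact mackey_mul_sub he (natT_mem_sub ξ Q h)
        · exact hT e he
    | algebraMap r => exact fun e he => mackey_mul_sub he (Subalgebra.algebraMap_mem _ r)
    | add x y _ _ hx hy => intro e he; rw [mul_add]; exact add_mem (hx e he) (hy e he)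
    | mul x y _ _ hx hy => intro e he; rw [← mul_assoc]; exact hy _ (hx e he)
  intro x hx
  simpa using key x hx 1 (one_mem_mackey k)

/-- The cyclotomic relation is monic of degree `d + 1`. -/
theorem natL_zero_pow_mem [Nontrivial R] (hn : 0 < n) {a : HeckeAlg n (d + 1) ξ Q}
    (ha : a ∈ sub ξ Q n 0) : a * natL ξ Q n 0 ^ (d + 1) ∈ mackey ξ Q n 0 := by
  set p : Polynomial R := ∏ l, (Polynomial.X - Polynomial.C (Q l)) with hp
  have hp0 : Polynomial.aeval (natL ξ Q n 0) p = 0 := by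
    rw [← prod_L_sub ξ Q ⟨0, hn⟩ rfl, hp, ← List.prod_ofFn, map_list_prod, List.map_ofFn]
    congr 2
    ext l
    simp [natL_of_lt ξ Q hn]
  have hm : p.Monic := Polynomial.monic_prod_of_monic _ _ fun l _ =>
    Polynomial.monic_X_sub_C (Q l)
  have hdeg : p.natDegree = d + 1 := by
    rw [hp, Polynomial.natDegree_prod_of_monic _ _ fun l _ => Polynomial.monic_X_sub_C (Q l)]
    simp
  rw [hm.as_sum, hdeg] at hp0
  simp only [map_add, map_pow, Polynomial.aeval_X, map_sum, map_mul, Polynomial.aeval_C] at hp0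
  rw [eq_neg_of_add_eq_zero_left hp0, mul_neg, Finset.mul_sum]
  refine neg_mem (sum_mem fun i hi => ?_)
  rw [← Algebra.smul_def, mul_smul_comm]
  exact Submodule.smul_mem _ _ (mul_natL_mem_mackey ha
    (Nat.le_of_lt_succ (Finset.mem_range.1 hi)))

/-- `b` is split one level lower. For `u L_k^c`, the product `T L_k^c T` is straightened by
`natL_pow_mul_natT` and the quadratic relation; for `u T' v`, both `u` and `v` commute with `T` and
the braid relation applies. -/
theorem natT_mul_mul_natT_mem {k : ℕ} (hk : k + 1 < n) {a b : HeckeAlg n (d + 1) ξ Q}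
    (ha : a ∈ sub ξ Q n (k + 1)) (hb : b ∈ mackey ξ Q n k) :
    a * natT ξ Q n (k + 1) * b * natT ξ Q n (k + 1) ∈ mackey ξ Q n (k + 1) := by
  have hL : natL ξ Q n k ∈ sub ξ Q n (k + 1) := natL_mem_sub ξ Q (by omega)
  induction hb using Submodule.span_induction with
  | mem b hb =>
    rcases hb with ⟨u, hu, c, hc, rfl⟩ | ⟨u, hu, v, hv, rfl⟩
    · have hau : a * u ∈ sub ξ Q n (k + 1) := mul_mem ha (sub_mono ξ Q (by omega) hu)
      have h1 := natL_pow_mul_natT ξ Q (n := n) hk c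
      have h2 : a * natT ξ Q n (k + 1) * (u * natL ξ Q n k ^ c) * natT ξ Q n (k + 1) =
          a * u * natL ξ Q n (k + 1) ^ c * (natT ξ Q n (k + 1) * natT ξ Q n (k + 1)) -
          ∑ i ∈ Finset.range c, a * u * (natL ξ Q n k ^ i *
            (natL ξ Q n (k + 1) ^ (c - 1 - i) + ((ξ : R) - 1) • natL ξ Q n (k + 1) ^ (c - i))) *
            natT ξ Q n (k + 1) := by
        rw [← Finset.sum_mul, ← Finset.mul_sum, ← mul_assoc, mul_assoc a,
          ← (sub_comm_natT ξ Q (by omega) hu).eq]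
        rw [eq_sub_iff_add_eq, ← add_mul, mul_assoc (a * u) _ (natT ξ Q n (k + 1) * _),
          ← mul_assoc (natL ξ Q n (k + 1) ^ c), h1]
        noncomm_ring
      rw [h2]
      refine sub_mem ?_ (sum_mem fun i _ => ?_)
      · rw [natT_mul_self ξ Q hk, mul_add, mul_smul_comm, mul_smul_comm, mul_one]
        exact add_mem (Submodule.smul_mem _ _ (natL_pow_mul_natT_mem hk hc hau))
          (Submodule.smul_mem _ _ (mul_natL_mem_mackey hau hc))
      · have hi := mul_mem hau (pow_mem hL i)
        rw [← mul_assoc, mul_add, mul_smul_comm, add_mul, smul_mul_assoc]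
        exact add_mem (natL_pow_mul_natT_mem hk (by omega) hi)
          (Submodule.smul_mem _ _ (natL_pow_mul_natT_mem hk (by omega) hi))
    · rcases Nat.eq_zero_or_pos k with rfl | hk0
      · simp
      · obtain ⟨k, rfl⟩ : ∃ m, k = m + 1 := ⟨k - 1, by omega⟩
        have hT : natT ξ Q n (k + 1) ∈ sub ξ Q n (k + 2) := natT_mem_sub ξ Q (by omega)
        have h2 : a * natT ξ Q n (k + 2) * (u * natT ξ Q n (k + 1) * v) * natT ξ Q n (k + 2) =
            a * u * natT ξ Q n (k + 1) * natT ξ Q n (k + 2) * (natT ξ Q n (k + 1) * v) := by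
          have e1 := (sub_comm_natT ξ Q (show k + 1 < k + 2 by omega) hu).eq
          have e2 := (sub_comm_natT ξ Q (show k + 1 < k + 2 by omega) hv).eq
          calc a * natT ξ Q n (k + 2) * (u * natT ξ Q n (k + 1) * v) * natT ξ Q n (k + 2)
              = a * (natT ξ Q n (k + 2) * u) * natT ξ Q n (k + 1) *
                  (v * natT ξ Q n (k + 2)) := by noncomm_ring
            _ = a * u * (natT ξ Q n (k + 2) * natT ξ Q n (k + 1) * natT ξ Q n (k + 2)) * v := by
                rw [← e1, e2]; noncomm_ring
            _ = _ := by rw [natT_braid ξ Q hk]; noncomm_ring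
        rw [h2]
        exact mul_natT_mul_mem_mackey
          (mul_mem (mul_mem ha (sub_mono ξ Q (by omega) hu)) hT)
          (mul_mem hT (sub_mono ξ Q (by omega) hv))
  | zero => simp
  | add x y _ _ hx hy => rw [mul_add, add_mul]; exact add_mem hx hy
  | smul r x _ hx => rw [mul_smul_comm, smul_mul_assoc]; exact Submodule.smul_mem _ _ hx

/-- The cyclotomic relation is used only at `k = 0`. Higher up, stability under `T` implies
stability under `L_{k+1} = ξ⁻¹ (T L_k T + T)`. -/
theorem sub_le_mackey [Nontrivial R] {k : ℕ} (hk : k < n) :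
    ∀ x ∈ sub ξ Q n (k + 1), x ∈ mackey ξ Q n k := by
  induction k with
  | zero =>
    refine sub_le_mackey_of_mul_mem (fun x hx => ?_) (fun x hx => by simp)
    refine mul_mem_mackey_of_forall (fun a ha c hc => ?_) (fun a ha b hb => by simp) hx
    rw [mul_assoc, ← pow_succ]
    rcases lt_or_eq_of_le hc with h | rfl
    · exact mul_natL_mem_mackey ha h
    · exact natL_zero_pow_mem hk ha
  | succ k ih =>
    have hT : ∀ x ∈ mackey ξ Q n (k + 1), x * natT ξ Q n (k + 1) ∈ mackey ξ Q n (k + 1) :=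
      fun x hx => mul_mem_mackey_of_forall (fun a ha c hc => natL_pow_mul_natT_mem hk hc ha)
        (fun a ha b hb => natT_mul_mul_natT_mem hk ha (ih (by omega) b hb)) hx
    refine sub_le_mackey_of_mul_mem (fun x hx => ?_) hT
    rw [natL_succ ξ Q hk, mul_smul_comm, add_mul, one_mul, mul_add, ← mul_assoc, ← mul_assoc]
    exact Submodule.smul_mem _ _ (add_mem
      (hT _ (mackey_mul_sub (hT x hx) (natL_mem_sub ξ Q (by omega)))) (hT x hx))

/-- The new generators are the `d + 1` powers of the last `L`, and `T` times the generators `C` one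
level lower: the smaller subalgebra commutes with `T` and is absorbed on the left. -/
theorem exists_coset_span [Nontrivial R] {k : ℕ} (hk : k < n) :
    ∃ C : Finset (HeckeAlg n (d + 1) ξ Q), C.card ≤ (k + 1) * (d + 1) ∧
      Subalgebra.toSubmodule (sub ξ Q n (k + 1)) ≤
        Subalgebra.toSubmodule (sub ξ Q n k) * Submodule.span R C := by
  classical
  have hL : ∀ (k : ℕ), ∀ a ∈ sub ξ Q n k, ∀ c ≤ d, ∀ C : Set (HeckeAlg n (d + 1) ξ Q),
      a * natL ξ Q n k ^ c ∈ Subalgebra.toSubmodule (sub ξ Q n k) *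
        Submodule.span R ((Finset.range (d + 1)).image (natL ξ Q n k ^ ·) ∪ C) := by
    intro k a ha c hc C
    refine Submodule.mul_mem_mul ha (Submodule.subset_span (Or.inl ?_))
    simp only [Finset.coe_image, Finset.coe_range]
    exact ⟨c, Nat.lt_succ_of_le hc, rfl⟩
  have hcard : ∀ k, ((Finset.range (d + 1)).image (natL ξ Q n k ^ ·)).card ≤ d + 1 := fun k => by
    simpa using Finset.card_image_le (s := Finset.range (d + 1)) (f := (natL ξ Q n k ^ ·))
  induction k with
  | zero =>
    refine ⟨(Finset.range (d + 1)).image (natL ξ Q n 0 ^ ·), by simpa using hcard 0, ?_⟩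
    intro x hx
    have hx' := sub_le_mackey hk x hx
    refine Submodule.span_le.2 ?_ hx'
    rintro _ (⟨a, ha, c, hc, rfl⟩ | ⟨a, ha, b, hb, rfl⟩)
    · simpa using hL 0 a ha c hc ∅
    · simp
  | succ k ih =>
    obtain ⟨C, hC, hspan⟩ := ih (by omega)
    have key : ∀ b ∈ Subalgebra.toSubmodule (sub ξ Q n k) * Submodule.span R
          (C : Set (HeckeAlg n (d + 1) ξ Q)), ∀ a ∈ sub ξ Q n (k + 1),
        a * natT ξ Q n (k + 1) * b ∈ Subalgebra.toSubmodule (sub ξ Q n (k + 1)) *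
          Submodule.span R ((Finset.range (d + 1)).image (natL ξ Q n (k + 1) ^ ·) ∪
            C.image (natT ξ Q n (k + 1) * ·) : Set (HeckeAlg n (d + 1) ξ Q)) := by
      intro b hb a ha
      induction hb using Submodule.mul_induction_on' with
      | mem_mul_mem u hu v hv =>
        induction hv using Submodule.span_induction with
        | mem v hv =>
          have e := (sub_comm_natT ξ Q (show k < k + 1 by omega) hu).eq
          rw [mul_assoc, ← mul_assoc _ u, ← e, mul_assoc, ← mul_assoc a]
          refine Submodule.mul_mem_mul
            (Subalgebra.mul_mem _ ha (sub_mono ξ Q (by omega) hu))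
            (Submodule.subset_span (Or.inr ?_))
          simp only [Finset.coe_image]
          exact ⟨v, hv, rfl⟩
        | zero => simp
        | add v w _ _ hv hw =>
          rw [mul_add, mul_add]; exact add_mem hv hw
        | smul r v _ hv =>
          rw [mul_smul_comm, mul_smul_comm]; exact Submodule.smul_mem _ _ hv
      | add v _ w _ hv hw => rw [mul_add]; exact add_mem hv hw
    refine ⟨(Finset.range (d + 1)).image (natL ξ Q n (k + 1) ^ ·) ∪
      C.image (natT ξ Q n (k + 1) * ·), ?_, ?_⟩
    · refine (Finset.card_union_le _ _).trans ?_
      have := (Finset.card_image_le (s := C) (f := (natT ξ Q n (k + 1) * ·))).trans hC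
      have := hcard (k + 1)
      have e : (k + 1 + 1) * (d + 1) = (d + 1) + (k + 1) * (d + 1) := by ring
      omega
    · intro x hx
      have hx' := sub_le_mackey hk x hx
      refine Submodule.span_le.2 ?_ hx'
      rw [Finset.coe_union]
      rintro _ (⟨a, ha, c, hc, rfl⟩ | ⟨a, ha, b, hb, rfl⟩)
      · exact hL (k + 1) a ha c hc _
      · exact key b (hspan hb) a ha

open scoped Pointwise in
theorem exists_finset_span [Nontrivial R] {k : ℕ} (hk : k ≤ n) :
    ∃ S : Finset (HeckeAlg n (d + 1) ξ Q), S.card ≤ (d + 1) ^ k * k.factorial ∧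
      Subalgebra.toSubmodule (sub ξ Q n k) ≤ Submodule.span R S := by
  classical
  induction k with
  | zero =>
    refine ⟨{1}, by simp, ?_⟩
    have h : sub ξ Q n 0 = ⊥ := by
      simp [sub]
    rw [h, Algebra.toSubmodule_bot, Submodule.one_eq_span, Finset.coe_singleton]
  | succ k ih =>
    obtain ⟨S, hS, h1⟩ := ih (by omega)
    obtain ⟨C, hC, h2⟩ := exists_coset_span (ξ := ξ) (Q := Q) hk
    refine ⟨S * C, ?_, ?_⟩
    · refine Finset.card_mul_le.trans ((Nat.mul_le_mul hS hC).trans (le_of_eq ?_))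
      rw [Nat.factorial_succ]
      ring
    · refine h2.trans ((mul_le_mul' h1 le_rfl).trans ?_)
      rw [Submodule.span_mul_span, Finset.coe_mul]

variable (ξ Q) in
theorem exists_finset_span_eq_top [Nontrivial R] :
    ∃ S : Finset (HeckeAlg n (d + 1) ξ Q), S.card ≤ (d + 1) ^ n * n.factorial ∧
      Submodule.span R (S : Set (HeckeAlg n (d + 1) ξ Q)) = ⊤ := by
  obtain ⟨S, hS, h⟩ := exists_finset_span (ξ := ξ) (Q := Q) (n := n) le_rfl
  rw [sub_top, Algebra.top_toSubmodule, top_le_iff] at h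
  exact ⟨S, hS, h⟩

end Decomposition

end CyclotomicHecke

namespace CyclotomicHecke

/-! ### The standard basis. -/

section StandardBasis

variable {R : Type*} [CommRing R] [IsDomain R] {n d : ℕ} (ξ : Rˣ) (Q : Fin (d + 1) → R)

/-- The exponent vector of a standard monomial. -/
noncomputable def exponent (c : Fin n → Fin (d + 1)) : Fin n →₀ ℕ :=
  Finsupp.equivFunOnFinite.symm fun i => (c i : ℕ)

@[simp] theorem exponent_apply (c : Fin n → Fin (d + 1)) (i : Fin n) : exponent c i = c i := rfl

theorem exponent_le (c : Fin n → Fin (d + 1)) (i : Fin n) : exponent c i ≤ d :=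
  Nat.le_of_lt_succ (c i).2

theorem exponent_injective : Function.Injective (exponent : (Fin n → Fin (d + 1)) → _) := by
  intro c c' h
  ext i
  simpa using DFunLike.congr_fun h i

theorem rep_wordT_reducedWord (w : Equiv.Perm (Fin n)) :
    rep ξ Q (Tw ξ Q w) (unitVec R n d 1) = unitVec R n d w := by
  have h := (exists_reduced_word w).choose_spec
  have h1 := rep_wordT ξ Q (reducedWord w) h.2
  rwa [show wordPerm (reducedWord w) = w from h.1] at h1

theorem rep_monomial (c : Fin n → Fin (d + 1)) (w : Equiv.Perm (Fin n)) :
    rep ξ Q (monomial ξ Q c w) (unitVec R n d 1) = stdVec R (exponent c) (exponent_le c) w := by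
  rw [monomial, map_mul, Module.End.mul_apply, rep_wordT_reducedWord,
    ← rep_evalL_monomial ξ Q, evalL_monomial]
  rfl

/-- The coordinates of an element of the Hecke algebra with respect to the standard monomials. -/
noncomputable def coord : HeckeAlg n (d + 1) ξ Q →ₗ[R]
    ((Fin n → Fin (d + 1)) × Equiv.Perm (Fin n) → R) :=
  LinearMap.pi fun p => MvPolynomial.lcoeff R (exponent p.1) ∘ₗ LinearMap.proj p.2 ∘ₗ
    (lowDegree R n d).subtype ∘ₗ LinearMap.applyₗ (unitVec R n d 1) ∘ₗ (rep ξ Q).toLinearMap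

theorem coord_apply (x : HeckeAlg n (d + 1) ξ Q) (c : Fin n → Fin (d + 1))
    (w : Equiv.Perm (Fin n)) : coord ξ Q x (c, w) =
      MvPolynomial.coeff (exponent c) ((rep ξ Q x (unitVec R n d 1)).1 w) := rfl

theorem coord_monomial (c : Fin n → Fin (d + 1)) (w : Equiv.Perm (Fin n)) :
    coord ξ Q (monomial ξ Q c w) = Pi.single (c, w) 1 := by
  classical
  ext ⟨c', w'⟩
  rw [coord_apply, rep_monomial]
  by_cases hw : w' = w
  · subst hw
    simp [stdVec, MvPolynomial.coeff_monomial, Pi.single_apply, exponent_injective.eq_iff, eq_comm]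
  · simp [stdVec, hw]

theorem coord_surjective : Function.Surjective (coord ξ Q (n := n)) := by
  classical
  intro f
  refine ⟨∑ p, f p • monomial ξ Q p.1 p.2, ?_⟩
  simp only [map_sum, map_smul, coord_monomial]
  ext p
  simp [Finset.sum_apply, Pi.single_apply]

/-- The composite of `R^S` onto the algebra with `coord` is a surjection onto a free module whose
rank is at least `|S|`. By the Orzech property it is injective, hence so is `coord`. -/
theorem coord_bijective : Function.Bijective (coord ξ Q (n := n)) := by
  classical
  refine ⟨?_, coord_surjective ξ Q⟩
  obtain ⟨S, hS, hspan⟩ := exists_finset_span_eq_top ξ Q (n := n)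
  have hg : Function.Surjective (Finsupp.linearCombination R ((↑) : S → HeckeAlg n (d + 1) ξ Q)) := by
    rw [← LinearMap.range_eq_top, Finsupp.range_linearCombination]
    simpa using hspan
  have hcard : Fintype.card S ≤ Fintype.card ((Fin n → Fin (d + 1)) × Equiv.Perm (Fin n)) := by
    simpa [Fintype.card_perm] using hS
  obtain ⟨e⟩ := Function.Embedding.nonempty_of_card_le hcard
  let i : (S →₀ R) →ₗ[R] ((Fin n → Fin (d + 1)) × Equiv.Perm (Fin n) → R) :=
    (Finsupp.linearEquivFunOnFinite R R _).toLinearMap ∘ₗ Finsupp.lmapDomain R R e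
  have hi : Function.Injective i := by
    simp only [i, LinearMap.coe_comp, LinearEquiv.coe_coe]
    exact (LinearEquiv.injective _).comp (Finsupp.mapDomain_injective e.injective)
  have h := OrzechProperty.injective_of_surjective_of_injective i
    (coord ξ Q (n := n) ∘ₗ Finsupp.linearCombination R ((↑) : S → HeckeAlg n (d + 1) ξ Q)) hi
    ((coord_surjective ξ Q).comp hg)
  exact Function.Injective.of_comp_right h hg

/-- The basis of standard monomials. -/
noncomputable def standardBasis :
    Module.Basis ((Fin n → Fin (d + 1)) × Equiv.Perm (Fin n)) R (HeckeAlg n (d + 1) ξ Q) :=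
  Module.Basis.ofEquivFun (LinearEquiv.ofBijective (coord ξ Q) (coord_bijective ξ Q))

theorem standardBasis_apply (c : Fin n → Fin (d + 1)) (w : Equiv.Perm (Fin n)) :
    standardBasis ξ Q (c, w) = monomial ξ Q c w := by
  classical
  rw [standardBasis, Module.Basis.coe_ofEquivFun, LinearEquiv.symm_apply_eq,
    LinearEquiv.ofBijective_apply, coord_monomial]

/-- An element is determined by its action on the unit vector, and there a reduced word shows only
its product. Matsumoto's theorem is bypassed. -/
theorem wordT_eq_Tw {s : List (Fin (n - 1))} (hs : IsReduced s) :
    wordT ξ Q s = Tw ξ Q (wordPerm s) := by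
  apply (coord_bijective ξ Q).1
  ext ⟨c, w⟩
  rw [coord_apply, coord_apply, rep_wordT ξ Q s hs, rep_wordT_reducedWord]

end StandardBasis

end CyclotomicHecke

namespace CyclotomicHecke

open MvPolynomial

set_option linter.unusedSectionVars false

/-! ### The trace functional on polynomials. -/

section PolyTrace

variable {R : Type*} [CommRing R] {n : ℕ} (z : R) (d : ℕ)

/-- The linear function sending `x^c` to `(1 - z) ^ (n d - |c|)`. -/
noncomputable def polyTrace : MvPolynomial (Fin n) R →ₗ[R] R :=
  (basisMonomials (Fin n) R).constr R fun c => (1 - z) ^ (n * d - c.degree)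

theorem polyTrace_monomial (c : Fin n →₀ ℕ) :
    polyTrace z d (MvPolynomial.monomial c 1) = (1 - z) ^ (n * d - c.degree) := by
  have h := (basisMonomials (Fin n) R).constr_basis R (fun c => (1 - z) ^ (n * d - c.degree)) c
  rwa [coe_basisMonomials] at h

theorem swapVar_monomial (i j : Fin n) (c : Fin n →₀ ℕ) :
    swapVar i j (MvPolynomial.monomial c (1 : R)) =
      MvPolynomial.monomial (c.mapDomain (Equiv.swap i j)) 1 :=
  rename_monomial _ _ _

theorem polyTrace_swapVar (i j : Fin n) (f : MvPolynomial (Fin n) R) :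
    polyTrace z d (swapVar i j f) = polyTrace z d f := by
  have h : polyTrace z d ∘ₗ (swapVar i j).toLinearMap = polyTrace (n := n) z d := by
    refine (basisMonomials (Fin n) R).ext fun c => ?_
    rw [coe_basisMonomials, LinearMap.comp_apply, AlgHom.toLinearMap_apply, swapVar_monomial,
      polyTrace_monomial, polyTrace_monomial]
    congr 2
    rw [Finsupp.degree_eq_sum, Finsupp.degree_eq_sum]
    refine Fintype.sum_equiv (Equiv.swap i j) _ _ fun k => ?_
    rw [← Finsupp.mapDomain_apply (Equiv.swap i j).injective c, Equiv.swap_apply_self]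
  exact LinearMap.congr_fun h f

/-- For each monomial `x^c` of `q`, the values at `x^c` and `(z - 1) x_j x^c` cancel. The degree
bound gives `|c| + 1 ≤ n d`, so the exponents do not truncate. -/
theorem polyTrace_linX_mul [IsDomain R] (j : Fin n) {q : MvPolynomial (Fin n) R}
    (h : ∀ k, degreeOf k (X j * q) ≤ d) : polyTrace z d (linX z j * q) = 0 := by
  rw [← support_sum_monomial_coeff q, Finset.mul_sum, map_sum]
  refine Finset.sum_eq_zero fun c hc => ?_
  have h1 : c + Finsupp.single j 1 ∈ (X j * q).support := by
    rw [mem_support_iff, add_comm, coeff_X_mul]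
    exact mem_support_iff.1 hc
  have h2 : c.degree + 1 ≤ n * d := by
    have : (c + Finsupp.single j 1).degree ≤ n * d := by
      rw [Finsupp.degree_eq_sum]
      refine (Finset.sum_le_card_nsmul _ _ d fun k _ => ?_).trans (by simp)
      exact (degreeOf_le_iff.1 (h k)) _ h1
    simpa using this
  have h3 : linX z j * MvPolynomial.monomial c (coeff c q) = coeff c q •
      (MvPolynomial.monomial c 1 + (z - 1) • MvPolynomial.monomial (Finsupp.single j 1 + c) 1) := by
    rw [linX, add_mul, one_mul, mul_assoc, X, monomial_mul, one_mul]
    simp only [C_mul_monomial, smul_monomial, smul_add, smul_eq_mul, mul_one]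
    rw [mul_comm (z - 1)]
  rw [h3, map_smul, map_add, map_smul, polyTrace_monomial, polyTrace_monomial, smul_eq_mul,
    smul_eq_mul, map_add, Finsupp.degree_single,
    show n * d - c.degree = n * d - (1 + c.degree) + 1 by omega, pow_succ]
  ring

theorem polyTrace_demazure [IsDomain R] {i j : Fin n} (hij : i ≠ j) {f : MvPolynomial (Fin n) R}
    (hf : ∀ k, degreeOf k f ≤ d) : polyTrace z d (demazure z i j f) = 0 := by
  rw [demazure_apply]
  refine polyTrace_linX_mul z d j fun k => ?_
  rcases degreeOf_divDiff hij (hf i) (hf j) with h | ⟨h1, h2⟩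
  · simp [h]
  by_cases hkj : k = j
  · subst hkj
    exact degreeOf_mul_le_of_le (degreeOf_X_self k).le le_rfl (by omega)
  · refine degreeOf_mul_le_of_le (degreeOf_X_of_ne hkj).le le_rfl ?_
    rw [zero_add]
    by_cases hki : k = i
    · subst hki; exact h1.le
    · exact (degreeOf_divDiff_of_ne hij hki hkj f).trans (hf k)

end PolyTrace

/-! ### Operators commuting with the action. -/

section Intertwiner

variable {R : Type*} [CommRing R] [IsDomain R] {n d : ℕ} (ξ : Rˣ) (Q : Fin (d + 1) → R)

/-- Among the `L_i` only `L_0` has to be tested, the others being expressions in it and the `T`'s.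
-/
theorem sub_le {ℓ : ℕ} (ξ : Rˣ) (Q : Fin ℓ → R) {k : ℕ} (hk : k ≤ n)
    (S : Subalgebra R (HeckeAlg n ℓ ξ Q)) (hL : 0 < k → natL ξ Q n 0 ∈ S)
    (hT : ∀ i < k, natT ξ Q n i ∈ S) : sub ξ Q n k ≤ S := by
  have h : ∀ i < k, natL ξ Q n i ∈ S := by
    intro i
    induction i with
    | zero => exact hL
    | succ i ih =>
      intro hi
      rw [natL_succ ξ Q (by omega)]
      exact S.smul_mem (mul_mem (add_mem (mul_mem (hT _ hi) (ih (by omega))) (one_mem _))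
        (hT _ hi)) _
  refine Algebra.adjoin_le ?_
  rintro _ (⟨i, hi, rfl⟩ | ⟨i, hi, rfl⟩)
  · exact h i hi
  · exact hT i hi

/-- The elements of the Hecke algebra whose action commutes with an operator `A` (which need not
preserve the representation space). -/
noncomputable def intertwiner
    (A : Module.End R (Equiv.Perm (Fin n) → MvPolynomial (Fin n) R)) :
    Subalgebra R (HeckeAlg n (d + 1) ξ Q) where
  carrier := {x | ∀ F G : lowDegree R n d, G.1 = A F.1 → (rep ξ Q x G).1 = A (rep ξ Q x F).1}
  mul_mem' hx hy F G h := by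
    rw [map_mul, Module.End.mul_apply, Module.End.mul_apply]
    exact hx _ _ (hy _ _ h)
  add_mem' hx hy F G h := by
    rw [map_add, LinearMap.add_apply, LinearMap.add_apply, Submodule.coe_add, Submodule.coe_add,
      map_add, hx _ _ h, hy _ _ h]
  algebraMap_mem' r F G h := by
    rw [AlgHom.commutes, Module.algebraMap_end_apply, Module.algebraMap_end_apply,
      Submodule.coe_smul, Submodule.coe_smul, map_smul, h]

variable {ξ Q}

theorem sub_le_intertwiner {A : Module.End R (Equiv.Perm (Fin n) → MvPolynomial (Fin n) R)}
    {k : ℕ} (hk : k ≤ n)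
    (hL : ∀ i : Fin n, i.1 = 0 → 0 < k → ∀ F, opL Q i (A F) = A (opL Q i F))
    (hT : ∀ i j : Fin n, j.1 = i.1 + 1 → j.1 < k → ∀ F,
      opT (ξ : R) i j (A F) = A (opT (ξ : R) i j F)) :
    sub ξ Q n k ≤ intertwiner ξ Q A := by
  refine sub_le ξ Q hk _ (fun h0 F G h => ?_) (fun i hi F G h => ?_)
  · rw [natL_of_lt ξ Q (show 0 < n by omega), rep_L ξ Q _ rfl, rep_L ξ Q _ rfl, h]
    exact hL _ rfl h0 _
  · rcases i with _ | i
    · simp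
    · rw [natT_succ ξ Q (by omega), rep_T, rep_T, h]
      exact hT _ _ rfl hi _

/-- The action commutes with right multiplication by `T`. -/
theorem rep_rightMulT {k l : Fin n} (hkl : l.1 = k.1 + 1) (x : HeckeAlg n (d + 1) ξ Q)
    {F G : lowDegree R n d} (h : G.1 = rightMulT (ξ : R) k l F.1) :
    (rep ξ Q x G).1 = rightMulT (ξ : R) k l (rep ξ Q x F).1 := by
  have hx : x ∈ sub ξ Q n n := by rw [sub_top]; trivial
  refine sub_le_intertwiner le_rfl (fun i _ _ F => ?_) (fun i j hij _ F => ?_) hx F G h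
  · exact (rightMulT_comp (ξ : R) (redMul Q i) k l F).symm
  · ext1 w
    have e : opT (ξ : R) i j F = (fun w => (swapVar i j).toLinearMap (leftMulT (ξ : R) i j F w)) +
      fun w => demazure (ξ : R) i j (F w) := rfl
    rw [e, map_add, rightMulT_comp, rightMulT_comp, opT_apply,
      leftMulT_rightMulT_comm (ξ : R) hij hkl]
    rfl

theorem rep_X_mul {k : ℕ} (hk : k ≤ n) {m : Fin n} (hm : k ≤ m.1) {x : HeckeAlg n (d + 1) ξ Q}
    (hx : x ∈ sub ξ Q n k) {F G : lowDegree R n d} (h : G.1 = fun w => X m * F.1 w) :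
    (rep ξ Q x G).1 = fun w => X m * (rep ξ Q x F).1 w := by
  refine sub_le_intertwiner (A := (LinearMap.mulLeft R (X m)).compLeft _) hk
    (fun i hi h0 F => ?_) (fun i j hij hj F => ?_) hx F G h
  · ext1 w
    have hmi : m ≠ i := by rintro rfl; omega
    simp only [opL_apply, LinearMap.compLeft_apply, Function.comp, LinearMap.mulLeft_apply,
      redMul_apply, topCoeff_X_mul hmi]
    ring
  · ext1 w
    have hmi : m ≠ i := by rintro rfl; omega
    have hmj : m ≠ j := by rintro rfl; omega
    exact opT_mul (ξ : R) (by rintro rfl; omega) (swapVar_X_of_ne hmi hmj) F w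

theorem rep_stdVec {k : ℕ} (hk : k ≤ n) {x : HeckeAlg n (d + 1) ξ Q} (hx : x ∈ sub ξ Q n k)
    (c : Fin n →₀ ℕ) (hc : ∀ m, c m ≤ d) (hck : ∀ m : Fin n, m.1 < k → c m = 0) :
    (rep ξ Q x (stdVec R c hc 1)).1 =
      fun w => MvPolynomial.monomial c 1 * (rep ξ Q x (unitVec R n d 1)).1 w := by
  induction h : c.degree generalizing c with
  | zero =>
    obtain rfl : c = 0 := (Finsupp.degree_eq_zero_iff c).1 h
    ext1 w
    exact (one_mul _).symm
  | succ N ih =>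
    obtain ⟨m, hm⟩ : ∃ m, c m ≠ 0 := by
      by_contra! h0
      obtain rfl : c = 0 := Finsupp.ext h0
      simp at h
    obtain ⟨c', rfl⟩ : ∃ c', c = Finsupp.single m 1 + c' :=
      ⟨c - Finsupp.single m 1, (add_tsub_cancel_of_le
        (Finsupp.single_le_iff.2 (Nat.one_le_iff_ne_zero.2 hm))).symm⟩
    have hX : (MvPolynomial.monomial (Finsupp.single m 1 + c') 1 : MvPolynomial (Fin n) R) =
        X m * MvPolynomial.monomial c' 1 := by
      rw [X, MvPolynomial.monomial_mul, one_mul]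
    have hc' : ∀ j, c' j ≤ d := fun j => (by simp : c' j ≤ _).trans (hc j)
    have hmk : k ≤ m.1 := by
      by_contra! hlt
      exact hm (hck m hlt)
    have h1 := ih c' hc' (fun j hj => by
      have := hck j hj
      rw [Finsupp.add_apply] at this
      omega) (by simp at h; omega)
    rw [rep_X_mul hk hmk hx (F := stdVec R c' hc' 1), h1]
    · ext1 w; rw [hX, mul_assoc]
    · ext1 w
      by_cases hw : w = 1
      · subst hw; simp [stdVec, hX]
      · simp [stdVec, hw]

/-- The image of the unit vector under `sub k` is supported on permutations of the first `k`
positions. -/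
theorem rep_unitVec_eq_zero {k : ℕ} (hk : k ≤ n) {x : HeckeAlg n (d + 1) ξ Q}
    (hx : x ∈ sub ξ Q n k) {w : Equiv.Perm (Fin n)} {p : Fin n} (hp : k ≤ p.1) (hw : w p ≠ p) :
    (rep ξ Q x (unitVec R n d 1)).1 w = 0 := by
  classical
  -- Truncation to the permutations fixing `p`: it commutes with `A_k`, since the transpositions
  -- involved do not move `p`, and it fixes the unit vector.
  let A : Module.End R (Equiv.Perm (Fin n) → MvPolynomial (Fin n) R) :=
    { toFun := fun F w => if w p = p then F w else 0
      map_add' := fun F G => by ext1 w; simp only [Pi.add_apply]; split_ifs <;> simp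
      map_smul' := fun c F => by ext1 w; simp only [Pi.smul_apply]; split_ifs <;> simp }
  have hA : ∀ F w, A F w = if w p = p then F w else 0 := fun F w => rfl
  have h := sub_le_intertwiner (A := A) (ξ := ξ) (Q := Q) hk (fun i hi h0 F => ?_)
    (fun i j hij hj F => ?_) hx (unitVec R n d 1) (unitVec R n d 1) ?_
  · rw [h, hA, if_neg hw]
  · ext1 w
    simp only [opL_apply, hA]
    split_ifs <;> simp
  · have hs : ∀ w : Equiv.Perm (Fin n), (Equiv.swap i j * w) p = p ↔ w p = p := by
      intro w
      rw [Equiv.Perm.mul_apply, Equiv.swap_apply_eq_iff, Equiv.swap_apply_of_ne_of_ne]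
      · rintro rfl; omega
      · rintro rfl; omega
    ext1 w
    simp only [opT_apply, hA, leftMulT_apply, hs]
    split_ifs <;> simp
  · ext1 w
    rw [hA]
    by_cases hw : w = 1
    · subst hw; simp
    · simp [unitVec, hw]

end Intertwiner

end CyclotomicHecke

namespace CyclotomicHecke

/-! ### The trace on the algebra and its symmetry. -/

section RepTrace

set_option linter.unusedSectionVars false

variable {R : Type*} [CommRing R] [IsDomain R] {n d : ℕ} (ξ : Rˣ) (Q : Fin (d + 1) → R)

/-- The trace function, read off from the action on the unit vector. -/
noncomputable def repTrace : HeckeAlg n (d + 1) ξ Q →ₗ[R] R :=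
  polyTrace (ξ : R) d ∘ₗ LinearMap.proj 1 ∘ₗ (lowDegree R n d).subtype ∘ₗ
    LinearMap.applyₗ (unitVec R n d 1) ∘ₗ (rep ξ Q).toLinearMap

theorem repTrace_apply (x : HeckeAlg n (d + 1) ξ Q) :
    repTrace ξ Q x = polyTrace (ξ : R) d ((rep ξ Q x (unitVec R n d 1)).1 1) := rfl

theorem trace_standardBasis : trace ξ Q (standardBasis ξ Q) = repTrace (n := n) ξ Q := by
  refine (standardBasis ξ Q).ext fun ⟨c, w⟩ => ?_
  rw [trace, Module.Basis.constr_basis, standardBasis_apply, repTrace_apply, rep_monomial,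
    traceValue]
  split_ifs with h
  · subst h
    simp only [stdVec, Pi.single_eq_same]
    rw [polyTrace_monomial, Finsupp.degree_eq_sum]
    simp
  · simp [stdVec, Pi.single_eq_of_ne (Ne.symm h)]

/-- `polyTrace` ignores the exchange of variables and kills the Demazure part; as `1` has no
descents, `leftMulT` at `1` only reads the value at `s_r`. -/
theorem repTrace_T_mul (r : Fin (n - 1)) (x : HeckeAlg n (d + 1) ξ Q) :
    repTrace ξ Q (T ξ Q r * x) = (ξ : R) * polyTrace (ξ : R) d
      ((rep ξ Q x (unitVec R n d 1)).1 (Equiv.swap (lo r) (hi r))) := by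
  have h : ¬ (hi r : Fin n) < lo r := by simp [lo, hi, Fin.lt_def]
  rw [repTrace_apply, map_mul, Module.End.mul_apply, rep_T, opT_apply, map_add,
    polyTrace_swapVar, polyTrace_demazure _ _ (lo_ne_hi r) ((rep ξ Q x _).2 1), add_zero,
    leftMulT_apply, inv_one, if_neg (by simpa using h), map_smul, smul_eq_mul, mul_one]

/-- On the unit vector `T_r` coincides with right multiplication by `T_r`, which can then be moved
past the action of `x`. -/
theorem repTrace_mul_T (r : Fin (n - 1)) (x : HeckeAlg n (d + 1) ξ Q) :
    repTrace ξ Q (x * T ξ Q r) = (ξ : R) * polyTrace (ξ : R) d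
      ((rep ξ Q x (unitVec R n d 1)).1 (Equiv.swap (lo r) (hi r))) := by
  have h : ¬ (hi r : Fin n) < lo r := by simp [lo, hi, Fin.lt_def]
  have hs : (rep ξ Q (T ξ Q r) (unitVec R n d 1)).1 =
      rightMulT (ξ : R) (lo r) (hi r) (unitVec R n d 1).1 := by
    rw [rep_T]
    simp only [unitVec]
    rw [opT_single _ (lo_ne_hi r) (by simpa using h), mul_one]
    ext1 w
    rw [rightMulT_apply]
    by_cases hw : w = Equiv.swap (lo r) (hi r)
    · subst hw
      have h1 : Equiv.swap (lo r : Fin n) (hi r) ≠ 1 := by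
        rw [Ne, Equiv.Perm.one_def, Equiv.swap_eq_refl_iff]
        exact lo_ne_hi r
      have h2 : (lo r : Fin n) < hi r := by simp [lo, hi, Fin.lt_def]
      rw [Equiv.swap_apply_right, Equiv.swap_apply_left, if_pos h2, Equiv.swap_mul_self,
        Pi.single_eq_same, Pi.single_eq_same, Pi.single_eq_of_ne h1, smul_zero, add_zero]
    · have h1 : w * Equiv.swap (lo r) (hi r) ≠ 1 := by
        intro e
        apply hw
        rw [mul_eq_one_iff_eq_inv.1 e, Equiv.swap_inv]
      rw [Pi.single_eq_of_ne hw, Pi.single_eq_of_ne h1]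
      split_ifs with h2
      · have h3 : w ≠ 1 := by rintro rfl; exact h h2
        rw [Pi.single_eq_of_ne h3, smul_zero, add_zero]
      · rw [smul_zero]
  rw [repTrace_apply, map_mul, Module.End.mul_apply,
    rep_rightMulT (show (hi r : Fin n).1 = (lo r : Fin n).1 + 1 from rfl) x hs, rightMulT_apply,
    if_neg (by simpa using h), one_mul, map_smul, smul_eq_mul]

theorem repTrace_T_comm (r : Fin (n - 1)) (x : HeckeAlg n (d + 1) ξ Q) :
    repTrace ξ Q (T ξ Q r * x) = repTrace ξ Q (x * T ξ Q r) := by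
  rw [repTrace_T_mul, repTrace_mul_T]

/-- The elements which can be moved cyclically inside the trace. -/
noncomputable def cyclic (n : ℕ) : Subalgebra R (HeckeAlg n (d + 1) ξ Q) where
  carrier := {x | ∀ y, repTrace ξ Q (x * y) = repTrace ξ Q (y * x)}
  mul_mem' {a b} ha hb y := by rw [mul_assoc, ha, mul_assoc, hb, mul_assoc]
  add_mem' {a b} ha hb y := by rw [add_mul, mul_add, map_add, map_add, ha, hb]
  algebraMap_mem' r y := by rw [Algebra.commutes]

/-- The subalgebra generated by the `T` exchanging two of the positions `0, …, k - 1`. -/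
noncomputable def finSub (n k : ℕ) : Subalgebra R (HeckeAlg n (d + 1) ξ Q) :=
  Algebra.adjoin R (natT ξ Q n '' Set.Iio k)

variable {ξ Q}

theorem mem_cyclic {x : HeckeAlg n (d + 1) ξ Q} :
    x ∈ cyclic ξ Q n ↔ ∀ y, repTrace ξ Q (x * y) = repTrace ξ Q (y * x) := Iff.rfl

theorem natT_mem_cyclic (k : ℕ) : natT ξ Q n k ∈ cyclic ξ Q n := by
  unfold natT
  split_ifs
  · exact repTrace_T_comm ξ Q _
  · exact zero_mem _

theorem finSub_le_cyclic (k : ℕ) : finSub ξ Q n k ≤ cyclic ξ Q n := by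
  refine Algebra.adjoin_le ?_
  rintro _ ⟨i, -, rfl⟩
  exact natT_mem_cyclic i

theorem finSub_le_sub (k : ℕ) : finSub ξ Q n k ≤ sub ξ Q n k :=
  Algebra.adjoin_mono Set.subset_union_right

theorem finSub_mono {i k : ℕ} (h : i ≤ k) : finSub ξ Q n i ≤ finSub ξ Q n k :=
  Algebra.adjoin_mono (Set.image_mono (Set.Iio_subset_Iio h))

/-- `A_{k+1}` is spanned by the `y L_k^c f` with `y ∈ A_k` and `f` in the finite part. -/
theorem sub_succ_le_span {k : ℕ} (hk : k < n) :
    ∀ x ∈ sub ξ Q n (k + 1), x ∈ Submodule.span R {x | ∃ y ∈ sub ξ Q n k, ∃ c ≤ d,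
      ∃ f ∈ finSub ξ Q n (k + 1), x = y * natL ξ Q n k ^ c * f} := by
  induction k with
  | zero =>
    intro x hx
    refine Submodule.span_le.2 ?_ (sub_le_mackey hk x hx)
    rintro _ (⟨a, ha, c, hc, rfl⟩ | ⟨a, ha, b, hb, rfl⟩)
    · exact Submodule.subset_span ⟨a, ha, c, hc, 1, one_mem _, (mul_one _).symm⟩
    · simp
  | succ k ih =>
    intro x hx
    refine Submodule.span_le.2 ?_ (sub_le_mackey hk x hx)
    rintro _ (⟨a, ha, c, hc, rfl⟩ | ⟨a, ha, b, hb, rfl⟩)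
    · exact Submodule.subset_span ⟨a, ha, c, hc, 1, one_mem _, (mul_one _).symm⟩
    · have hb' := ih (by omega) b hb
      rw [SetLike.mem_coe]
      clear hb
      induction hb' using Submodule.span_induction with
      | mem b hb =>
        obtain ⟨y, hy, c, hc, f, hf, rfl⟩ := hb
        have hay : a * y ∈ sub ξ Q n (k + 1) := mul_mem ha (sub_mono ξ Q (by omega) hy)
        have hL : natL ξ Q n k ∈ sub ξ Q n (k + 1) := natL_mem_sub ξ Q (by omega)
        have hf' : f ∈ finSub ξ Q n (k + 1 + 1) := finSub_mono (by omega) hf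
        have hT : natT ξ Q n (k + 1) ∈ finSub ξ Q n (k + 1 + 1) :=
          Algebra.subset_adjoin ⟨k + 1, Nat.lt_succ_self _, rfl⟩
        -- `y` passes `T`, and `natL_pow_mul_natT`, solved for `T L_k^c`, moves `T` to the right
        -- into the finite part.
        have e : a * natT ξ Q n (k + 1) * (y * natL ξ Q n k ^ c * f) =
            a * y * natL ξ Q n (k + 1) ^ c * (natT ξ Q n (k + 1) * f) -
            ∑ i ∈ Finset.range c, (a * y * natL ξ Q n k ^ i *
              natL ξ Q n (k + 1) ^ (c - 1 - i) * f +
              ((ξ : R) - 1) • (a * y * natL ξ Q n k ^ i * natL ξ Q n (k + 1) ^ (c - i) * f)) := by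
          have e1 := (sub_comm_natT ξ Q (show k < k + 1 by omega) hy).eq
          have e2 := natL_pow_mul_natT ξ Q (n := n) hk c
          have e3 : ∑ i ∈ Finset.range c, (a * y * natL ξ Q n k ^ i *
              natL ξ Q n (k + 1) ^ (c - 1 - i) * f +
              ((ξ : R) - 1) • (a * y * natL ξ Q n k ^ i * natL ξ Q n (k + 1) ^ (c - i) * f)) =
              a * y * (∑ i ∈ Finset.range c, natL ξ Q n k ^ i * (natL ξ Q n (k + 1) ^ (c - 1 - i) +
                ((ξ : R) - 1) • natL ξ Q n (k + 1) ^ (c - i))) * f := by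
            rw [Finset.mul_sum, Finset.sum_mul]
            refine Finset.sum_congr rfl fun i _ => ?_
            simp only [mul_add, add_mul, mul_smul_comm, smul_mul_assoc, mul_assoc]
          rw [e3, eq_sub_of_add_eq' e2.symm]
          linear_combination (norm := noncomm_ring) -a * e1 * natL ξ Q n k ^ c * f
        rw [e]
        refine sub_mem (Submodule.subset_span ⟨_, hay, c, hc, _, mul_mem hT hf', rfl⟩)
          (sum_mem fun i _ => add_mem ?_ (Submodule.smul_mem _ _ ?_))
        · exact Submodule.subset_span
            ⟨_, mul_mem hay (pow_mem hL i), c - 1 - i, by omega, f, hf', rfl⟩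
        · exact Submodule.subset_span
            ⟨_, mul_mem hay (pow_mem hL i), c - i, by omega, f, hf', rfl⟩
      | zero => simp
      | add x y _ _ hx hy => rw [mul_add]; exact add_mem hx hy
      | smul r x _ hx => rw [mul_smul_comm]; exact Submodule.smul_mem _ _ hx

/-- The monomial `x^c`, evaluated at the `L_i`. -/
noncomputable abbrev monL {ℓ : ℕ} (ξ : Rˣ) (Q : Fin ℓ → R) (c : Fin n →₀ ℕ) :
    HeckeAlg n ℓ ξ Q :=
  evalL ξ Q (MvPolynomial.monomial c 1)

theorem monL_add (b c : Fin n →₀ ℕ) : monL ξ Q (b + c) = monL ξ Q b * monL ξ Q c := by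
  rw [monL, monL, monL, ← map_mul, MvPolynomial.monomial_mul, one_mul]

theorem monL_single {k : ℕ} (hk : k < n) (b : ℕ) :
    monL ξ Q (Finsupp.single ⟨k, hk⟩ b) = natL ξ Q n k ^ b := by
  rw [natL_of_lt ξ Q hk, ← evalL_X, ← map_pow, MvPolynomial.X_pow_eq_monomial]

theorem commute_monL {x : HeckeAlg n (d + 1) ξ Q} {c : Fin n →₀ ℕ}
    (h : ∀ m : Fin n, c m ≠ 0 → Commute x (L ξ Q m)) : Commute x (monL ξ Q c) := by
  rw [monL, evalL_monomial]
  refine Commute.list_prod_right _ _ fun y hy => ?_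
  obtain ⟨m, rfl⟩ := List.mem_ofFn.1 hy
  by_cases hm : c m = 0
  · rw [hm, pow_zero]; exact Commute.one_right _
  · exact (h m hm).pow_right _

theorem commute_monL_of_mem_sub {k : ℕ} {x : HeckeAlg n (d + 1) ξ Q} (hx : x ∈ sub ξ Q n k)
    {c : Fin n →₀ ℕ} (hc : ∀ m : Fin n, m.1 < k → c m = 0) : Commute x (monL ξ Q c) :=
  commute_monL fun m hm => by
    rw [← natL_of_lt ξ Q m.2]
    exact sub_comm_natL ξ Q (by by_contra! h; exact hm (hc m h)) hx

theorem natT_commute_monL {k : ℕ} {c : Fin n →₀ ℕ} (hc : ∀ m : Fin n, m.1 ≤ k → c m = 0) :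
    Commute (natT ξ Q n k) (monL ξ Q c) :=
  commute_monL fun m hm => by
    rw [← natL_of_lt ξ Q m.2]
    have : k < m.1 := by by_contra! h; exact hm (hc m h)
    exact natT_comm_natL ξ Q (by omega) (by omega)

theorem rep_mul_monL {k : ℕ} (hk : k ≤ n) {h : HeckeAlg n (d + 1) ξ Q} (hh : h ∈ sub ξ Q n k)
    {c : Fin n →₀ ℕ} (hc : ∀ m, c m ≤ d) (hck : ∀ m : Fin n, m.1 < k → c m = 0) :
    (rep ξ Q (h * monL ξ Q c) (unitVec R n d 1)).1 =
      fun w => MvPolynomial.monomial c 1 * (rep ξ Q h (unitVec R n d 1)).1 w := by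
  rw [map_mul, Module.End.mul_apply, rep_evalL_monomial ξ Q c hc, rep_stdVec hk hh c hc hck]

/-- The trace reads off the value at a transposition that moves position `k`, where the image of the
unit vector under `A_k` vanishes. -/
theorem repTrace_mul_monL_mul_natT {k : ℕ} (hk : k < n) {h : HeckeAlg n (d + 1) ξ Q}
    (hh : h ∈ sub ξ Q n k) {c : Fin n →₀ ℕ} (hc : ∀ m, c m ≤ d)
    (hck : ∀ m : Fin n, m.1 < k → c m = 0) :
    repTrace ξ Q (h * monL ξ Q c * natT ξ Q n k) = 0 := by
  rcases k with _ | k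
  · simp
  rw [natT_succ ξ Q hk, repTrace_mul_T, rep_mul_monL hk.le hh hc hck]
  beta_reduce
  rw [rep_unitVec_eq_zero hk.le hh (p := ⟨k + 1, hk⟩) le_rfl, mul_zero, map_zero, mul_zero]
  · have : Equiv.swap (lo (⟨k, by omega⟩ : Fin (n - 1))) (hi ⟨k, by omega⟩) (⟨k + 1, hk⟩ : Fin n) =
      ⟨k, by omega⟩ := Equiv.swap_apply_right _ _
    rw [this]
    simp

theorem repTrace_mul_monL_add {k : ℕ} (hk : k < n) {h : HeckeAlg n (d + 1) ξ Q}
    (hh : h ∈ sub ξ Q n k) {c : Fin n →₀ ℕ} (hc : ∀ m, c m ≤ d)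
    (hck : ∀ m : Fin n, m.1 < k → c m = 0) (hkd : c ⟨k, hk⟩ < d) :
    repTrace ξ Q (h * monL ξ Q c) +
      ((ξ : R) - 1) * repTrace ξ Q (h * monL ξ Q (Finsupp.single ⟨k, hk⟩ 1 + c)) = 0 := by
  have hc' : ∀ m : Fin n, (Finsupp.single (⟨k, hk⟩ : Fin n) 1 + c : Fin n →₀ ℕ) m ≤ d := by
    intro m
    rw [Finsupp.add_apply, Finsupp.single_apply]
    split_ifs with e
    · subst e; omega
    · simpa using hc m
  have hck' : ∀ m : Fin n, m.1 < k → (Finsupp.single (⟨k, hk⟩ : Fin n) 1 + c : Fin n →₀ ℕ) m = 0 := by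
    intro m hm
    rw [Finsupp.add_apply, hck m hm, Finsupp.single_apply, if_neg (by rintro rfl; simp at hm)]
  have e := rep_mul_monL hk.le hh hc' hck'
  have hX : (MvPolynomial.monomial (Finsupp.single (⟨k, hk⟩ : Fin n) 1 + c) (1 : R)) =
      MvPolynomial.X ⟨k, hk⟩ * MvPolynomial.monomial c 1 := by
    rw [MvPolynomial.X, MvPolynomial.monomial_mul, one_mul]
  -- The vector obtained with the larger exponent still lies in `lowDegree`; this is the degree
  -- bound for `polyTrace_linX_mul`.
  have hlow := (rep ξ Q (h * monL ξ Q (Finsupp.single ⟨k, hk⟩ 1 + c)) (unitVec R n d 1)).2 1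
  rw [e, hX] at hlow
  simp only [mul_assoc] at hlow
  have key := polyTrace_linX_mul (ξ : R) d _ hlow
  rw [repTrace_apply, repTrace_apply, e, rep_mul_monL hk.le hh hc hck, hX, ← smul_eq_mul,
    ← map_smul, ← map_add, ← key]
  congr 1
  simp only [linX, MvPolynomial.smul_eq_C_mul]
  ring

/-- Write `g'` as `y L^b f` with `f` in the finite part. Then `y` passes `T`, and `f` moves
cyclically to the front. Straightening `T L^b` leaves a term ending in `T`, of trace zero by
`repTrace_mul_monL_mul_natT`, and pairs cancelling by `repTrace_mul_monL_add`. -/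
theorem repTrace_mul_natT_mul {k : ℕ} (hk : k < n) {g g' : HeckeAlg n (d + 1) ξ Q}
    (hg : g ∈ sub ξ Q n k) (hg' : g' ∈ sub ξ Q n k) {c : Fin n →₀ ℕ} (hc : ∀ m, c m ≤ d)
    (hck : ∀ m : Fin n, m.1 ≤ k → c m = 0) :
    repTrace ξ Q (g * natT ξ Q n k * g' * monL ξ Q c) = 0 := by
  rcases k with _ | k
  · simp
  have hsingle : ∀ b ≤ d, (∀ m : Fin n, (Finsupp.single (⟨k + 1, hk⟩ : Fin n) b + c) m ≤ d) ∧
      (∀ m : Fin n, m.1 < k + 1 → (Finsupp.single (⟨k + 1, hk⟩ : Fin n) b + c) m = 0) ∧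
      (Finsupp.single (⟨k + 1, hk⟩ : Fin n) b + c) ⟨k + 1, hk⟩ = b := by
    intro b hb
    have h0 := hck ⟨k + 1, hk⟩ le_rfl
    refine ⟨fun m => ?_, fun m hm => ?_, by simp [h0]⟩
    · rw [Finsupp.add_apply, Finsupp.single_apply]
      split_ifs with e
      · subst e; omega
      · simpa using hc m
    · rw [Finsupp.add_apply, hck m hm.le, Finsupp.single_apply,
        if_neg (by rintro rfl; simp at hm)]
  have hg'' := sub_succ_le_span (ξ := ξ) (Q := Q) (show k < n by omega) g' hg'
  clear hg'
  induction hg'' using Submodule.span_induction with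
  | mem g' hg' =>
    obtain ⟨y, hy, b, hb, f, hf, rfl⟩ := hg'
    have hfs := finSub_le_sub _ hf
    have hfu : Commute f (monL ξ Q c) := commute_monL_of_mem_sub hfs fun m hm => hck m hm.le
    have hTu : Commute (natT ξ Q n (k + 1)) (monL ξ Q c) := natT_commute_monL hck
    have hyT := (sub_comm_natT ξ Q (show k < k + 1 by omega) hy).eq
    have hL : natL ξ Q n k ∈ sub ξ Q n (k + 1) := natL_mem_sub ξ Q (by omega)
    have hh : f * g * y ∈ sub ξ Q n (k + 1) :=
      mul_mem (mul_mem hfs hg) (sub_mono ξ Q (by omega) hy)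
    have e1 : g * natT ξ Q n (k + 1) * (y * natL ξ Q n k ^ b * f) * monL ξ Q c =
        g * y * natT ξ Q n (k + 1) * natL ξ Q n k ^ b * monL ξ Q c * f := by
      linear_combination (norm := noncomm_ring) -g * hyT * natL ξ Q n k ^ b * f * monL ξ Q c +
        g * y * natT ξ Q n (k + 1) * natL ξ Q n k ^ b * hfu.eq
    have e2 : f * (g * y * natT ξ Q n (k + 1) * natL ξ Q n k ^ b * monL ξ Q c) =
        f * g * y * monL ξ Q (Finsupp.single ⟨k + 1, hk⟩ b + c) * natT ξ Q n (k + 1) -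
        ∑ i ∈ Finset.range b, (f * g * y * natL ξ Q n k ^ i *
            monL ξ Q (Finsupp.single ⟨k + 1, hk⟩ (b - 1 - i) + c) +
          ((ξ : R) - 1) • (f * g * y * natL ξ Q n k ^ i *
            monL ξ Q (Finsupp.single ⟨k + 1, hk⟩ (b - i) + c))) := by
      have e3 : ∑ i ∈ Finset.range b, (f * g * y * natL ξ Q n k ^ i *
            monL ξ Q (Finsupp.single ⟨k + 1, hk⟩ (b - 1 - i) + c) +
          ((ξ : R) - 1) • (f * g * y * natL ξ Q n k ^ i *
            monL ξ Q (Finsupp.single ⟨k + 1, hk⟩ (b - i) + c))) =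
          f * g * y * (∑ i ∈ Finset.range b, natL ξ Q n k ^ i *
            (natL ξ Q n (k + 1) ^ (b - 1 - i) +
              ((ξ : R) - 1) • natL ξ Q n (k + 1) ^ (b - i))) * monL ξ Q c := by
        rw [Finset.mul_sum, Finset.sum_mul]
        refine Finset.sum_congr rfl fun i _ => ?_
        simp only [monL_add, monL_single, mul_add, add_mul, mul_smul_comm, smul_mul_assoc,
          mul_assoc]
      have e4 := natL_pow_mul_natT ξ Q (n := n) hk b
      rw [e3, monL_add, monL_single, eq_sub_of_add_eq' e4.symm]
      linear_combination (norm := noncomm_ring) f * g * y * natL ξ Q n (k + 1) ^ b * hTu.eq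
    rw [e1, ← mem_cyclic.1 (finSub_le_cyclic _ hf), e2, map_sub,
      repTrace_mul_monL_mul_natT hk hh (hsingle b hb).1 (hsingle b hb).2.1, zero_sub,
      neg_eq_zero, map_sum]
    refine Finset.sum_eq_zero fun i hi => ?_
    have hi' := Finset.mem_range.1 hi
    obtain ⟨s1, s2, s3⟩ := hsingle (b - 1 - i) (by omega)
    have := repTrace_mul_monL_add hk (mul_mem hh (pow_mem hL i)) s1 s2 (by omega)
    rw [← add_assoc, ← Finsupp.single_add, show 1 + (b - 1 - i) = b - i by omega] at this
    rw [map_add, map_smul, smul_eq_mul, this]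
  | zero => simp
  | add x y _ _ hx hy => rw [mul_add, add_mul, map_add, hx, hy, add_zero]
  | smul r x _ hx => rw [mul_smul_comm, smul_mul_assoc, map_smul, hx, smul_zero]

/-- The monomial in the later `L_i` makes the induction on `k` work: a summand `a L_k^b` of `h`
passes its power to `c` and leaves `a ∈ A_k`, while for a summand `a T b` both traces vanish. -/
theorem repTrace_natL_zero_mul {k : ℕ} (hk : k ≤ n) {h : HeckeAlg n (d + 1) ξ Q}
    (hh : h ∈ sub ξ Q n k) {c : Fin n →₀ ℕ} (hc : ∀ m, c m ≤ d)
    (hck : ∀ m : Fin n, m.1 < k → c m = 0) :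
    repTrace ξ Q (natL ξ Q n 0 * (h * monL ξ Q c)) =
      repTrace ξ Q (h * monL ξ Q c * natL ξ Q n 0) := by
  have hcomm : ∀ c, Commute (natL ξ Q n 0) (monL ξ Q c) := fun c =>
    commute_monL fun m _ => by rw [← natL_of_lt ξ Q m.2]; exact natL_comm ξ Q _ _
  induction k generalizing h c with
  | zero =>
    rw [← mul_assoc, (sub_comm_natL ξ Q le_rfl hh).eq.symm, mul_assoc, (hcomm c).eq, mul_assoc]
  | succ k ih =>
    have hh' := sub_le_mackey (show k < n by omega) h hh
    clear hh
    induction hh' using Submodule.span_induction with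
    | mem x hx =>
      rcases hx with ⟨a, ha, b, hb, rfl⟩ | ⟨a, ha, b, hb, rfl⟩
      · rw [mul_assoc a, ← monL_single (show k < n by omega), ← monL_add]
        refine ih (by omega) ha (fun m => ?_) (fun m hm => ?_)
        · have h0 := hck ⟨k, by omega⟩ (Nat.lt_succ_self k)
          rw [Finsupp.add_apply, Finsupp.single_apply]
          split_ifs with e
          · subst e; omega
          · simpa using hc m
        · rw [Finsupp.add_apply, hck m (by omega), Finsupp.single_apply,
            if_neg (by rintro rfl; simp at hm)]
      · rcases k with _ | k
        · simp
        · have hL : natL ξ Q n 0 ∈ sub ξ Q n (k + 1) := natL_mem_sub ξ Q (by omega)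
          have hck' : ∀ m : Fin n, m.1 ≤ k + 1 → c m = 0 := fun m hm => hck m (by omega)
          have e1 := repTrace_mul_natT_mul (by omega) (mul_mem hL ha) hb hc hck'
          have e2 := repTrace_mul_natT_mul (by omega) ha (mul_mem hb hL) hc hck'
          rw [mul_assoc _ (monL ξ Q c), ← (hcomm c).eq]
          simp only [mul_assoc] at e1 e2 ⊢
          rw [e1, e2]
    | zero => simp
    | add x y _ _ hx hy => simp only [add_mul, mul_add, map_add, hx, hy]
    | smul r x _ hx => simp only [smul_mul_assoc, mul_smul_comm, map_smul, hx]

variable (ξ Q) in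
theorem repTrace_mul_comm (x y : HeckeAlg n (d + 1) ξ Q) :
    repTrace ξ Q (x * y) = repTrace ξ Q (y * x) := by
  have hx : x ∈ sub ξ Q n n := by rw [sub_top]; trivial
  refine sub_le ξ Q le_rfl (cyclic ξ Q n) (fun _ z => ?_) (fun i _ => natT_mem_cyclic i) hx y
  have hz : z ∈ sub ξ Q n n := by rw [sub_top]; trivial
  have h := repTrace_natL_zero_mul (c := 0) le_rfl hz (fun _ => Nat.zero_le _) (fun _ _ => rfl)
  have h1 : monL ξ Q (0 : Fin n →₀ ℕ) = 1 := by
    rw [monL, MvPolynomial.monomial_zero', map_one, map_one]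
  rwa [h1, mul_one] at h

end RepTrace

end CyclotomicHecke

theorem theorem3 {R : Type*} [CommRing R] [IsDomain R] (n ℓ : ℕ) (hℓ : 1 ≤ ℓ)
    (ξ : Rˣ) (Q : Fin ℓ → R) :
    -- `T_w` does not depend on the choice of the reduced expression of `w`
    (∀ s : List (Fin (n - 1)), CyclotomicHecke.IsReduced s →
      CyclotomicHecke.wordT ξ Q s =
        CyclotomicHecke.Tw ξ Q (CyclotomicHecke.wordPerm s)) ∧
    -- the standard monomials form a basis, so that the trace function is well defined,
    -- and the trace function is symmetric
    ∃ b : Module.Basis ((Fin n → Fin ℓ) × Equiv.Perm (Fin n)) R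
        (CyclotomicHecke.HeckeAlg n ℓ ξ Q),
      (∀ c w, b (c, w) = CyclotomicHecke.monomial ξ Q c w) ∧
      (∀ x y : CyclotomicHecke.HeckeAlg n ℓ ξ Q,
        CyclotomicHecke.trace ξ Q b (x * y) = CyclotomicHecke.trace ξ Q b (y * x)) ∧
      (CyclotomicHecke.inducedForm ξ Q (CyclotomicHecke.trace ξ Q b)).IsSymm := by
  obtain ⟨d, rfl⟩ : ∃ d, ℓ = d + 1 := ⟨ℓ - 1, by omega⟩
  have h := CyclotomicHecke.repTrace_mul_comm ξ Q (n := n)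
  rw [← CyclotomicHecke.trace_standardBasis] at h
  exact ⟨fun s hs => CyclotomicHecke.wordT_eq_Tw ξ Q hs, CyclotomicHecke.standardBasis ξ Q,
    CyclotomicHecke.standardBasis_apply ξ Q, h, ⟨h⟩⟩
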